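/- Let $n\ge 1$ and $0<\lambda\le\Lambda<\infty$, let $B_1$ be the open unit ball of $\mathbb R^n$, and let $\mathcal P^{\pm}$ be the Pucci extremal operators: for a symmetric matrix $X$ with eigenvalues $e_i$, $$\mathcal P^+(X)=\lambda\sum_{e_i<0}e_i+\Lambda\sum_{e_i>0}e_i,\qquad \mathcal P^-(X)=\lambda\sum_{e_i>0}e_i+\Lambda\sum_{e_i<0}e_i .$$ There is a constant $\sigma=\sigma(n,\lambda,\Lambda)\in(0,1]$, and for every $\delta\in(0,\sigma)$ a constant $C=C(n,\lambda,\Lambda,\delta)>0$, such that the following holds for every $0\le\gamma<1$. Let $u\in C^0(\overline{B_1})$ and $f\in C^0(B_1)\cap L^\infty(B_1)$ satisfy $$|Du|^{-\gamma}\mathcal P^-(D^2u)-|Du|^{1-\gamma}\le f\le |Du|^{-\gamma}\mathcal P^+(D^2u)+|Du|^{1-\gamma}\quad\text{in }B_1$$ in the viscosity sense: for every $\varphi\in C^2(B_1)$ and $x_0\in B_1$ such that $\varphi$ touches $u$ at $x_0$ from below (resp. from above) in a neighbourhood of $x_0$, the left (resp. right) inequality holds at $x_0$ with $D\varphi(x_0),D^2\varphi(x_0)$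 in place of $Du,D^2u$; if $\gamma>0$, only $\varphi$ with $D\varphi(x_0)\ne0$ are tested. Then $u\in W^{2,\delta}(B_1)$ and $$\|u\|_{W^{2,\delta}(B_1)}\le C\Big(\|u\|_{L^\infty(B_1)}+\|f\|_{L^\infty(B_1)}^{\frac1{1-\gamma}}\Big).$$ Here, as $\delta<1$, $u\in W^{2,\delta}(B_1)$ means that $u$ has a second-order Taylor expansion (with error $o(|y-x|^2)$ as $y\to x$) at almost every $x\in B_1$, and that $u$ and the resulting measurable functions $D_iu$, $D_{ij}u$ belong to $L^\delta(B_1)$, with $$\|u\|_{W^{2,\delta}(B_1)}=\Big(\int_{B_1}|u|^\delta+\sum_i\int_{B_1}|D_iu|^\delta+\sum_{i,j}\int_{B_1}|D_{ij}u|^\delta\Big)^{1/\delta}.$$ Moreover the same bound holds for $\|\Theta\|_{L^\delta(B_1)}$, where $\Theta(x)\in[0,\infty]$ is the infimum of all $M\ge0$ for which there are $p,q\in\mathbb R^n$ with $$u(x)+p\cdot(y-x)-\tfrac M2|y-x|^2\le u(y)\le u(x)+q\cdot(y-x)+\tfrac M2|y-x|^2\quad\text{for all }y\in B_1 .$$ 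-/

import Mathlib

open MeasureTheory Metric Topology Asymptotics
open scoped ENNReal NNReal

/-- The maximal Pucci extremal operator with ellipticity constants `lam ≤ Lam`, evaluated on a
real symmetric matrix through its eigenvalues (counted with multiplicity). It is only ever
evaluated on symmetric matrices; the value `0` elsewhere is a convention. -/
noncomputable def pucciMax {n : ℕ} (lam Lam : ℝ) (X : Matrix (Fin n) (Fin n) ℝ) : ℝ :=
  open Classical in
  if h : X.IsHermitian then
    lam * (∑ i with h.eigenvalues i < 0, h.eigenvalues i)
      + Lam * (∑ i with 0 < h.eigenvalues i, h.eigenvalues i)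
  else 0

/-- The minimal Pucci extremal operator. -/
noncomputable def pucciMin {n : ℕ} (lam Lam : ℝ) (X : Matrix (Fin n) (Fin n) ℝ) : ℝ :=
  open Classical in
  if h : X.IsHermitian then
    lam * (∑ i with 0 < h.eigenvalues i, h.eigenvalues i)
      + Lam * (∑ i with h.eigenvalues i < 0, h.eigenvalues i)
  else 0

/-- The classical Hessian matrix of `φ` at `x`, with entries `D_i D_j φ (x)`. -/
noncomputable def hessianMatrix {n : ℕ} (φ : EuclideanSpace ℝ (Fin n) → ℝ)
    (x : EuclideanSpace ℝ (Fin n)) : Matrix (Fin n) (Fin n) ℝ :=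
  Matrix.of fun i j =>
    fderiv ℝ (fderiv ℝ φ) x (EuclideanSpace.single i 1) (EuclideanSpace.single j 1)

/-- The Hessian matrix of a function that is `C²` in an open set is symmetric there. -/
theorem hessianMatrix_isHermitian {n : ℕ} {φ : EuclideanSpace ℝ (Fin n) → ℝ}
    {Ω : Set (EuclideanSpace ℝ (Fin n))} (hΩ : IsOpen Ω) (hφ : ContDiffOn ℝ 2 φ Ω)
    {x : EuclideanSpace ℝ (Fin n)} (hx : x ∈ Ω) : (hessianMatrix φ x).IsHermitian := by
  have h : IsSymmSndFDerivAt ℝ φ x :=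
    (hφ.contDiffAt (hΩ.mem_nhds hx)).isSymmSndFDerivAt (by simp)
  ext i j
  simpa [hessianMatrix] using h.eq _ _

/-- `v` touches `w` from below at `x₀` in `U`. -/
def TouchesFromBelow {n : ℕ} (v w : EuclideanSpace ℝ (Fin n) → ℝ)
    (x₀ : EuclideanSpace ℝ (Fin n)) (U : Set (EuclideanSpace ℝ (Fin n))) : Prop :=
  x₀ ∈ U ∧ v x₀ = w x₀ ∧ ∀ x ∈ U, v x ≤ w x

/-- `|Du|^{-γ} P^-(D²u) - |Du|^{1-γ} ≤ f` in `Ω` in the viscosity sense: the inequality holds at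
`x₀` for every `C²` function `φ` touching `u` from below at `x₀` in a neighbourhood of `x₀`. When
`γ > 0` the left-hand side has no meaning where `Dφ(x₀) = 0`, and such `φ` are not tested; when
`γ = 0` the inequality is `P^-(D²u) - |Du| ≤ f` and all `φ` are tested. -/
def IsViscositySupersol {n : ℕ} (lam Lam γ : ℝ) (Ω : Set (EuclideanSpace ℝ (Fin n)))
    (f u : EuclideanSpace ℝ (Fin n) → ℝ) : Prop :=
  ∀ φ : EuclideanSpace ℝ (Fin n) → ℝ, ContDiffOn ℝ 2 φ Ω →
    ∀ x₀ ∈ Ω, ∀ U : Set (EuclideanSpace ℝ (Fin n)), IsOpen U → U ⊆ Ω →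
      TouchesFromBelow φ u x₀ U → (γ = 0 ∨ gradient φ x₀ ≠ 0) →
        ‖gradient φ x₀‖ ^ (-γ) * pucciMin lam Lam (hessianMatrix φ x₀)
          - ‖gradient φ x₀‖ ^ (1 - γ) ≤ f x₀

/-- `f ≤ |Du|^{-γ} P^+(D²u) + |Du|^{1-γ}` in `Ω` in the viscosity sense: the same with `C²`
functions `φ` touching `u` from above. -/
def IsViscositySubsol {n : ℕ} (lam Lam γ : ℝ) (Ω : Set (EuclideanSpace ℝ (Fin n)))
    (f u : EuclideanSpace ℝ (Fin n) → ℝ) : Prop :=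
  ∀ φ : EuclideanSpace ℝ (Fin n) → ℝ, ContDiffOn ℝ 2 φ Ω →
    ∀ x₀ ∈ Ω, ∀ U : Set (EuclideanSpace ℝ (Fin n)), IsOpen U → U ⊆ Ω →
      TouchesFromBelow u φ x₀ U → (γ = 0 ∨ gradient φ x₀ ≠ 0) →
        f x₀ ≤ ‖gradient φ x₀‖ ^ (-γ) * pucciMax lam Lam (hessianMatrix φ x₀)
          + ‖gradient φ x₀‖ ^ (1 - γ)

/-- `u` has at `x` the second-order Taylor expansion
`u(y) = u(x) + p·(y - x) + (y - x)ᵀ A (y - x) / 2 + o(|y - x|²)` with `A` symmetric; `p` and `A`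
are then unique, and they are the pointwise gradient and Hessian of `u` at `x`. -/
def HasSecondOrderExpansionAt {n : ℕ} (u : EuclideanSpace ℝ (Fin n) → ℝ)
    (x p : EuclideanSpace ℝ (Fin n)) (A : Matrix (Fin n) (Fin n) ℝ) : Prop :=
  A.IsSymm ∧
    (fun y => u y - u x - ∑ i, p i * (y i - x i)
        - (1 / 2) * ∑ i, ∑ j, A i j * (y i - x i) * (y j - x j))
      =o[𝓝 x] fun y => ‖y - x‖ ^ 2

/-- The measurable functions `Du`, `D2u` are the gradient and the Hessian of `u` almost everywhere
in `Ω`. They are determined by `u` up to null sets. -/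
structure IsGradHess {n : ℕ} (Ω : Set (EuclideanSpace ℝ (Fin n)))
    (u : EuclideanSpace ℝ (Fin n) → ℝ)
    (Du : EuclideanSpace ℝ (Fin n) → EuclideanSpace ℝ (Fin n))
    (D2u : EuclideanSpace ℝ (Fin n) → Matrix (Fin n) (Fin n) ℝ) : Prop where
  aemeasurable_grad : ∀ i, AEMeasurable (fun x => Du x i) (volume.restrict Ω)
  aemeasurable_hess : ∀ i j, AEMeasurable (fun x => D2u x i j) (volume.restrict Ω)
  expansion : ∀ᵐ x ∂(volume.restrict Ω), HasSecondOrderExpansionAt u x (Du x) (D2u x)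

/-- Membership in `W^{2,δ}(Ω)` for an exponent `0 < δ < 1`. Functions in `L^δ` need not be locally
integrable, so that the derivatives are the pointwise ones, which have to exist almost everywhere
in `Ω`; the function and its derivatives of order one and two have to lie in `L^δ(Ω)`. -/
def MemSobolevTwo {n : ℕ} (δ : ℝ) (Ω : Set (EuclideanSpace ℝ (Fin n)))
    (u : EuclideanSpace ℝ (Fin n) → ℝ) : Prop :=
  ∃ (Du : EuclideanSpace ℝ (Fin n) → EuclideanSpace ℝ (Fin n))
    (D2u : EuclideanSpace ℝ (Fin n) → Matrix (Fin n) (Fin n) ℝ),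
    IsGradHess Ω u Du D2u ∧
      MemLp u (ENNReal.ofReal δ) (volume.restrict Ω) ∧
      (∀ i, MemLp (fun x => Du x i) (ENNReal.ofReal δ) (volume.restrict Ω)) ∧
      ∀ i j, MemLp (fun x => D2u x i j) (ENNReal.ofReal δ) (volume.restrict Ω)

/-- The quasi-norm of `W^{2,δ}(Ω)`,
`(∫ |u|^δ + ∑ i, ∫ |D_i u|^δ + ∑ i j, ∫ |D_ij u|^δ)^{1/δ}` with integrals over `Ω`. The infimum is
over versions of the almost everywhere unique derivatives, which all give the same value; it is
`∞` if there are none. -/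
noncomputable def sobolevTwoNorm {n : ℕ} (δ : ℝ) (Ω : Set (EuclideanSpace ℝ (Fin n)))
    (u : EuclideanSpace ℝ (Fin n) → ℝ) : ℝ≥0∞ :=
  ⨅ (Du : EuclideanSpace ℝ (Fin n) → EuclideanSpace ℝ (Fin n))
    (D2u : EuclideanSpace ℝ (Fin n) → Matrix (Fin n) (Fin n) ℝ)
    (_ : IsGradHess Ω u Du D2u),
    ((∫⁻ x in Ω, ‖u x‖ₑ ^ δ) + (∑ i, ∫⁻ x in Ω, ‖Du x i‖ₑ ^ δ)
      + ∑ i, ∑ j, ∫⁻ x in Ω, ‖D2u x i j‖ₑ ^ δ) ^ (1 / δ)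

/-- `paraboloidOpening u Ω x` is the least opening `M ∈ [0, ∞]` such that a concave and a convex
paraboloid of opening `M` touch `u` at `x` in `Ω` from below and from above. -/
noncomputable def paraboloidOpening {n : ℕ} (u : EuclideanSpace ℝ (Fin n) → ℝ)
    (Ω : Set (EuclideanSpace ℝ (Fin n))) (x : EuclideanSpace ℝ (Fin n)) : ℝ≥0∞ :=
  ⨅ (M : ℝ≥0)
    (_ : (∃ p : EuclideanSpace ℝ (Fin n), TouchesFromBelow
          (fun y => u x + inner ℝ p (y - x) - (M : ℝ) / 2 * ‖y - x‖ ^ 2) u x Ω) ∧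
        ∃ q : EuclideanSpace ℝ (Fin n), TouchesFromBelow
          u (fun y => u x + inner ℝ q (y - x) + (M : ℝ) / 2 * ‖y - x‖ ^ 2) x Ω),
    (M : ℝ≥0∞)

/-
If `K ≥ ‖u‖_∞ + ‖f‖_∞ ^ (1 / (1 - γ))`, Young's inequality turns both singular inequalities into
`P^-(D²u) ≤ K + 2 |Du|`, for `u` and for `-u`; this no longer depends on `γ`, and tilting the test
functions shows that it also holds where `Du = 0`. Dividing by `K`, assume `K = 1`.

Suppose that a paraboloid of opening `a`, with `a` large, touches `u` from below near a ball. Raise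
it by a Gaussian centred in the ball, and slide paraboloids with vertices in the ball under the
difference: the equation forces the contact points into the ball. The map from contact points to
vertices has a Jacobian bounded by means of the equation, so that the area formula makes the contact
points, where `u` is touched by paraboloids of opening `κ a`, a fixed fraction of the ball. By a
covering argument the set where no paraboloid of opening `T κ ^ k` touches `u` has measure at most
`C q ^ k`, with `q < 1`. The same holds for `-u`, and summing over `k` bounds the integral of
`Θ ^ δ` if `κ ^ δ q < 1`.

Where paraboloids of opening `a` touch from both sides, the slopes are locally Lipschitz. By
Rademacher's theorem they are differentiable almost everywhere, and at density points this
differentiability is a second-order Taylor expansion of `u`. Finally `|D_ij u| ≤ Θ`, and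
`|Du| ≤ 4 (‖u‖_∞ + Θ)` since the bounds defining `Θ` hold on the whole ball.
-/

section LinearAlgebra

theorem abs_det_le_trace_pow_of_isPositive {E : Type*} [NormedAddCommGroup E]
    [InnerProductSpace ℝ E] [FiniteDimensional ℝ E] {X : E →L[ℝ] E} (hX : X.IsPositive) :
    |X.det| ≤ LinearMap.trace ℝ E X ^ Module.finrank ℝ E := by
  have hev := hX.toLinearMap.nonneg_eigenvalues (rfl : Module.finrank ℝ E = _)
  rw [ContinuousLinearMap.det, hX.isSymmetric.det_eq_prod_eigenvalues rfl,
    hX.isSymmetric.trace_eq_sum_eigenvalues rfl]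
  simp only [RCLike.ofReal_real_eq_id, id_eq]
  rw [abs_of_nonneg (Finset.prod_nonneg fun i _ => hev i)]
  calc ∏ i, hX.isSymmetric.eigenvalues rfl i
      ≤ ∏ _i : Fin (Module.finrank ℝ E), ∑ j, hX.isSymmetric.eigenvalues rfl j :=
        Finset.prod_le_prod (fun i _ => hev i) fun i _ =>
          Finset.single_le_sum (fun j _ => hev j) (Finset.mem_univ i)
    _ = _ := by simp

variable {n : ℕ} {lam Lam β c : ℝ} {A P : Matrix (Fin n) (Fin n) ℝ}

theorem dotProduct_eigenvectorBasis_self (hA : A.IsHermitian) (i : Fin n) :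
    star (hA.eigenvectorBasis i).ofLp ⬝ᵥ (hA.eigenvectorBasis i).ofLp = 1 := by
  rw [dotProduct_comm, ← EuclideanSpace.inner_eq_star_dotProduct]
  exact hA.eigenvectorBasis.inner_eq_one i

theorem le_eigenvalues_of_posSemidef (hA : A.IsHermitian) (h : (A - c • 1).PosSemidef)
    (i : Fin n) : c ≤ hA.eigenvalues i := by
  have hv := h.dotProduct_mulVec_nonneg (hA.eigenvectorBasis i)
  rw [Matrix.sub_mulVec, Matrix.smul_mulVec, Matrix.one_mulVec, dotProduct_sub, dotProduct_smul,
    dotProduct_eigenvectorBasis_self] at hv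
  rw [hA.eigenvalues_eq]
  simpa using hv

theorem eigenvalues_le_of_posSemidef (hA : A.IsHermitian) (h : (c • 1 - A).PosSemidef)
    (i : Fin n) : hA.eigenvalues i ≤ c := by
  have hv := h.dotProduct_mulVec_nonneg (hA.eigenvectorBasis i)
  rw [Matrix.sub_mulVec, Matrix.smul_mulVec, Matrix.one_mulVec, dotProduct_sub, dotProduct_smul,
    dotProduct_eigenvectorBasis_self] at hv
  rw [hA.eigenvalues_eq]
  simpa using hv

theorem isHermitian_sub_smul_one (hP : P.IsHermitian) : (P - β • 1).IsHermitian :=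
  hP.sub (Matrix.isHermitian_one.smul (IsSelfAdjoint.all β))

theorem mul_trace_le_pucciMin_add (hLam : lam ≤ Lam) (hβ : 0 ≤ β) (hP : P.PosSemidef) :
    lam * P.trace ≤ pucciMin lam Lam (P - β • 1) + Lam * n * β := by
  have hA := isHermitian_sub_smul_one (β := β) hP.1
  have hev (i) : -β ≤ hA.eigenvalues i := le_eigenvalues_of_posSemidef hA (by simpa using hP) i
  have htr : P.trace = ∑ i, hA.eigenvalues i + n * β := by
    have := hA.trace_eq_sum_eigenvalues
    simp only [Matrix.trace_sub, Matrix.trace_smul, Matrix.trace_one, Fintype.card_fin,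
      smul_eq_mul, RCLike.ofReal_real_eq_id, id_eq] at this
    linarith
  rw [pucciMin, dif_pos hA, htr]
  simp only [Finset.sum_filter]
  have hterm (e : ℝ) (he : -β ≤ e) : lam * (e + β) ≤
      lam * (if 0 < e then e else 0) + Lam * (if e < 0 then e else 0) + Lam * β := by
    rcases lt_trichotomy e 0 with h | rfl | h
    · rw [if_neg h.le.not_gt, if_pos h]; nlinarith
    · simp only [lt_irrefl, if_false]; nlinarith
    · rw [if_pos h, if_neg h.le.not_gt]; nlinarith
  have hsum := Finset.sum_le_sum fun i (_ : i ∈ Finset.univ) => hterm _ (hev i)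
  simp only [← Finset.mul_sum, Finset.sum_add_distrib, Finset.sum_const, Finset.card_univ,
    Fintype.card_fin, nsmul_eq_mul] at hsum
  linarith

theorem mul_trace_le_neg_pucciMax_add (hLam : lam ≤ Lam) (hβ : 0 ≤ β) (hP : P.PosSemidef) :
    lam * P.trace ≤ -pucciMax lam Lam (-(P - β • 1)) + Lam * n * β := by
  have hA := (isHermitian_sub_smul_one (β := β) hP.1).neg
  have hev (i) : hA.eigenvalues i ≤ β := eigenvalues_le_of_posSemidef hA (by simpa using hP) i
  have htr : P.trace = n * β - ∑ i, hA.eigenvalues i := by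
    have := hA.trace_eq_sum_eigenvalues
    simp only [Matrix.trace_neg, Matrix.trace_sub, Matrix.trace_smul, Matrix.trace_one,
      Fintype.card_fin, smul_eq_mul, RCLike.ofReal_real_eq_id, id_eq] at this
    linarith
  rw [pucciMax, dif_pos hA, htr]
  simp only [Finset.sum_filter]
  have hterm (e : ℝ) (he : e ≤ β) : lam * (β - e) ≤
      Lam * β - (lam * (if e < 0 then e else 0) + Lam * (if 0 < e then e else 0)) := by
    rcases lt_trichotomy e 0 with h | rfl | h
    · rw [if_pos h, if_neg h.le.not_gt]; nlinarith
    · simp only [lt_irrefl, if_false]; nlinarith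
    · rw [if_neg h.le.not_gt, if_pos h]; nlinarith
  have hsum := Finset.sum_le_sum fun i (_ : i ∈ Finset.univ) => hterm _ (hev i)
  simp only [← Finset.mul_sum, Finset.sum_add_distrib, Finset.sum_sub_distrib, Finset.sum_const,
    Finset.card_univ, Fintype.card_fin, nsmul_eq_mul] at hsum
  linarith

theorem isPositive_toEuclideanCLM_iff :
    (Matrix.toEuclideanCLM (n := Fin n) (𝕜 := ℝ) A).IsPositive ↔ A.PosSemidef :=
  Matrix.isPositive_toEuclideanLin_iff

theorem trace_toEuclideanCLM (A : Matrix (Fin n) (Fin n) ℝ) :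
    LinearMap.trace ℝ (EuclideanSpace ℝ (Fin n)) (Matrix.toEuclideanCLM (𝕜 := ℝ) A) = A.trace := by
  rw [Matrix.coe_toEuclideanCLM_eq_toEuclideanLin, Matrix.toEuclideanLin, Matrix.toLpLin_eq_toLin,
    Matrix.trace_toLin_eq]

end LinearAlgebra

section QuadraticPolynomials

variable {E : Type*} [NormedAddCommGroup E] [InnerProductSpace ℝ E]

/-- The quadratic polynomial with value `c`, gradient `p` and Hessian `X` at `x`. -/
noncomputable def quadPoly (c : ℝ) (x p : E) (X : E →L[ℝ] E) (y : E) : ℝ :=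
  c + inner ℝ p (y - x) + 1 / 2 * inner ℝ (X (y - x)) (y - x)

/-- `(p, X)` is a second-order subjet of `u` at `x`, in the strong sense that the quadratic
polynomial with these derivatives touches `u` from below at `x` near `x`. -/
def HasSubjet (u : E → ℝ) (x p : E) (X : E →L[ℝ] E) : Prop :=
  ∀ᶠ y in 𝓝 x, quadPoly (u x) x p X y ≤ u y

variable {c : ℝ} {x p : E} {X : E →L[ℝ] E}

@[simp]
theorem quadPoly_self (c : ℝ) (x p : E) (X : E →L[ℝ] E) : quadPoly c x p X x = c := by
  simp [quadPoly]

theorem neg_quadPoly (c : ℝ) (x p : E) (X : E →L[ℝ] E) (y : E) :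
    -quadPoly c x p X y = quadPoly (-c) x (-p) (-X) y := by
  simp only [quadPoly, neg_apply, inner_neg_left]
  ring

theorem contDiff_quadPoly (c : ℝ) (x p : E) (X : E →L[ℝ] E) :
    ContDiff ℝ 2 (quadPoly c x p X) := by
  have h : ContDiff ℝ 2 fun y => y - x := contDiff_id.sub contDiff_const
  exact (contDiff_const.add (contDiff_const.inner ℝ h)).add
    (contDiff_const.mul ((X.contDiff.comp h).inner ℝ h))

theorem hasFDerivAt_quadPoly (c : ℝ) (x p : E) (hX : X.IsSymmetric) (y : E) :
    HasFDerivAt (quadPoly c x p X) (innerSL ℝ (p + X (y - x))) y := by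
  have hid : HasFDerivAt (fun y : E => y - x) (ContinuousLinearMap.id ℝ E) y :=
    (hasFDerivAt_id y).sub_const x
  refine ((((hasFDerivAt_const p y).inner ℝ hid).const_add c).add
    (((X.hasFDerivAt.comp y hid).inner ℝ hid).const_mul (1 / 2))).congr_fderiv ?_
  ext k
  simp [hX.apply_clm k (y - x), real_inner_comm k, inner_sub_right]
  ring

theorem gradient_quadPoly [CompleteSpace E] (c : ℝ) (x p : E) (hX : X.IsSymmetric) :
    gradient (quadPoly c x p X) x = p := by
  refine HasGradientAt.gradient ?_
  rw [hasGradientAt_iff_hasFDerivAt]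
  refine (hasFDerivAt_quadPoly c x p hX x).congr_fderiv ?_
  ext k
  simp

theorem quadPoly_recentre (c : ℝ) (x p z : E) (hX : X.IsSymmetric) (y : E) :
    quadPoly c x p X y = quadPoly (quadPoly c x p X z) z (p + X (z - x)) X y := by
  obtain ⟨h, rfl⟩ : ∃ h, y = z + h := ⟨y - z, by abel⟩
  obtain ⟨k, rfl⟩ : ∃ k, z = x + k := ⟨z - x, by abel⟩
  have hkh : x + k + h - x = k + h := by abel
  simp only [quadPoly, hkh, add_sub_cancel_left, map_add, inner_add_left, inner_add_right,
    hX.apply_clm h k, real_inner_comm (X k) h]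
  ring

theorem hessianMatrix_quadPoly {n : ℕ} (c : ℝ) (x p : EuclideanSpace ℝ (Fin n))
    {A : Matrix (Fin n) (Fin n) ℝ} (hA : A.IsHermitian) :
    hessianMatrix (quadPoly c x p (Matrix.toEuclideanCLM (𝕜 := ℝ) A)) x = A := by
  set X := Matrix.toEuclideanCLM (n := Fin n) (𝕜 := ℝ) A with hX
  have hXs : X.IsSymmetric := Matrix.isSymmetric_toEuclideanLin_iff.2 hA
  have hgrad : fderiv ℝ (quadPoly c x p X) = fun y => innerSL ℝ (p + X (y - x)) :=
    funext fun y => (hasFDerivAt_quadPoly c x p hXs y).fderiv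
  have hhess : HasFDerivAt (fun y => innerSL ℝ (p + X (y - x)))
      ((innerSL ℝ (E := EuclideanSpace ℝ (Fin n))).comp X) x :=
    (innerSL ℝ (E := EuclideanSpace ℝ (Fin n))).hasFDerivAt.comp x
      ((X.hasFDerivAt.comp x ((hasFDerivAt_id x).sub_const x)).const_add p)
  ext i j
  rw [← hA.apply i j]
  rw [hessianMatrix, Matrix.of_apply, hgrad, hhess.fderiv]
  simp [hX, EuclideanSpace.inner_single_right]

end QuadraticPolynomials

section Subjets

variable {E : Type*} [NormedAddCommGroup E] [InnerProductSpace ℝ E]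
  {u : E → ℝ} {Ω : Set E} {x p : E} {X : E →L[ℝ] E} {lam Lam K : ℝ}

/-- `pucciMin lam Lam (D²u) ≤ K + 2 |Du|` in `Ω` in the viscosity sense, weakened to the bound of a
trace: a Hessian is written as `P - β` with `P ≥ 0` and `β ≥ 0`, and then
`lam * tr P - Lam * n * β` is a lower bound of its image under the Pucci operator. -/
def SubjetBound (lam Lam K : ℝ) (Ω : Set E) (u : E → ℝ) : Prop :=
  ∀ x ∈ Ω, ∀ p, ∀ P : E →L[ℝ] E, P.IsPositive → ∀ β : ℝ, 0 ≤ β →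
    HasSubjet u x p (P - β • 1) →
      lam * LinearMap.trace ℝ E P ≤ K + 2 * ‖p‖ + Lam * Module.finrank ℝ E * β

theorem HasSubjet.congr {v : E → ℝ} (h : HasSubjet u x p X) (huv : u =ᶠ[𝓝 x] v) :
    HasSubjet v x p X := by
  filter_upwards [h, huv] with y hy hyv
  rwa [← huv.eq_of_nhds, ← hyv]

theorem SubjetBound.congr {v : E → ℝ} (hu : SubjetBound lam Lam K Ω u) (hΩ : IsOpen Ω)
    (huv : Set.EqOn u v Ω) : SubjetBound lam Lam K Ω v :=
  fun x hx p P hP β hβ h => hu x hx p P hP β hβ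
    (h.congr ((huv.symm.eventuallyEq_of_mem (hΩ.mem_nhds hx))))

theorem HasSubjet.add {v : E → ℝ} {q : E} {Y : E →L[ℝ] E} (hu : HasSubjet u x p X)
    (hv : HasSubjet v x q Y) : HasSubjet (u + v) x (p + q) (X + Y) := by
  filter_upwards [hu, hv] with y hy hy'
  simp only [quadPoly, Pi.add_apply, add_apply, inner_add_left] at hy hy' ⊢
  linarith

theorem HasSubjet.const_mul (h : HasSubjet u x p X) {c : ℝ} (hc : 0 ≤ c) :
    HasSubjet (fun y => c * u y) x (c • p) (c • X) := by
  filter_upwards [h] with y hy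
  have hscale : quadPoly (c * u x) x (c • p) (c • X) y = c * quadPoly (u x) x p X y := by
    simp only [quadPoly, smul_apply, real_inner_smul_left]
    ring
  rw [hscale]
  gcongr

theorem SubjetBound.const_mul (hu : SubjetBound lam Lam K Ω u) {c : ℝ} (hc : 0 < c) :
    SubjetBound lam Lam (c * K) Ω fun y => c * u y := by
  intro x hx p P hP β hβ h
  have hj : HasSubjet u x (c⁻¹ • p) (c⁻¹ • P - (c⁻¹ * β) • 1) := by
    have := h.const_mul (inv_pos.2 hc).le
    simpa only [inv_mul_cancel_left₀ hc.ne', smul_sub, mul_smul] using this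
  have hb := hu x hx _ _ (hP.smul_of_nonneg (inv_pos.2 hc).le) _ (by positivity) hj
  rw [ContinuousLinearMap.toLinearMap_smul, map_smul, smul_eq_mul, norm_smul,
    Real.norm_of_nonneg (inv_pos.2 hc).le] at hb
  have hb' := mul_le_mul_of_nonneg_left hb hc.le
  field_simp at hb'
  linarith

/-- Lowering the Hessian by `η` makes the contact strict, so that it survives a change of the
slope: the minimum of `u` minus the tilted polynomial is attained close to `x`. -/
theorem HasSubjet.exists_of_slope_near [ProperSpace E] (hΩ : Ω ∈ 𝓝 x) (hu : ContinuousOn u Ω)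
    (hX : X.IsSymmetric) (h : HasSubjet u x p X) {η : ℝ} (hη : 0 < η) :
    ∀ᶠ q in 𝓝 p, ∃ z ∈ Ω, ‖z - x‖ ≤ 2 * ‖q - p‖ / η ∧ quadPoly (u x) x p X z ≤ u z ∧
      u z ≤ quadPoly (u x) x q (X - η • 1) z ∧
      HasSubjet u z (q + (X - η • 1) (z - x)) (X - η • 1) := by
  obtain ⟨ρ, hρ0, hρ⟩ := nhds_basis_closedBall.mem_iff.1 (Filter.inter_mem hΩ h)
  have hsmall : ∀ᶠ q in 𝓝 p, 2 * ‖q - p‖ / η < ρ :=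
    ContinuousAt.eventually_lt (by fun_prop) continuousAt_const (by simpa using hρ0)
  filter_upwards [hsmall] with q hq
  set Y := X - η • (1 : E →L[ℝ] E) with hY
  have hYs : Y.IsSymmetric := hX.sub (LinearMap.IsSymmetric.one.smul (by simp))
  obtain ⟨z, hz, hzmin⟩ := (isCompact_closedBall x ρ).exists_isMinOn
    ⟨x, mem_closedBall_self hρ0.le⟩ ((hu.mono fun y hy => (hρ hy).1).sub
      (contDiff_quadPoly (u x) x q Y).continuous.continuousOn)
  have hmin (y) (hy : y ∈ closedBall x ρ) :
      u z - quadPoly (u x) x q Y z ≤ u y - quadPoly (u x) x q Y y := hzmin hy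
  have hzle : u z ≤ quadPoly (u x) x q Y z := by
    simpa using hmin x (mem_closedBall_self hρ0.le)
  have hXz : quadPoly (u x) x p X z ≤ u z := (hρ hz).2
  have hgap : quadPoly (u x) x q Y z - quadPoly (u x) x p X z
      = inner ℝ (q - p) (z - x) - η / 2 * ‖z - x‖ ^ 2 := by
    rw [quadPoly, quadPoly]
    generalize z - x = h
    simp only [hY, sub_apply, smul_apply, one_apply_eq_self,
      inner_sub_left, real_inner_smul_left, real_inner_self_eq_norm_sq]
    ring
  have hzx : ‖z - x‖ ≤ 2 * ‖q - p‖ / η := by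
    rw [le_div_iff₀ hη]
    rcases (norm_nonneg (z - x)).eq_or_lt with h0 | h0
    · rw [← h0, zero_mul]; positivity
    · have := real_inner_le_norm (q - p) (z - x)
      refine le_of_mul_le_mul_right ?_ h0
      nlinarith
  refine ⟨z, (hρ hz).1, hzx, hXz, hzle, ?_⟩
  have hzball : z ∈ ball x ρ := mem_ball_iff_norm.2 (hzx.trans_lt hq)
  filter_upwards [isOpen_ball.mem_nhds hzball] with y hy
  have hrec := quadPoly_recentre (u x) x q z hYs y
  have hshift : quadPoly (u z) z (q + Y (z - x)) Y y
      = quadPoly (quadPoly (u x) x q Y z) z (q + Y (z - x)) Y y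
        + (u z - quadPoly (u x) x q Y z) := by
    rw [quadPoly, quadPoly]; ring
  rw [hshift, ← hrec]
  linarith [hmin y (ball_subset_closedBall hy)]

/-- Tilting along `Y e`, where `⟪Y e, e⟫ > 0`, produces a nonzero slope: if the new slope vanished
at `z`, then `Y (z - x) = τ Y e`, and the tilted polynomial would lie strictly below the original
one at `z`. -/
theorem slope_ne_zero_of_tilt {Y : E →L[ℝ] E} (hY : Y.IsSymmetric) {e z : E} {c η τ : ℝ}
    (hη : 0 ≤ η) (hτ : 0 < τ) (he : 0 < inner ℝ (Y e) e)
    (hle : quadPoly c x 0 (Y + η • 1) z ≤ quadPoly c x (-(τ • Y e)) Y z) :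
    -(τ • Y e) + Y (z - x) ≠ 0 := by
  intro h0
  have hYz : Y (z - x) = τ • Y e := by rw [← sub_eq_zero, ← h0]; abel
  have hsq : inner ℝ (Y (z - x)) (z - x) = τ ^ 2 * inner ℝ (Y e) e := by
    rw [hYz, real_inner_smul_left, hY.apply_clm e, hYz, real_inner_smul_right, real_inner_comm]
    ring
  have hlin : inner ℝ (-(τ • Y e)) (z - x) = -(τ ^ 2 * inner ℝ (Y e) e) := by
    rw [inner_neg_left, ← hYz, hsq]
  simp only [quadPoly, inner_zero_left, add_apply, smul_apply, one_apply_eq_self,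
    inner_add_left, real_inner_smul_left, real_inner_self_eq_norm_sq, hlin, hsq] at hle
  have h1 : 0 < τ ^ 2 * inner ℝ (Y e) e := by positivity
  have h2 : 0 ≤ η * ‖z - x‖ ^ 2 := by positivity
  linarith

theorem exists_inner_pos_of_trace_pos [FiniteDimensional ℝ E]
    (h : 0 < LinearMap.trace ℝ E X) : ∃ e, 0 < inner ℝ (X e) e := by
  by_contra! hno
  refine h.not_ge ?_
  rw [LinearMap.trace_eq_sum_inner _ (stdOrthonormalBasis ℝ E)]
  exact Finset.sum_nonpos fun i _ => (real_inner_comm _ _).trans_le (hno _)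

theorem HasSubjet.exists_slope_ne_zero [FiniteDimensional ℝ E] (hΩ : IsOpen Ω)
    (hu : ContinuousOn u Ω) (hx : x ∈ Ω) (hX : X.IsSymmetric)
    (htr : 0 < LinearMap.trace ℝ E X) (h : HasSubjet u x 0 X) {ε : ℝ} (hε : 0 < ε) :
    ∃ z ∈ Ω, ∃ q ≠ 0, ‖q‖ < ε ∧ ∃ η, 0 < η ∧ η < ε ∧ HasSubjet u z q (X - η • 1) := by
  obtain ⟨e, η, ⟨he, hηε⟩, hη⟩ :
      ∃ e, ∃ η : ℝ, (0 < inner ℝ ((X - η • (1 : E →L[ℝ] E)) e) e ∧ η < ε) ∧ 0 < η := by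
    obtain ⟨e, he⟩ := exists_inner_pos_of_trace_pos htr
    have hpos : ∀ᶠ η : ℝ in 𝓝 0, 0 < inner ℝ ((X - η • (1 : E →L[ℝ] E)) e) e :=
      ContinuousAt.eventually_lt continuousAt_const (by fun_prop) (by simpa using he)
    exact ⟨e, (((hpos.and (gt_mem_nhds hε)).filter_mono nhdsWithin_le_nhds).and
      (self_mem_nhdsWithin : ∀ᶠ η in 𝓝[>] (0 : ℝ), 0 < η)).exists⟩
  set Y := X - η • (1 : E →L[ℝ] E) with hY
  have hYs : Y.IsSymmetric := hX.sub (LinearMap.IsSymmetric.one.smul (by simp))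
  have htilt : Filter.Tendsto (fun τ : ℝ => -(τ • Y e)) (𝓝[>] 0) (𝓝 0) := by
    refine Filter.Tendsto.mono_left (Continuous.tendsto' (by fun_prop) _ _ (by simp))
      nhdsWithin_le_nhds
  have hsmall : ∀ᶠ q : E in 𝓝 0, ‖q‖ + ‖Y‖ * (2 * ‖q - 0‖ / η) < ε :=
    ContinuousAt.eventually_lt (by fun_prop) continuousAt_const (by simpa using hε)
  obtain ⟨τ, ⟨⟨z, hz, hzx, hXz, hzY, hj⟩, hτε⟩, hτ⟩ := ((htilt.eventually
    ((h.exists_of_slope_near (hΩ.mem_nhds hx) hu hX hη).and hsmall)).and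
      self_mem_nhdsWithin).exists
  have hle : quadPoly (u x) x 0 (Y + η • 1) z ≤ quadPoly (u x) x (-(τ • Y e)) Y z := by
    rw [hY, sub_add_cancel]
    exact hXz.trans hzY
  refine ⟨z, hz, _, slope_ne_zero_of_tilt hYs hη.le hτ he hle, ?_, η, hη, hηε, hj⟩
  calc _ ≤ ‖-(τ • Y e)‖ + ‖Y (z - x)‖ := norm_add_le _ _
    _ ≤ ‖-(τ • Y e)‖ + ‖Y‖ * (2 * ‖-(τ • Y e) - 0‖ / η) := by
      gcongr
      exact (Y.le_opNorm _).trans (by gcongr)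
    _ < ε := hτε

/-- Subjets with vanishing slope are limits of subjets with nonvanishing slope. -/
theorem SubjetBound.of_slope_ne_zero [FiniteDimensional ℝ E] (hΩ : IsOpen Ω)
    (hu : ContinuousOn u Ω) (hlam : 0 ≤ lam) (hLam : lam ≤ Lam) (hK : 0 ≤ K)
    (H : ∀ x ∈ Ω, ∀ p ≠ 0, ∀ P : E →L[ℝ] E, P.IsPositive → ∀ β : ℝ, 0 ≤ β →
      HasSubjet u x p (P - β • 1) →
        lam * LinearMap.trace ℝ E P ≤ K + 2 * ‖p‖ + Lam * Module.finrank ℝ E * β) :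
    SubjetBound lam Lam K Ω u := by
  intro x hx p P hP β hβ hj
  rcases ne_or_eq p 0 with hp | rfl
  · exact H x hx p hp P hP β hβ hj
  have hLam0 : 0 ≤ Lam := hlam.trans hLam
  set d : ℝ := ((Module.finrank ℝ E : ℕ) : ℝ)
  have htrace : LinearMap.trace ℝ E (P - β • 1 : E →L[ℝ] E) = LinearMap.trace ℝ E P - β * d := by
    simp [d]
  rcases le_or_gt (LinearMap.trace ℝ E (P - β • 1 : E →L[ℝ] E)) 0 with htr | htr
  · rw [htrace, sub_nonpos] at htr
    calc lam * LinearMap.trace ℝ E P ≤ lam * (β * d) := by gcongr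
      _ ≤ Lam * (β * d) := by gcongr
      _ ≤ K + 2 * ‖(0 : E)‖ + Lam * d * β := by rw [norm_zero]; linarith
  refine le_of_forall_pos_lt_add fun ε hε => ?_
  have hs : (P - β • 1 : E →L[ℝ] E).IsSymmetric :=
    hP.isSymmetric.sub (LinearMap.IsSymmetric.one.smul (by simp))
  obtain ⟨z, hz, q, hq0, hq, η, hη0, hη, hjz⟩ :=
    hj.exists_slope_ne_zero hΩ hu hx hs htr (show 0 < ε / (3 + Lam * d) by positivity)
  have hb := H z hz q hq0 P hP (β + η) (by positivity) (by rwa [add_smul, ← sub_sub])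
  rw [lt_div_iff₀ (by positivity)] at hq hη
  have hmul : 0 ≤ (Lam * d) * ‖q‖ := by positivity
  rw [norm_zero]
  nlinarith

end Subjets

section ViscosityToSubjets

/-- After multiplication by `q ^ γ` the singular inequality becomes
`P ≤ q ^ γ * K ^ (1 - γ) + q`, and the first term is at most `q + K` by Young's inequality. -/
theorem le_add_two_mul_of_rpow_mul_sub_le {γ q P F K : ℝ} (hγ0 : 0 ≤ γ) (hγ1 : γ ≤ 1)
    (hq : 0 < q) (hK : 0 ≤ K) (hF : F ≤ K ^ (1 - γ))
    (h : q ^ (-γ) * P - q ^ (1 - γ) ≤ F) : P ≤ K + 2 * q := by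
  have hyoung : q ^ γ * K ^ (1 - γ) ≤ γ * q + (1 - γ) * K :=
    Real.geom_mean_le_arith_mean2_weighted hγ0 (sub_nonneg.2 hγ1) hq.le hK (by ring)
  have hmul := mul_le_mul_of_nonneg_left (h.trans hF) (Real.rpow_nonneg hq.le γ)
  have hone : q ^ γ * q ^ (-γ) = 1 := by rw [← Real.rpow_add hq]; simp
  have hself : q ^ γ * q ^ (1 - γ) = q := by rw [← Real.rpow_add hq]; simp
  rw [mul_sub, ← mul_assoc, hone, hself, one_mul] at hmul
  nlinarith

variable {n : ℕ} {lam Lam γ K : ℝ} {Ω : Set (EuclideanSpace ℝ (Fin n))}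
  {u f : EuclideanSpace ℝ (Fin n) → ℝ}

theorem IsViscositySupersol.subjetBound (hu : IsViscositySupersol lam Lam γ Ω f u)
    (hΩ : IsOpen Ω) (huc : ContinuousOn u Ω) (hlam : 0 ≤ lam) (hLam : lam ≤ Lam) (hγ0 : 0 ≤ γ)
    (hγ1 : γ ≤ 1) (hK : 0 ≤ K) (hf : ∀ x ∈ Ω, f x ≤ K ^ (1 - γ)) :
    SubjetBound lam Lam K Ω u := by
  refine .of_slope_ne_zero hΩ huc hlam hLam hK fun x hx p hp P hP β hβ hj => ?_
  obtain ⟨A, rfl⟩ : ∃ A, Matrix.toEuclideanCLM (n := Fin n) (𝕜 := ℝ) A = P :=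
    ⟨_, StarAlgEquiv.apply_symm_apply _ P⟩
  replace hP := isPositive_toEuclideanCLM_iff.1 hP
  rw [show Matrix.toEuclideanCLM (𝕜 := ℝ) A - β • 1
    = Matrix.toEuclideanCLM (𝕜 := ℝ) (A - β • 1) by simp] at hj
  have hB := isHermitian_sub_smul_one (β := β) hP.1
  have hBs : (Matrix.toEuclideanCLM (n := Fin n) (𝕜 := ℝ) (A - β • 1)).IsSymmetric :=
    Matrix.isSymmetric_toEuclideanLin_iff.2 hB
  obtain ⟨V, hV, hVo, hxV⟩ := _root_.eventually_nhds_iff.1 hj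
  have hvisc := hu _ (contDiff_quadPoly (u x) x p _).contDiffOn x hx (V ∩ Ω) (hVo.inter hΩ)
    Set.inter_subset_right ⟨⟨hxV, hx⟩, quadPoly_self _ _ _ _, fun y hy => hV y hy.1⟩
  rw [gradient_quadPoly _ _ _ hBs, hessianMatrix_quadPoly _ _ _ hB] at hvisc
  have hpucci := le_add_two_mul_of_rpow_mul_sub_le hγ0 hγ1 (norm_pos_iff.2 hp) hK (hf x hx)
    (hvisc (Or.inr hp))
  rw [trace_toEuclideanCLM, finrank_euclideanSpace_fin]
  linarith [mul_trace_le_pucciMin_add hLam hβ hP]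

theorem IsViscositySubsol.subjetBound_neg (hu : IsViscositySubsol lam Lam γ Ω f u)
    (hΩ : IsOpen Ω) (huc : ContinuousOn u Ω) (hlam : 0 ≤ lam) (hLam : lam ≤ Lam) (hγ0 : 0 ≤ γ)
    (hγ1 : γ ≤ 1) (hK : 0 ≤ K) (hf : ∀ x ∈ Ω, -f x ≤ K ^ (1 - γ)) :
    SubjetBound lam Lam K Ω (-u) := by
  refine .of_slope_ne_zero hΩ huc.neg hlam hLam hK fun x hx p hp P hP β hβ hj => ?_
  obtain ⟨A, rfl⟩ : ∃ A, Matrix.toEuclideanCLM (n := Fin n) (𝕜 := ℝ) A = P :=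
    ⟨_, StarAlgEquiv.apply_symm_apply _ P⟩
  replace hP := isPositive_toEuclideanCLM_iff.1 hP
  rw [show Matrix.toEuclideanCLM (𝕜 := ℝ) A - β • 1
    = Matrix.toEuclideanCLM (𝕜 := ℝ) (A - β • 1) by simp] at hj
  have hB := (isHermitian_sub_smul_one (β := β) hP.1).neg
  have hBs : (Matrix.toEuclideanCLM (n := Fin n) (𝕜 := ℝ) (-(A - β • 1))).IsSymmetric :=
    Matrix.isSymmetric_toEuclideanLin_iff.2 hB
  obtain ⟨V, hV, hVo, hxV⟩ := _root_.eventually_nhds_iff.1 hj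
  have hvisc := hu (quadPoly (u x) x (-p) (Matrix.toEuclideanCLM (𝕜 := ℝ) (-(A - β • 1))))
    (contDiff_quadPoly _ _ _ _).contDiffOn x hx (V ∩ Ω) (hVo.inter hΩ) Set.inter_subset_right
    ⟨⟨hxV, hx⟩, (quadPoly_self _ _ _ _).symm, fun y hy => by
      have hy' := neg_le_neg (hV y hy.1)
      rwa [neg_quadPoly, Pi.neg_apply, Pi.neg_apply, neg_neg, neg_neg, ← map_neg] at hy'⟩
  rw [gradient_quadPoly _ _ _ hBs, hessianMatrix_quadPoly _ _ _ hB, norm_neg] at hvisc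
  have hpucci := le_add_two_mul_of_rpow_mul_sub_le
    (P := -pucciMax lam Lam (-(A - β • 1))) hγ0 hγ1 (norm_pos_iff.2 hp) hK (hf x hx)
    (by linarith [hvisc (Or.inr (neg_ne_zero.2 hp))])
  rw [trace_toEuclideanCLM, finrank_euclideanSpace_fin]
  linarith [mul_trace_le_neg_pucciMax_add hLam hβ hP]

end ViscosityToSubjets

section ThickPoints

theorem tendsto_const_mul_nhdsGT_zero {c : ℝ} (hc : 0 < c) :
    Filter.Tendsto (fun r => c * r) (𝓝[>] 0) (𝓝[>] 0) :=
  tendsto_nhdsWithin_iff.2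
    ⟨(Continuous.tendsto' (by fun_prop) _ _ (by simp)).mono_left nhdsWithin_le_nhds,
      eventually_mem_nhdsWithin.mono fun _ hr => mul_pos hc hr⟩

/-- `A` is so dense at `x` that every ball of radius `r` around `x` is within distance `o(r)`
of `A`. -/
def IsThickAt {E : Type*} [PseudoMetricSpace E] (A : Set E) (x : E) : Prop :=
  ∀ ε > 0, ∀ᶠ r in 𝓝[>] (0 : ℝ), ∀ z ∈ closedBall x r, ∃ a ∈ A, dist a z ≤ ε * r

variable {E : Type*} [NormedAddCommGroup E] [NormedSpace ℝ E] [FiniteDimensional ℝ E]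
  [MeasurableSpace E] [BorelSpace E] (μ : Measure E) [μ.IsAddHaarMeasure] {A : Set E} {x z : E}
  {ε r : ℝ}

theorem measure_inter_closedBall_le_of_disjoint (hε : 0 ≤ ε) (hε1 : ε ≤ 1) (hr : 0 < r)
    (hz : z ∈ closedBall x r) (hA : Disjoint A (closedBall z (ε * r))) :
    μ (A ∩ closedBall x (2 * r))
      ≤ (1 - ENNReal.ofReal ((ε / 2) ^ Module.finrank ℝ E)) * μ (closedBall x (2 * r)) := by
  have hsub : closedBall z (ε * r) ⊆ closedBall x (2 * r) :=
    closedBall_subset_closedBall' (by nlinarith [mem_closedBall.1 hz])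
  have hvol : μ (closedBall z (ε * r))
      = ENNReal.ofReal ((ε / 2) ^ Module.finrank ℝ E) * μ (closedBall x (2 * r)) := by
    rw [Measure.addHaar_closedBall _ _ (by positivity), Measure.addHaar_closedBall _ x
      (by positivity), ← mul_assoc, ← ENNReal.ofReal_mul (by positivity), ← mul_pow]
    congr 3
    ring
  calc μ (A ∩ closedBall x (2 * r))
      ≤ μ (closedBall x (2 * r) \ closedBall z (ε * r)) :=
        measure_mono fun y hy => ⟨hy.2, hA.notMem_of_mem_left hy.1⟩
    _ = _ := by
        rw [measure_sdiff hsub measurableSet_closedBall.nullMeasurableSet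
          measure_closedBall_lt_top.ne, hvol,
          ENNReal.sub_mul fun _ _ => measure_closedBall_lt_top.ne, one_mul]

theorem ae_isThickAt (A : Set E) : ∀ᵐ x ∂(μ.restrict A), IsThickAt A x := by
  filter_upwards [Besicovitch.ae_tendsto_measure_inter_div μ A] with x hx ε hε
  set ε' := min ε 1
  have hε'0 : 0 < ε' := by positivity
  have hlt : 1 - ENNReal.ofReal ((ε' / 2) ^ Module.finrank ℝ E) < 1 :=
    ENNReal.sub_lt_self ENNReal.one_ne_top one_ne_zero
      (ENNReal.ofReal_pos.2 (by positivity)).ne'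
  filter_upwards [(hx.comp (tendsto_const_mul_nhdsGT_zero two_pos)).eventually_const_lt hlt,
    self_mem_nhdsWithin] with r hdens hr z hz
  by_contra! hno
  refine hdens.not_ge (ENNReal.div_le_of_le_mul
    (measure_inter_closedBall_le_of_disjoint μ hε'0.le (min_le_right _ _) hr hz ?_))
  refine Set.disjoint_left.2 fun a ha haz => (hno a ha).not_ge (haz.trans ?_)
  exact mul_le_mul_of_nonneg_right (min_le_left _ _) (le_of_lt hr)

end ThickPoints

section QuadraticExpansions

variable {E : Type*} [NormedAddCommGroup E] [InnerProductSpace ℝ E] {w : E → ℝ} {A U : Set E}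
  {P : E → E} {M : ℝ} {x p : E} {L : E →L[ℝ] E}

/-- `w` has at `x` a second-order Taylor expansion with gradient `p` and Hessian `L`, which is not
required to be symmetric. -/
def HasQuadExpansion (w : E → ℝ) (x p : E) (L : E →L[ℝ] E) : Prop :=
  (fun y => w y - quadPoly (w x) x p L y) =o[𝓝 x] fun y => ‖y - x‖ ^ 2

theorem tendsto_ray (x k : E) : Filter.Tendsto (fun t : ℝ => x + t • k) (𝓝[>] 0) (𝓝 x) :=
  (Continuous.tendsto' (by fun_prop) _ _ (by simp)).mono_left nhdsWithin_le_nhds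

theorem HasQuadExpansion.eventually_ray (h : HasQuadExpansion w x p L) (k : E) {ε : ℝ}
    (hε : 0 < ε) : ∀ᶠ t in 𝓝[>] (0 : ℝ), |w (x + t • k) - w x - t * inner ℝ p k
      - t ^ 2 / 2 * inner ℝ (L k) k| ≤ ε * t ^ 2 := by
  have hc : 0 < ε / (‖k‖ ^ 2 + 1) := by positivity
  filter_upwards [(tendsto_ray x k).eventually (h.def hc)] with t ht
  rw [quadPoly, add_sub_cancel_left, map_smul, real_inner_smul_right, real_inner_smul_left,
    real_inner_smul_right, norm_smul, Real.norm_eq_abs, norm_pow, norm_mul, norm_norm, mul_pow,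
    Real.norm_eq_abs, sq_abs, norm_norm] at ht
  calc _ = |w (x + t • k) - (w x + t * inner ℝ p k + 1 / 2 * (t * (t * inner ℝ (L k) k)))| := by
        congr 1; ring
    _ ≤ ε / (‖k‖ ^ 2 + 1) * (t ^ 2 * ‖k‖ ^ 2) := ht
    _ = ε * t ^ 2 * (‖k‖ ^ 2 / (‖k‖ ^ 2 + 1)) := by ring
    _ ≤ ε * t ^ 2 := mul_le_of_le_one_right (by positivity)
        ((div_le_one (by positivity)).2 (by linarith))

theorem HasQuadExpansion.mul_sq_norm_le (h : HasQuadExpansion w x p L) {c : ℝ}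
    (hc : ∀ᶠ y in 𝓝 x, c * ‖y - x‖ ^ 2 ≤ w y - w x - inner ℝ p (y - x)) (k : E) :
    2 * c * ‖k‖ ^ 2 ≤ inner ℝ (L k) k := by
  refine le_of_forall_pos_le_add fun ε hε => ?_
  obtain ⟨t, ⟨hexp, hle⟩, ht⟩ := (((h.eventually_ray k (half_pos hε)).and
    ((tendsto_ray x k).eventually hc)).and (eventually_mem_nhdsWithin (s := Set.Ioi 0))).exists
  rw [add_sub_cancel_left, norm_smul, mul_pow, real_inner_smul_right, Real.norm_eq_abs,
    sq_abs] at hle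
  refine le_of_mul_le_mul_left ?_ (sq_pos_of_pos ht)
  linarith [(abs_le.1 hexp).2]

/-- `w` has first-order expansions with gradient `P` and error `M ‖y - a‖ ^ 2` for `y ∈ U`, at all
points `a ∈ A`. -/
def HasUniformExpansionOn (w : E → ℝ) (P : E → E) (M : ℝ) (A U : Set E) : Prop :=
  ∀ a ∈ A, ∀ y ∈ U, |w y - w a - inner ℝ (P a) (y - a)| ≤ M * ‖y - a‖ ^ 2

theorem HasUniformExpansionOn.abs_sub_le (hw : HasUniformExpansionOn w P M A U) {a y z : E}
    (ha : a ∈ A) (hy : y ∈ U) (hz : z ∈ U) (q : E) :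
    |w z - w y - inner ℝ q (z - y)|
      ≤ M * ‖z - a‖ ^ 2 + M * ‖y - a‖ ^ 2 + ‖P a - q‖ * ‖z - y‖ := by
  have hsplit : w z - w y - inner ℝ q (z - y) = (w z - w a - inner ℝ (P a) (z - a))
      - (w y - w a - inner ℝ (P a) (y - a)) + inner ℝ (P a - q) (z - y) := by
    simp only [inner_sub_left, inner_sub_right]
    ring
  rw [hsplit]
  calc _ ≤ _ := abs_add_le _ _
    _ ≤ _ := add_le_add ((abs_sub _ _).trans (add_le_add (hw a ha z hz) (hw a ha y hy)))
      (abs_real_inner_le_norm _ _)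

theorem eventually_norm_sub_le_of_hasFDerivWithinAt (hP : HasFDerivWithinAt P L A x)
    (C : ℝ) {ε : ℝ} (hε : 0 < ε) : ∀ᶠ r in 𝓝[>] (0 : ℝ), ∀ a ∈ A ∩ closedBall x (C * r),
      ‖P a - P x - L (a - x)‖ ≤ ε * ‖a - x‖ := by
  have hnhds := eventually_nhdsWithin_iff.1 (hP.isLittleO.def hε)
  obtain ⟨ρ, hρ, hball⟩ := Metric.eventually_nhds_iff.1 hnhds
  have hsmall : ∀ᶠ r : ℝ in 𝓝 0, C * r < ρ :=
    ContinuousAt.eventually_lt (by fun_prop) continuousAt_const (by simpa using hρ)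
  filter_upwards [hsmall.filter_mono nhdsWithin_le_nhds] with r hr a ha
  exact hball (ha.2.trans_lt hr) ha.1

/-- A point `z₁` near a thick point is close to points of `A`, and the expansions there have almost
the affine gradient `P x + L (z₁ - x)`. -/
theorem HasUniformExpansionOn.eventually_abs_sub_le_of_isThickAt
    (hw : HasUniformExpansionOn w P M A U) (hM : 0 ≤ M) (hU : U ∈ 𝓝 x)
    (hP : HasFDerivWithinAt P L A x) (hA : IsThickAt A x) {η : ℝ} (hη : 0 < η) :
    ∀ᶠ r in 𝓝[>] (0 : ℝ), ∀ z₁ ∈ closedBall x r, ∀ z₂ ∈ closedBall x r,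
      |w z₂ - w z₁ - inner ℝ (P x + L (z₁ - x)) (z₂ - z₁)|
        ≤ 2 * M * ‖z₂ - z₁‖ ^ 2 + η * r ^ 2 := by
  set c := 3 * M + 4 + 2 * ‖L‖ with hc
  have hc0 : 0 < c := by positivity
  set ε := min 1 (η / c)
  have hε0 : 0 < ε := by positivity
  have hε1 : ε ≤ 1 := min_le_left _ _
  have hεc : ε * c ≤ η := (le_div_iff₀ hc0).1 (min_le_right _ _)
  filter_upwards [hA ε hε0, eventually_norm_sub_le_of_hasFDerivWithinAt hP 2 hε0,
    (eventually_closedBall_subset hU).filter_mono nhdsWithin_le_nhds,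
    self_mem_nhdsWithin] with r hthick hdiff hrU hr z₁ hz₁ z₂ hz₂
  have hr0 : 0 < r := hr
  obtain ⟨a, haA, haz⟩ := hthick z₁ hz₁
  have hgrad : ‖P a - (P x + L (z₁ - x))‖ ≤ ε * (2 * r) + ‖L‖ * (ε * r) := by
    have hax : a ∈ closedBall x (2 * r) := by
      rw [mem_closedBall] at hz₁ ⊢
      nlinarith [dist_triangle a z₁ x]
    have hsplit : P a - (P x + L (z₁ - x)) = (P a - P x - L (a - x)) + L (a - z₁) := by
      simp only [map_sub]; abel
    rw [hsplit]
    refine (norm_add_le _ _).trans (add_le_add ((hdiff a ⟨haA, hax⟩).trans ?_)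
      ((L.le_opNorm _).trans ?_))
    · gcongr; exact mem_closedBall_iff_norm.1 hax
    · gcongr; exact (dist_eq_norm a z₁).ge.trans haz
  have hz1a : ‖z₁ - a‖ ≤ ε * r := by rwa [← dist_eq_norm, dist_comm]
  have hz2a : ‖z₂ - a‖ ≤ ‖z₂ - z₁‖ + ε * r := (norm_sub_le_norm_sub_add_norm_sub _ z₁ _).trans
    (by gcongr)
  have hz12 : ‖z₂ - z₁‖ ≤ 2 * r := by
    rw [← dist_eq_norm]
    linarith [dist_triangle_right z₂ z₁ x, mem_closedBall.1 hz₁, mem_closedBall.1 hz₂]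
  have hsq : (ε * r) ^ 2 ≤ ε * r ^ 2 := by nlinarith [sq_nonneg r]
  have hsq1 : ‖z₁ - a‖ ^ 2 ≤ ε * r ^ 2 := (by gcongr : _ ≤ (ε * r) ^ 2).trans hsq
  have hsq2 : ‖z₂ - a‖ ^ 2 ≤ 2 * ‖z₂ - z₁‖ ^ 2 + 2 * (ε * r ^ 2) :=
    calc ‖z₂ - a‖ ^ 2 ≤ (‖z₂ - z₁‖ + ε * r) ^ 2 := by gcongr
      _ ≤ _ := by nlinarith [sq_nonneg (‖z₂ - z₁‖ - ε * r)]
  calc _ ≤ _ := hw.abs_sub_le haA (hrU hz₁) (hrU hz₂) _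
    _ ≤ M * (2 * ‖z₂ - z₁‖ ^ 2 + 2 * (ε * r ^ 2)) + M * (ε * r ^ 2)
        + (ε * (2 * r) + ‖L‖ * (ε * r)) * (2 * r) := by gcongr
    _ = 2 * M * ‖z₂ - z₁‖ ^ 2 + ε * c * r ^ 2 := by rw [hc]; ring
    _ ≤ _ := by gcongr

/-- Subtracting the quadratic polynomial is harmless along a ray, where the antisymmetric part of
`L` drops out. -/
theorem abs_sub_quadPoly_sub_le_of_ray {k : E} {s t η : ℝ}
    (h : |w (x + t • k) - w (x + s • k)
      - inner ℝ (p + L (x + s • k - x)) (x + t • k - (x + s • k))|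
        ≤ 2 * M * ‖x + t • k - (x + s • k)‖ ^ 2 + η) :
    |(w (x + t • k) - quadPoly (w x) x p L (x + t • k))
      - (w (x + s • k) - quadPoly (w x) x p L (x + s • k))|
        ≤ (2 * M + ‖L‖) * ((t - s) ^ 2 * ‖k‖ ^ 2) + η := by
  have hL : |inner ℝ (L k) k| ≤ ‖L‖ * ‖k‖ ^ 2 := by
    rw [sq, ← mul_assoc]
    exact (abs_real_inner_le_norm _ _).trans (by gcongr; exact L.le_opNorm k)
  have hquad : |(t - s) ^ 2 / 2 * inner ℝ (L k) k| ≤ (t - s) ^ 2 * (‖L‖ * ‖k‖ ^ 2) := by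
    rw [abs_mul, abs_of_nonneg (by positivity)]
    gcongr
    linarith [sq_nonneg (t - s)]
  rw [add_sub_add_left_eq_sub, ← sub_smul, norm_smul, mul_pow, Real.norm_eq_abs, sq_abs] at h
  simp only [quadPoly, add_sub_cancel_left, map_smul, inner_add_left, real_inner_smul_left,
    real_inner_smul_right] at h ⊢
  calc _ = |(w (x + t • k) - w (x + s • k)
          - ((t - s) * inner ℝ p k + s * ((t - s) * inner ℝ (L k) k)))
          - (t - s) ^ 2 / 2 * inner ℝ (L k) k| := by congr 1; ring
    _ ≤ 2 * M * ((t - s) ^ 2 * ‖k‖ ^ 2) + η + (t - s) ^ 2 * (‖L‖ * ‖k‖ ^ 2) :=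
        (abs_sub _ _).trans (add_le_add ((by congr 1; ring : _ = _).trans_le h) hquad)
    _ = _ := by ring

theorem HasUniformExpansionOn.hasQuadExpansion (hw : HasUniformExpansionOn w P M A U)
    (hM : 0 ≤ M) (hU : U ∈ 𝓝 x) (hP : HasFDerivWithinAt P L A x) (hA : IsThickAt A x) :
    HasQuadExpansion w x (P x) L := by
  refine isLittleO_iff.2 fun ε hε => ?_
  obtain ⟨N, hN⟩ := exists_nat_gt ((2 * M + ‖L‖) / (ε / 2))
  have hN0 : (0 : ℝ) < N := lt_of_le_of_lt (by positivity) hN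
  have hN' : (2 * M + ‖L‖) / N ≤ ε / 2 := (div_lt_comm₀ (by positivity) hN0).1 hN |>.le
  have hfirst := hw.eventually_abs_sub_le_of_isThickAt hM hU hP hA
    (show 0 < ε / (2 * N) by positivity)
  have hcentre := eventually_nhdsWithin_iff.1 ((tendsto_norm_sub_self_nhdsNE x).eventually hfirst)
  filter_upwards [hcentre] with y hy
  obtain ⟨k, rfl⟩ : ∃ k, y = x + k := ⟨y - x, by abel⟩
  rcases eq_or_ne k 0 with rfl | hk
  · simp
  specialize hy (by simpa using hk)
  simp only [add_sub_cancel_left] at hy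
  set e : ℝ → ℝ := fun t => w (x + t • k) - quadPoly (w x) x (P x) L (x + t • k) with he
  have hmem {t : ℝ} (h0 : 0 ≤ t) (h1 : t ≤ 1) : x + t • k ∈ closedBall x ‖k‖ := by
    rw [mem_closedBall_iff_norm, add_sub_cancel_left, norm_smul, Real.norm_of_nonneg h0]
    exact mul_le_of_le_one_left (norm_nonneg k) h1
  have hstep {j : ℕ} (hj : j < N) : dist (e (j / N)) (e ((j + 1 : ℕ) / N))
      ≤ ((2 * M + ‖L‖) / N + ε / 2) / N * ‖k‖ ^ 2 := by
    have hj' : ((j + 1 : ℕ) : ℝ) ≤ N := by exact_mod_cast hj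
    have hjN : (j : ℝ) / N ≤ 1 := (div_le_one hN0).2 (by exact_mod_cast hj.le)
    have hbound := abs_sub_quadPoly_sub_le_of_ray (hy _ (hmem (by positivity) hjN) _
      (hmem (t := (j + 1 : ℕ) / N) (by positivity) ((div_le_one hN0).2 hj')))
    rw [dist_comm, Real.dist_eq]
    refine hbound.trans_eq ?_
    push_cast
    field_simp
    ring
  have hsum := dist_le_range_sum_of_dist_le (f := fun j : ℕ => e (j / N)) N hstep
  simp only [Finset.sum_const, Finset.card_range, nsmul_eq_mul, he, Nat.cast_zero, zero_div,
    zero_smul, add_zero, quadPoly_self, sub_self, div_self hN0.ne', one_smul, dist_zero_left]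
    at hsum
  rw [add_sub_cancel_left, norm_pow, norm_norm]
  calc _ ≤ _ := hsum
    _ = ((2 * M + ‖L‖) / N + ε / 2) * ‖k‖ ^ 2 := by field_simp
    _ ≤ _ := by gcongr; linarith

/-- Compare the second-order expansions at `x + t h` and `x + t (h + τ k)` with the first-order one
between these points, and let `t → 0`. -/
theorem HasUniformExpansionOn.inner_sub_inner_le (hw : HasUniformExpansionOn w P M A U)
    (hM : 0 ≤ M) (hU : U ∈ 𝓝 x) (hP : HasFDerivWithinAt P L A x) (hA : IsThickAt A x) (h k : E)
    {τ : ℝ} (hτ : 0 < τ) :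
    inner ℝ (L k) h - inner ℝ (L h) k ≤ τ * (4 * M * ‖k‖ ^ 2 - inner ℝ (L k) k) := by
  suffices H : τ * (inner ℝ (L k) h - inner ℝ (L h) k) + τ ^ 2 * inner ℝ (L k) k
      ≤ 4 * M * (τ * ‖k‖) ^ 2 from le_of_mul_le_mul_left (by linarith) hτ
  refine le_of_forall_pos_le_add fun ς hς => ?_
  set R := ‖h‖ + ‖τ • k‖ + 1
  have hR : 0 < R := by positivity
  have hexp := hw.hasQuadExpansion hM hU hP hA
  have hη : 0 < ς / (2 * R ^ 2 + 4) := by positivity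
  obtain ⟨t, ⟨⟨hfirst, hray₁⟩, hray₂⟩, ht⟩ := ((((tendsto_const_mul_nhdsGT_zero hR).eventually
    (hw.eventually_abs_sub_le_of_isThickAt hM hU hP hA hη)).and
    (hexp.eventually_ray h hη)).and (hexp.eventually_ray (h + τ • k) hη)).and
    (self_mem_nhdsWithin : ∀ᶠ t in 𝓝[>] (0 : ℝ), 0 < t) |>.exists
  have hmem {l : E} (hl : ‖l‖ ≤ R) : x + t • l ∈ closedBall x (R * t) := by
    rw [mem_closedBall_iff_norm, add_sub_cancel_left, norm_smul, Real.norm_of_nonneg ht.le,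
      mul_comm R]
    gcongr
  specialize hfirst _ (hmem (l := h) (by simp only [R]; linarith [norm_nonneg (τ • k)])) _
    (hmem (l := h + τ • k) (by simp only [R]; linarith [norm_add_le h (τ • k)]))
  rw [add_sub_cancel_left, add_sub_add_left_eq_sub, ← smul_sub, add_sub_cancel_left, smul_smul,
    norm_smul, Real.norm_of_nonneg (by positivity)] at hfirst
  simp only [map_smul, map_add, inner_add_left, inner_add_right, real_inner_smul_left,
    real_inner_smul_right] at hfirst hray₁ hray₂
  have herr : ς / (2 * R ^ 2 + 4) * ((2 * R ^ 2 + 4) * t ^ 2) = ς * t ^ 2 := by field_simp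
  refine le_of_mul_le_mul_left ?_ (sq_pos_of_pos ht)
  linarith [(abs_le.1 hfirst).2, (abs_le.1 hray₁).2, (abs_le.1 hray₂).1]

theorem HasUniformExpansionOn.isSymmetric (hw : HasUniformExpansionOn w P M A U) (hM : 0 ≤ M)
    (hU : U ∈ 𝓝 x) (hP : HasFDerivWithinAt P L A x) (hA : IsThickAt A x) : L.IsSymmetric := by
  have hle (h k : E) : inner ℝ (L k) h ≤ inner ℝ (L h) k := by
    have hlim : Filter.Tendsto (fun τ : ℝ => τ * (4 * M * ‖k‖ ^ 2 - inner ℝ (L k) k)) (𝓝[>] 0)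
        (𝓝 0) := (Continuous.tendsto' (by fun_prop) _ _ (by simp)).mono_left nhdsWithin_le_nhds
    rw [← sub_nonpos]
    exact ge_of_tendsto hlim (eventually_mem_nhdsWithin.mono fun τ hτ =>
      hw.inner_sub_inner_le hM hU hP hA h k hτ)
  exact fun h k => ((hle k h).antisymm (hle h k)).trans (real_inner_comm _ _)

end QuadraticExpansions

theorem measure_image_eq_zero_of_lipschitzOn {E : Type*} [NormedAddCommGroup E] [NormedSpace ℝ E]
    [FiniteDimensional ℝ E] [MeasurableSpace E] [BorelSpace E] (μ : Measure E)
    [μ.IsAddHaarMeasure] {T : E → E} {K : ℝ≥0} {s : Set E} (hT : LipschitzOnWith K T s)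
    (hs : μ s = 0) : μ (T '' s) = 0 := by
  have hs' : μH[(Module.finrank ℝ E : ℝ)] s = 0 :=
    Measure.absolutelyContinuous_isAddHaarMeasure _ μ hs
  refine Measure.absolutelyContinuous_isAddHaarMeasure μ μH[(Module.finrank ℝ E : ℝ)] ?_
  refine le_antisymm ((hT.hausdorffMeasure_image_le (Nat.cast_nonneg _)).trans ?_) zero_le
  rw [hs', mul_zero]

/-- If `T` is differentiable almost everywhere on `A` and its Jacobian is at most `D` there, the
exceptional null set is not seen by the image because `T` is Lipschitz. -/
theorem measure_image_le_of_lipschitzOn {E : Type*} [NormedAddCommGroup E] [NormedSpace ℝ E]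
    [FiniteDimensional ℝ E] [MeasurableSpace E] [BorelSpace E] (μ : Measure E)
    [μ.IsAddHaarMeasure] {T : E → E} {K : ℝ≥0} {A : Set E} {D : ℝ} (hA : MeasurableSet A)
    (hT : LipschitzOnWith K T A)
    (hD : ∀ᵐ x ∂μ, x ∈ A → DifferentiableWithinAt ℝ T A x ∧ |(fderivWithin ℝ T A x).det| ≤ D) :
    μ (T '' A) ≤ ENNReal.ofReal D * μ A := by
  set N := toMeasurable μ {x | ¬ (x ∈ A →
    DifferentiableWithinAt ℝ T A x ∧ |(fderivWithin ℝ T A x).det| ≤ D)}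
  have hN : μ N = 0 := (measure_toMeasurable _).trans hD
  have hm : MeasurableSet (A \ N) := hA.diff (measurableSet_toMeasurable _ _)
  have hgood : ∀ x ∈ A \ N, DifferentiableWithinAt ℝ T A x ∧ |(fderivWithin ℝ T A x).det| ≤ D := by
    intro x hx
    by_contra hcon
    exact hx.2 (subset_toMeasurable _ _ fun h => hcon (h hx.1))
  have hbulk : μ (T '' (A \ N)) ≤ ENNReal.ofReal D * μ A := calc
    _ ≤ ∫⁻ x in A \ N, ENNReal.ofReal |(fderivWithin ℝ T A x).det| ∂μ :=
        addHaar_image_le_lintegral_abs_det_fderiv μ hm fun x hx =>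
          (hgood x hx).1.hasFDerivWithinAt.mono Set.sdiff_subset
    _ ≤ ∫⁻ _ in A \ N, ENNReal.ofReal D ∂μ :=
        setLIntegral_mono' hm fun x hx => ENNReal.ofReal_le_ofReal (hgood x hx).2
    _ ≤ _ := by
        rw [setLIntegral_const]
        gcongr
        exact Set.sdiff_subset
  have hnull : μ (T '' (A ∩ N)) = 0 := measure_image_eq_zero_of_lipschitzOn μ
    (hT.mono Set.inter_subset_left) (measure_mono_null Set.inter_subset_right hN)
  calc μ (T '' A) = μ (T '' (A \ N) ∪ T '' (A ∩ N)) := by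
        rw [← Set.image_union, Set.sdiff_union_inter]
    _ ≤ μ (T '' (A \ N)) + μ (T '' (A ∩ N)) := measure_union_le _ _
    _ ≤ _ := by rw [hnull, add_zero]; exact hbulk

section Contact

variable {E : Type*} [NormedAddCommGroup E] {v : E → ℝ} {a θ κ : ℝ} {B V : Set E} {q r : E × E}

/-- The pairs `(x, y)` of a vertex `y ∈ V` and a point `x ∈ B` at which a concave paraboloid of
opening `a` with vertex `y` touches `v` from below in `B`. -/
def contactPairs (B : Set E) (v : E → ℝ) (a : ℝ) (V : Set E) : Set (E × E) :=
  {q | q.1 ∈ B ∧ q.2 ∈ V ∧ ∀ z ∈ B, v q.1 + a / 2 * ‖q.1 - q.2‖ ^ 2 ≤ v z + a / 2 * ‖z - q.2‖ ^ 2}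

theorem isCompact_contactPairs (hv : Continuous v) (hB : IsCompact B) (hV : IsCompact V) :
    IsCompact (contactPairs B v a V) := by
  have hclosed : IsClosed {q : E × E |
      ∀ z ∈ B, v q.1 + a / 2 * ‖q.1 - q.2‖ ^ 2 ≤ v z + a / 2 * ‖z - q.2‖ ^ 2} := by
    simp only [Set.ofPred_forall]
    exact isClosed_iInter fun z => isClosed_iInter fun _ => isClosed_le (by fun_prop) (by fun_prop)
  convert (hB.prod hV).inter_right hclosed using 1
  ext q
  exact and_assoc.symm

theorem exists_mem_contactPairs (hv : Continuous v) (hB : IsCompact B) (hB' : B.Nonempty) {y : E}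
    (hy : y ∈ V) : ∃ z, (z, y) ∈ contactPairs B v a V := by
  obtain ⟨z, hz, hmin⟩ := hB.exists_isMinOn hB' (f := fun z => v z + a / 2 * ‖z - y‖ ^ 2)
    (by fun_prop)
  exact ⟨z, hz, hy, fun _ hz' => hmin hz'⟩

/-- The inf-convolution of `v` over `B` with the paraboloid of opening `κ`. -/
noncomputable def infConv (B : Set E) (v : E → ℝ) (κ : ℝ) (x : E) : ℝ :=
  sInf ((fun z => v z + κ / 2 * ‖x - z‖ ^ 2) '' B)

theorem infConv_le (hv : Continuous v) (hB : IsCompact B) (x : E) {z : E} (hz : z ∈ B) :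
    infConv B v κ x ≤ v z + κ / 2 * ‖x - z‖ ^ 2 :=
  csInf_le (hB.image (by fun_prop)).bddBelow ⟨z, hz, rfl⟩

variable [InnerProductSpace ℝ E]

theorem inner_sub_nonneg_of_mem_contactPairs (ha : 0 < a) (hq : q ∈ contactPairs B v a V)
    (hr : r ∈ contactPairs B v a V) : 0 ≤ inner ℝ (q.1 - r.1) (q.2 - r.2) := by
  have hqr := hq.2.2 r.1 hr.1
  have hrq := hr.2.2 q.1 hq.1
  simp only [norm_sub_sq_real] at hqr hrq
  refine nonneg_of_mul_nonneg_right ?_ ha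
  simp only [inner_sub_left, inner_sub_right]
  linarith

/-- The point dividing the segment from a contact point to its vertex in the ratio
`θ : (1 - θ)`. -/
def dividingPoint (θ : ℝ) (q : E × E) : E := q.1 + θ • (q.2 - q.1)

theorem continuous_dividingPoint : Continuous (dividingPoint θ : E × E → E) := by
  unfold dividingPoint
  fun_prop

theorem dividingPoint_sub_fst : dividingPoint θ q - q.1 = θ • (q.2 - q.1) :=
  add_sub_cancel_left _ _

theorem snd_sub_dividingPoint : q.2 - dividingPoint θ q = (1 - θ) • (q.2 - q.1) := by
  unfold dividingPoint
  module

/-- The map from contact points to vertices need not be Lipschitz, but it is monotone, so the map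
from dividing points to vertices is Lipschitz. -/
theorem mul_norm_sub_le_norm_dividingPoint_sub (ha : 0 < a) (hθ1 : θ < 1)
    (hq : q ∈ contactPairs B v a V) (hr : r ∈ contactPairs B v a V) :
    θ * ‖q.2 - r.2‖ ≤ ‖dividingPoint θ q - dividingPoint θ r‖ := by
  have hmono := mul_nonneg (sub_nonneg.2 hθ1.le) (inner_sub_nonneg_of_mem_contactPairs ha hq hr)
  have hdiv : dividingPoint θ q - dividingPoint θ r
      = (1 - θ) • (q.1 - r.1) + θ • (q.2 - r.2) := by
    unfold dividingPoint
    module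
  rcases (norm_nonneg (q.2 - r.2)).eq_or_lt with h0 | h0
  · simp [← h0]
  refine le_of_mul_le_mul_right ?_ h0
  have hCS := real_inner_le_norm (dividingPoint θ q - dividingPoint θ r) (q.2 - r.2)
  rw [hdiv, inner_add_left, real_inner_smul_left, real_inner_smul_left,
    real_inner_self_eq_norm_sq, ← hdiv] at hCS
  linarith

theorem exists_lipschitzOnWith_dividingPoint (ha : 0 < a) (hθ0 : 0 < θ) (hθ1 : θ < 1) :
    ∃ T : E → E, LipschitzOnWith (Real.toNNReal θ⁻¹) T
      (dividingPoint θ '' contactPairs B v a V) ∧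
      ∀ q ∈ contactPairs B v a V, T (dividingPoint θ q) = q.2 := by
  set Γ := contactPairs B v a V
  have hdist : ∀ q ∈ Γ, ∀ r ∈ Γ, θ * ‖q.2 - r.2‖ ≤ ‖dividingPoint θ q - dividingPoint θ r‖ :=
    fun q hq r hr => mul_norm_sub_le_norm_dividingPoint_sub ha hθ1 hq hr
  have hfactor : Function.FactorsThrough (fun q : Γ => q.1.2) fun q : Γ => dividingPoint θ q.1 := by
    intro q r hqr
    have h := hdist q q.2 r r.2
    rw [sub_eq_zero.2 hqr, norm_zero] at h
    exact sub_eq_zero.1 (norm_le_zero_iff.1 (nonpos_of_mul_nonpos_right h hθ0))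
  have hT (q) (hq : q ∈ Γ) := hfactor.extend_apply (fun _ => (0 : E)) ⟨q, hq⟩
  refine ⟨_, LipschitzOnWith.of_dist_le_mul ?_, hT⟩
  rintro _ ⟨q, hq, rfl⟩ _ ⟨r, hr, rfl⟩
  rw [hT q hq, hT r hr, dist_eq_norm, dist_eq_norm, Real.coe_toNNReal _ (by positivity),
    inv_mul_eq_div, le_div_iff₀ hθ0, mul_comm]
  exact hdist q hq r hr

theorem norm_add_sq_le_div_add_div (hθ0 : 0 < θ) (hθ1 : θ < 1) (x y : E) :
    ‖x + y‖ ^ 2 ≤ ‖x‖ ^ 2 / θ + ‖y‖ ^ 2 / (1 - θ) := by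
  have h1 : 0 < 1 - θ := sub_pos.2 hθ1
  have hsq := sq_nonneg ‖(1 - θ) • x - θ • y‖
  rw [norm_sub_sq_real, norm_smul, norm_smul, Real.norm_of_nonneg hθ0.le,
    Real.norm_of_nonneg h1.le, real_inner_smul_left, real_inner_smul_right] at hsq
  rw [norm_add_sq_real, div_add_div _ _ hθ0.ne' h1.ne', le_div_iff₀ (by positivity)]
  linarith

/-- A paraboloid of opening `a` is the inf-convolution, with opening `a / θ`, of the one of opening
`a / (1 - θ)` with the same vertex, so touching `v` becomes touching its inf-convolution. -/
theorem le_infConv (ha : 0 < a) (hθ0 : 0 < θ) (hθ1 : θ < 1) (hq : q ∈ contactPairs B v a V)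
    (y : E) : v q.1 + a / 2 * ‖q.1 - q.2‖ ^ 2 - a / (1 - θ) / 2 * ‖y - q.2‖ ^ 2
      ≤ infConv B v (a / θ) y := by
  refine le_csInf ⟨_, q.1, hq.1, rfl⟩ ?_
  rintro _ ⟨z, hz, rfl⟩
  have htri := norm_add_sq_le_div_add_div hθ0 hθ1 (z - y) (y - q.2)
  rw [sub_add_sub_cancel, norm_sub_rev z y] at htri
  calc v q.1 + a / 2 * ‖q.1 - q.2‖ ^ 2 - a / (1 - θ) / 2 * ‖y - q.2‖ ^ 2
      ≤ v z + a / 2 * ‖z - q.2‖ ^ 2 - a / (1 - θ) / 2 * ‖y - q.2‖ ^ 2 := by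
        exact sub_le_sub_right (hq.2.2 z hz) _
    _ ≤ v z + a / 2 * (‖y - z‖ ^ 2 / θ + ‖y - q.2‖ ^ 2 / (1 - θ))
        - a / (1 - θ) / 2 * ‖y - q.2‖ ^ 2 := by gcongr
    _ = _ := by ring

theorem infConv_dividingPoint (hv : Continuous v) (hB : IsCompact B) (ha : 0 < a) (hθ0 : 0 < θ)
    (hθ1 : θ < 1) (hq : q ∈ contactPairs B v a V) :
    infConv B v (a / θ) (dividingPoint θ q)
      = v q.1 + a / θ / 2 * ‖dividingPoint θ q - q.1‖ ^ 2 := by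
  refine (infConv_le hv hB _ hq.1).antisymm (le_trans (le_of_eq ?_) (le_infConv ha hθ0 hθ1 hq _))
  have h1 : 0 < 1 - θ := sub_pos.2 hθ1
  rw [norm_sub_rev _ q.2, norm_sub_rev _ q.2, snd_sub_dividingPoint, dividingPoint_sub_fst,
    norm_smul, norm_smul,
    Real.norm_of_nonneg hθ0.le, Real.norm_of_nonneg h1.le]
  field_simp
  ring

theorem infConv_sub_le (hv : Continuous v) (hB : IsCompact B) (ha : 0 < a) (hθ0 : 0 < θ)
    (hθ1 : θ < 1) (hq : q ∈ contactPairs B v a V) (y : E) :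
    infConv B v (a / θ) y - infConv B v (a / θ) (dividingPoint θ q)
      - inner ℝ (a • (q.2 - q.1)) (y - dividingPoint θ q)
      ≤ a / θ / 2 * ‖y - dividingPoint θ q‖ ^ 2 := by
  have hle := infConv_le (κ := a / θ) hv hB y hq.1
  rw [← sub_add_sub_cancel y (dividingPoint θ q), norm_add_sq_real, real_inner_comm,
    dividingPoint_sub_fst, real_inner_smul_left] at hle
  rw [infConv_dividingPoint hv hB ha hθ0 hθ1 hq, dividingPoint_sub_fst, real_inner_smul_left]
  field_simp at hle ⊢
  linarith

theorem le_infConv_sub (hv : Continuous v) (hB : IsCompact B) (ha : 0 < a) (hθ0 : 0 < θ)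
    (hθ1 : θ < 1) (hq : q ∈ contactPairs B v a V) (y : E) :
    -(a / (1 - θ) / 2) * ‖y - dividingPoint θ q‖ ^ 2
      ≤ infConv B v (a / θ) y - infConv B v (a / θ) (dividingPoint θ q)
        - inner ℝ (a • (q.2 - q.1)) (y - dividingPoint θ q) := by
  have h1 : 0 < 1 - θ := sub_pos.2 hθ1
  have hle := le_infConv ha hθ0 hθ1 hq y
  rw [← sub_sub_sub_cancel_right y q.2 (dividingPoint θ q), snd_sub_dividingPoint,
    norm_sub_sq_real (y - _), real_inner_comm, real_inner_smul_left, norm_smul,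
    Real.norm_of_nonneg h1.le, norm_sub_rev q.1] at hle
  rw [infConv_dividingPoint hv hB ha hθ0 hθ1 hq, dividingPoint_sub_fst, real_inner_smul_left,
    norm_smul, Real.norm_of_nonneg hθ0.le]
  field_simp at hle ⊢
  linarith

theorem HasQuadExpansion.hasSubjet_of_infConv (hv : Continuous v) (hB : IsCompact B) {x z p : E}
    {H : E →L[ℝ] E} (h : HasQuadExpansion (infConv B v κ) x p H) (hz : z ∈ interior B)
    (hx : infConv B v κ x = v z + κ / 2 * ‖x - z‖ ^ 2) {ε : ℝ} (hε : 0 < ε) :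
    HasSubjet v z p (H - ε • (1 : E →L[ℝ] E)) := by
  have htranslate : Filter.Tendsto (fun y => x + (y - z)) (𝓝 z) (𝓝 x) :=
    Continuous.tendsto' (by fun_prop) _ _ (by simp)
  filter_upwards [htranslate.eventually (h.def (half_pos hε)),
    mem_interior_iff_mem_nhds.1 hz] with y hy hyB
  have hle := infConv_le (κ := κ) hv hB (x + (y - z)) hyB
  rw [show x + (y - z) - y = x - z by abel] at hle
  rw [add_sub_cancel_left, norm_pow, norm_norm, quadPoly, add_sub_cancel_left,
    Real.norm_eq_abs] at hy
  rw [quadPoly, sub_apply, smul_apply, one_apply_eq_self, inner_sub_left, real_inner_smul_left,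
    real_inner_self_eq_norm_sq]
  linarith [(abs_le.1 hy).1]

end Contact

section VertexMeasure

variable {E : Type*} [NormedAddCommGroup E] [InnerProductSpace ℝ E] {v : E → ℝ} {a θ C : ℝ}
  {B V : Set E}

/-- At the points `(x, y)` of `contactPairs B v a V`, the positive part of the Hessian of `v` has
trace at most `C * a`, where Hessians are shifted by their lower bound `-3 a`. -/
def ContactTraceBound (B : Set E) (v : E → ℝ) (a : ℝ) (V : Set E) (C : ℝ) : Prop :=
  ∀ q ∈ contactPairs B v a V, ∀ P : E →L[ℝ] E, P.IsPositive →
    HasSubjet v q.1 (a • (q.2 - q.1)) (P - (3 * a) • (1 : E →L[ℝ] E)) →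
    LinearMap.trace ℝ E P ≤ C * a

theorem smul_apply_dividingPoint_sub (hθ1 : θ < 1) {q : E × E} {T : E → E}
    (hT : T (dividingPoint θ q) = q.2) :
    (a / (1 - θ)) • (T (dividingPoint θ q) - dividingPoint θ q) = a • (q.2 - q.1) := by
  rw [hT, snd_sub_dividingPoint, smul_smul, div_mul_cancel₀ _ (sub_pos.2 hθ1).ne']

theorem hasUniformExpansionOn_infConv (hv : Continuous v) (hB : IsCompact B) (ha : 0 < a)
    (hθ0 : 0 < θ) (hθ1 : θ < 1) {T : E → E}
    (hT : ∀ q ∈ contactPairs B v a V, T (dividingPoint θ q) = q.2) :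
    HasUniformExpansionOn (infConv B v (a / θ)) (fun x => (a / (1 - θ)) • (T x - x))
      (a / (1 - θ) / 2 + a / θ / 2) (dividingPoint θ '' contactPairs B v a V) Set.univ := by
  rintro _ ⟨q, hq, rfl⟩ y -
  beta_reduce
  have := sub_pos.2 hθ1
  rw [smul_apply_dividingPoint_sub hθ1 (hT q hq), abs_le, add_mul]
  have hlower : 0 ≤ a / (1 - θ) / 2 * ‖y - dividingPoint θ q‖ ^ 2 := by positivity
  have hupper : 0 ≤ a / θ / 2 * ‖y - dividingPoint θ q‖ ^ 2 := by positivity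
  constructor
  · linarith [le_infConv_sub hv hB ha hθ0 hθ1 hq y]
  · linarith [infConv_sub_le hv hB ha hθ0 hθ1 hq y]

theorem isPositive_of_smul_sub_one {L : E →L[ℝ] E} {α : ℝ} (hα : 0 < α)
    (hsymm : (α • (L - 1)).IsSymmetric)
    (hpos : ∀ k, -α * ‖k‖ ^ 2 ≤ inner ℝ ((α • (L - 1)) k) k) : L.IsPositive := by
  simp only [smul_apply, sub_apply, one_apply_eq_self, real_inner_smul_left, inner_sub_left,
    real_inner_self_eq_norm_sq] at hpos
  refine (L.isPositive_iff).2 ⟨fun h k => ?_, fun k => ?_⟩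
  · have hhk := hsymm.apply_clm h k
    simp only [smul_apply, sub_apply, one_apply_eq_self, real_inner_smul_left,
      real_inner_smul_right, inner_sub_left, inner_sub_right] at hhk
    exact sub_left_injective (mul_left_cancel₀ hα.ne' hhk)
  · exact nonneg_of_mul_nonneg_right (by linarith [hpos k]) hα

variable [FiniteDimensional ℝ E]

theorem ContactTraceBound.trace_le (htrace : ContactTraceBound B v a V C) {q : E × E}
    (hq : q ∈ contactPairs B v a V) (ha : 0 < a) {α : ℝ} (haα : a ≤ α) (hα : α ≤ 2 * a)
    {L : E →L[ℝ] E} (hL : L.IsPositive) (hsub : HasSubjet v q.1 (a • (q.2 - q.1))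
      (α • (L - 1) - a • (1 : E →L[ℝ] E))) : LinearMap.trace ℝ E L ≤ C := by
  have hbound := htrace q hq (α • L + (2 * a - α) • 1)
    ((hL.smul_of_nonneg (ha.le.trans haα)).add
      (ContinuousLinearMap.isPositive_one.smul_of_nonneg (sub_nonneg.2 hα)))
    (by convert hsub using 1; module)
  have htr : LinearMap.trace ℝ E (α • L + (2 * a - α) • 1 : E →L[ℝ] E)
      = α * LinearMap.trace ℝ E L + (2 * a - α) * Module.finrank ℝ E := by
    rw [ContinuousLinearMap.toLinearMap_add, ContinuousLinearMap.toLinearMap_smul,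
      ContinuousLinearMap.toLinearMap_smul, ContinuousLinearMap.toLinearMap_one, map_add, map_smul,
      map_smul, LinearMap.trace_one, smul_eq_mul, smul_eq_mul]
  refine le_of_mul_le_mul_right ?_ ha
  calc LinearMap.trace ℝ E L * a ≤ α * LinearMap.trace ℝ E L := by
        rw [mul_comm]
        exact mul_le_mul_of_nonneg_right haα hL.toLinearMap.trace_nonneg
    _ ≤ α * LinearMap.trace ℝ E L + (2 * a - α) * Module.finrank ℝ E :=
        le_add_of_nonneg_right (mul_nonneg (sub_nonneg.2 hα) (Nat.cast_nonneg _))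
    _ ≤ C * a := htr ▸ hbound

/-- The gradient of the inf-convolution is `a / (1 - θ) * (T x - x)`, with `T` mapping dividing
points to vertices; so the Hessian bounds of the inf-convolution turn into bounds for `DT`. -/
theorem abs_det_fderivWithin_le_of_contactTraceBound (hv : Continuous v) (hB : IsCompact B)
    (ha : 0 < a) (hθ0 : 0 < θ) (hθ1 : θ ≤ 1 / 2)
    (hint : ∀ q ∈ contactPairs B v a V, q.1 ∈ interior B) (htrace : ContactTraceBound B v a V C)
    {T : E → E} (hT : ∀ q ∈ contactPairs B v a V, T (dividingPoint θ q) = q.2) {x : E}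
    (hx : x ∈ dividingPoint θ '' contactPairs B v a V)
    (hthick : IsThickAt (dividingPoint θ '' contactPairs B v a V) x)
    (hdiff : DifferentiableWithinAt ℝ T (dividingPoint θ '' contactPairs B v a V) x) :
    |(fderivWithin ℝ T (dividingPoint θ '' contactPairs B v a V) x).det|
      ≤ C ^ Module.finrank ℝ E := by
  set A := dividingPoint θ '' contactPairs B v a V
  set L := fderivWithin ℝ T A x
  set α := a / (1 - θ)
  have h1θ : 0 < 1 - θ := by linarith
  have hθ1' : θ < 1 := by linarith
  have hα : 0 < α := by positivity
  have haα : a ≤ α := (le_div_iff₀ h1θ).2 (by nlinarith)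
  have hα2 : α ≤ 2 * a := (div_le_iff₀ h1θ).2 (by nlinarith)
  have huniform := hasUniformExpansionOn_infConv hv hB ha hθ0 hθ1' hT
  have hderiv : HasFDerivWithinAt (fun x => α • (T x - x)) (α • (L - 1)) A x :=
    (hdiff.hasFDerivWithinAt.sub (hasFDerivWithinAt_id x A)).const_smul α
  have hM : 0 ≤ α / 2 + a / θ / 2 := by positivity
  have hexp := huniform.hasQuadExpansion hM Filter.univ_mem hderiv hthick
  have hsymm := huniform.isSymmetric hM Filter.univ_mem hderiv hthick
  obtain ⟨q, hq, rfl⟩ := hx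
  rw [smul_apply_dividingPoint_sub hθ1' (hT q hq)] at hexp
  have hL : L.IsPositive := isPositive_of_smul_sub_one hα hsymm fun k =>
    (hexp.mul_sq_norm_le (.of_forall (le_infConv_sub hv hB ha hθ0 hθ1' hq)) k).trans' (by
      rw [mul_neg, mul_div_cancel₀ _ two_ne_zero])
  have htr := htrace.trace_le hq ha haα hα2 hL (hexp.hasSubjet_of_infConv hv hB (hint q hq)
    (infConv_dividingPoint hv hB ha hθ0 hθ1' hq) ha)
  exact (abs_det_le_trace_pow_of_isPositive hL).trans
    (pow_le_pow_left₀ hL.toLinearMap.trace_nonneg htr _)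

variable [MeasurableSpace E] [BorelSpace E] (μ : Measure E) [μ.IsAddHaarMeasure]

theorem measure_vertices_le_dividingPoint (hv : Continuous v) (hB : IsCompact B)
    (hB' : B.Nonempty) (hV : IsCompact V) (ha : 0 < a) (hθ0 : 0 < θ) (hθ1 : θ ≤ 1 / 2)
    (hint : ∀ q ∈ contactPairs B v a V, q.1 ∈ interior B)
    (htrace : ContactTraceBound B v a V C) :
    μ V ≤ ENNReal.ofReal (C ^ Module.finrank ℝ E)
      * μ (dividingPoint θ '' contactPairs B v a V) := by
  obtain ⟨T, hTL, hT⟩ := exists_lipschitzOnWith_dividingPoint (B := B) (v := v) (V := V) ha hθ0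
    (by linarith)
  have hVT : V ⊆ T '' (dividingPoint θ '' contactPairs B v a V) := by
    intro y hy
    obtain ⟨z, hz⟩ := exists_mem_contactPairs (a := a) hv hB hB' hy
    exact ⟨_, ⟨_, hz, rfl⟩, hT _ hz⟩
  have hA : MeasurableSet (dividingPoint θ '' contactPairs B v a V) :=
    ((isCompact_contactPairs hv hB hV).image continuous_dividingPoint).measurableSet
  refine (measure_mono hVT).trans (measure_image_le_of_lipschitzOn μ hA hTL ?_)
  filter_upwards [hTL.ae_differentiableWithinAt_of_mem (μ := μ),
    (ae_restrict_iff' hA).1 (ae_isThickAt μ _)] with x hdiff hthick hx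
  exact ⟨hdiff hx, abs_det_fderivWithin_le_of_contactTraceBound hv hB ha hθ0 hθ1 hint htrace hT hx
    (hthick hx) (hdiff hx)⟩

theorem measure_vertices_le (hv : Continuous v) (hB : IsCompact B) (hB' : B.Nonempty)
    (hV : IsCompact V) (ha : 0 < a) (hint : ∀ q ∈ contactPairs B v a V, q.1 ∈ interior B)
    (htrace : ContactTraceBound B v a V C) :
    μ V ≤ ENNReal.ofReal (C ^ Module.finrank ℝ E) * μ (Prod.fst '' contactPairs B v a V) := by
  have hΓ := isCompact_contactPairs (a := a) hv hB hV
  obtain ⟨R, hR⟩ : ∃ R, ∀ q ∈ contactPairs B v a V, ‖q.2 - q.1‖ ≤ R :=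
    hΓ.exists_bound_of_continuousOn (f := fun q => q.2 - q.1) (by fun_prop)
  have hradius : Filter.Tendsto (fun θ : ℝ => θ * R) (𝓝[>] 0) (𝓝 0) :=
    (Continuous.tendsto' (by fun_prop) _ _ (by simp)).mono_left nhdsWithin_le_nhds
  have hlim := ENNReal.Tendsto.const_mul (a := ENNReal.ofReal (C ^ Module.finrank ℝ E))
    ((tendsto_measure_cthickening_of_isCompact (μ := μ) (hΓ.image continuous_fst)).comp hradius)
    (Or.inr ENNReal.ofReal_ne_top)
  refine ge_of_tendsto hlim ?_
  filter_upwards [Ioc_mem_nhdsGT one_half_pos] with θ hθ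
  refine (measure_vertices_le_dividingPoint μ hv hB hB' hV ha hθ.1 hθ.2 hint htrace).trans ?_
  rw [Function.comp_apply]
  gcongr
  rintro _ ⟨q, hq, rfl⟩
  refine mem_cthickening_of_dist_le _ q.1 _ _ ⟨q, hq, rfl⟩ ?_
  rw [dist_eq_norm, dividingPoint_sub_fst, norm_smul, Real.norm_of_nonneg hθ.1.le]
  exact mul_le_mul_of_nonneg_left (hR q hq) hθ.1.le

end VertexMeasure

section TouchingParaboloids

variable {E : Type*} [NormedAddCommGroup E] [InnerProductSpace ℝ E] {u v : E → ℝ} {B V : Set E}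
  {a c : ℝ} {x p q : E}

/-- The concave paraboloid of opening `a` with slope `p` at `x` touches `u` from below at `x`
in `B`. -/
def TouchesBelow (B : Set E) (u : E → ℝ) (a : ℝ) (x p : E) : Prop :=
  ∀ y ∈ B, u x + inner ℝ p (y - x) - a / 2 * ‖y - x‖ ^ 2 ≤ u y

/-- The points of `B` at which some concave paraboloid of opening `a` touches `u` from below
in `B`. -/
def touchSet (B : Set E) (u : E → ℝ) (a : ℝ) : Set E :=
  {x | x ∈ B ∧ ∃ p, TouchesBelow B u a x p}

theorem TouchesBelow.mono (h : TouchesBelow B u a x p) (hac : a ≤ c) : TouchesBelow B u c x p :=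
  fun y hy => (h y hy).trans' (by gcongr)

theorem TouchesBelow.mono_set (h : TouchesBelow B u a x p) (hVB : V ⊆ B) :
    TouchesBelow V u a x p :=
  fun y hy => h y (hVB hy)

theorem touchSet_mono (hac : a ≤ c) : touchSet B u a ⊆ touchSet B u c :=
  fun _ ⟨hx, p, hp⟩ => ⟨hx, p, hp.mono hac⟩

theorem TouchesBelow.add (hu : TouchesBelow B u a x p) (hv : TouchesBelow B v c x q) :
    TouchesBelow B (u + v) (a + c) x (p + q) := by
  intro y hy
  rw [Pi.add_apply, Pi.add_apply, inner_add_left]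
  linarith [hu y hy, hv y hy]

theorem TouchesBelow.const_mul (h : TouchesBelow B u a x p) (hc : 0 ≤ c) :
    TouchesBelow B (fun y => c * u y) (c * a) x (c • p) := by
  intro y hy
  rw [real_inner_smul_left]
  linarith [mul_le_mul_of_nonneg_left (h y hy) hc]

theorem TouchesBelow.hasSubjet (h : TouchesBelow B u a x p) (hB : B ∈ 𝓝 x) :
    HasSubjet u x p (-(a • 1)) := by
  filter_upwards [hB] with y hy
  refine (h y hy).trans' (le_of_eq ?_)
  simp only [quadPoly, neg_apply, smul_apply, one_apply_eq_self, inner_neg_left,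
    real_inner_smul_left, real_inner_self_eq_norm_sq]
  ring

theorem touchesBelow_quadPoly (c a : ℝ) (x p z : E) :
    TouchesBelow Set.univ (quadPoly c x p (-(a • 1))) a z (p - a • (z - x)) := by
  intro y _
  have hsymm : (-(a • (1 : E →L[ℝ] E))).IsSymmetric := by
    rw [← neg_smul]
    exact LinearMap.IsSymmetric.one.smul (by simp)
  refine le_of_eq ?_
  rw [quadPoly_recentre c x p z hsymm y, quadPoly.eq_def (quadPoly c x p _ z)]
  simp only [neg_apply, smul_apply, one_apply_eq_self, inner_neg_left, real_inner_smul_left,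
    real_inner_self_eq_norm_sq, ← sub_eq_add_neg]
  ring

theorem touchesBelow_of_mem_contactPairs {r : E × E} (hr : r ∈ contactPairs B u a V) :
    TouchesBelow B u a r.1 (a • (r.2 - r.1)) := by
  intro y hy
  have hmin := hr.2.2 y hy
  rw [show y - r.2 = (r.1 - r.2) + (y - r.1) by abel, norm_add_sq_real] at hmin
  rw [real_inner_smul_left, ← neg_sub r.1 r.2, inner_neg_left]
  linarith

theorem norm_mul_le_of_forall_inner_le {b t : ℝ} (ht : 0 ≤ t)
    (h : ∀ e : E, ‖e‖ ≤ t → inner ℝ p e ≤ b) : ‖p‖ * t ≤ b := by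
  have he := h ((t * ‖p‖⁻¹) • p) <| by
    rw [norm_smul, norm_mul, norm_inv, norm_norm, Real.norm_of_nonneg ht, mul_assoc]
    exact mul_le_of_le_one_right ht inv_mul_le_one
  rwa [real_inner_smul_right, real_inner_self_eq_norm_sq, sq, mul_assoc, ← mul_assoc _ ‖p‖,
    inv_mul_mul_self, mul_comm] at he

theorem TouchesBelow.norm_slope_mul_le {K t : ℝ} (h : TouchesBelow B u a x p)
    (hu : ∀ y ∈ B, |u y| ≤ K) (ha : 0 ≤ a) (ht : 0 ≤ t) (hB : closedBall x t ⊆ B) :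
    ‖p‖ * t ≤ 2 * K + a / 2 * t ^ 2 := by
  refine norm_mul_le_of_forall_inner_le ht fun e he => ?_
  have hy : x + e ∈ B := hB (by rwa [mem_closedBall, dist_self_add_left])
  have htouch := h _ hy
  rw [add_sub_cancel_left] at htouch
  have hsq : a / 2 * ‖e‖ ^ 2 ≤ a / 2 * t ^ 2 := by gcongr
  linarith [(abs_le.1 (hu _ hy)).2, (abs_le.1 (hu x (hB (mem_closedBall_self ht)))).1]

end TouchingParaboloids

section Gaussian

variable {E : Type*} [NormedAddCommGroup E] {κ : ℝ}

/-- The Gaussian of decay `κ` centred at `x₀`. -/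
noncomputable def gaussianBump (κ : ℝ) (x₀ x : E) : ℝ := Real.exp (-κ * ‖x - x₀‖ ^ 2)

theorem gaussianBump_pos (κ : ℝ) (x₀ x : E) : 0 < gaussianBump κ x₀ x := Real.exp_pos _

theorem gaussianBump_le_one (hκ : 0 ≤ κ) (x₀ x : E) : gaussianBump κ x₀ x ≤ 1 :=
  Real.exp_le_one_iff.2 (by rw [neg_mul, neg_nonpos]; positivity)

theorem gaussianBump_div_sq (b r : ℝ) (x₀ x : E) :
    gaussianBump (b / r ^ 2) x₀ x = Real.exp (-b * (‖x - x₀‖ / r) ^ 2) := by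
  rw [gaussianBump]
  congr 1
  ring

variable [InnerProductSpace ℝ E]

theorem gaussianBump_add (κ : ℝ) (x₀ z h : E) :
    gaussianBump κ x₀ (z + h)
      = gaussianBump κ x₀ z * Real.exp (-(2 * κ * inner ℝ (z - x₀) h + κ * ‖h‖ ^ 2)) := by
  rw [gaussianBump, gaussianBump, ← Real.exp_add, add_sub_right_comm, norm_add_sq_real]
  congr 1
  ring

theorem touchesBelow_gaussianBump (hκ : 0 ≤ κ) (x₀ z : E) :
    TouchesBelow Set.univ (gaussianBump κ x₀) (2 * κ) z
      (-(2 * κ * gaussianBump κ x₀ z) • (z - x₀)) := by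
  intro y _
  obtain ⟨h, rfl⟩ : ∃ h, y = z + h := ⟨y - z, by abel⟩
  rw [add_sub_cancel_left, gaussianBump_add, real_inner_smul_left]
  have hexp := mul_le_mul_of_nonneg_left
    (Real.add_one_le_exp (-(2 * κ * inner ℝ (z - x₀) h + κ * ‖h‖ ^ 2))) (gaussianBump_pos κ x₀ z).le
  have hone := mul_le_mul_of_nonneg_right (gaussianBump_le_one hκ x₀ z)
    (by positivity : 0 ≤ κ * ‖h‖ ^ 2)
  linarith

theorem one_add_add_sq_div_four_le_exp {t : ℝ} (ht : -2 ≤ t) :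
    1 + t + t ^ 2 / 4 ≤ Real.exp t := by
  have hsq : Real.exp t = Real.exp (t / 2) ^ 2 := by rw [← Real.exp_nat_mul]; congr 1; ring
  have := Real.add_one_le_exp (t / 2)
  rw [hsq]
  nlinarith

theorem hasSubjet_gaussianBump (hκ : 0 ≤ κ) (x₀ z : E) :
    HasSubjet (gaussianBump κ x₀) z (-(2 * κ * gaussianBump κ x₀ z) • (z - x₀))
      ((κ ^ 2 * gaussianBump κ x₀ z) • InnerProductSpace.rankOne ℝ (z - x₀) (z - x₀)
        - (4 * κ * gaussianBump κ x₀ z) • 1) := by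
  have hlin : ∀ᶠ y in 𝓝 z, 2 * κ * inner ℝ (z - x₀) (y - z) + κ * ‖y - z‖ ^ 2 < 2 :=
    ContinuousAt.eventually_lt (by fun_prop) (by fun_prop) (by simp)
  have hsq : ∀ᶠ y in 𝓝 z, κ * ‖y - z‖ ^ 2 < 4 :=
    ContinuousAt.eventually_lt (by fun_prop) (by fun_prop) (by simp)
  filter_upwards [hlin, hsq] with y hlin hsq
  obtain ⟨h, rfl⟩ : ∃ h, y = z + h := ⟨y - z, by abel⟩
  rw [add_sub_cancel_left] at hlin hsq
  set i := κ * inner ℝ (z - x₀) h with hi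
  set j := κ * ‖h‖ ^ 2 with hj
  have hj0 : 0 ≤ j := by positivity
  have hexp : 1 - 2 * i - 2 * j + i ^ 2 / 2 ≤ Real.exp (-(2 * i + j)) := by
    refine (one_add_add_sq_div_four_le_exp (by linarith)).trans' ?_
    nlinarith [sq_nonneg (i + j)]
  have hpoly : quadPoly (gaussianBump κ x₀ z) z (-(2 * κ * gaussianBump κ x₀ z) • (z - x₀))
      ((κ ^ 2 * gaussianBump κ x₀ z) • InnerProductSpace.rankOne ℝ (z - x₀) (z - x₀)
        - (4 * κ * gaussianBump κ x₀ z) • 1) (z + h)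
      = gaussianBump κ x₀ z * (1 - 2 * i - 2 * j + i ^ 2 / 2) := by
    simp only [quadPoly, add_sub_cancel_left, sub_apply, smul_apply, one_apply_eq_self,
      InnerProductSpace.rankOne_apply, inner_sub_left, real_inner_smul_left,
      real_inner_self_eq_norm_sq, hi, hj]
    ring
  rw [hpoly, gaussianBump_add, mul_assoc 2 κ]
  exact mul_le_mul_of_nonneg_left hexp (gaussianBump_pos κ x₀ z).le

end Gaussian

section Barrier

variable {E : Type*} [NormedAddCommGroup E] [InnerProductSpace ℝ E] {u : E → ℝ} {B V : Set E}
  {S A b r c lam Lam : ℝ} {x₀ x₁ p z y : E} {q : E × E}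

/-- The concave paraboloid of opening `S ^ 2` with slope `p` at `x₁`, raised by a Gaussian of width
`r` around `x₀` that vanishes at distance `3 / 2 * r` from `x₀`. -/
noncomputable def barrier (S A b r c : ℝ) (x₀ x₁ p : E) : E → ℝ :=
  quadPoly (c - S ^ 2 * A * r ^ 2 * Real.exp (-b * (3 / 2) ^ 2)) x₁ p (-(S ^ 2 • 1))
    + fun x => S ^ 2 * A * r ^ 2 * gaussianBump (b / r ^ 2) x₀ x

/-- The gradient of `barrier`. -/
noncomputable def barrierGradient (S A b r : ℝ) (x₀ x₁ p x : E) : E :=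
  p - S ^ 2 • (x - x₁) - (2 * S ^ 2 * A * b * gaussianBump (b / r ^ 2) x₀ x) • (x - x₀)

theorem continuous_barrier : Continuous (barrier S A b r c x₀ x₁ p) := by
  have := (contDiff_quadPoly (c - S ^ 2 * A * r ^ 2 * Real.exp (-b * (3 / 2) ^ 2)) x₁ p
    (-(S ^ 2 • (1 : E →L[ℝ] E)))).continuous
  unfold barrier gaussianBump
  fun_prop

theorem barrier_apply (x : E) : barrier S A b r c x₀ x₁ p x
    = c + inner ℝ p (x - x₁) - S ^ 2 / 2 * ‖x - x₁‖ ^ 2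
      + S ^ 2 * A * r ^ 2
        * (Real.exp (-b * (‖x - x₀‖ / r) ^ 2) - Real.exp (-b * (3 / 2) ^ 2)) := by
  simp only [barrier, Pi.add_apply, quadPoly, neg_apply, smul_apply, one_apply_eq_self,
    inner_neg_left, real_inner_smul_left, real_inner_self_eq_norm_sq, gaussianBump_div_sq]
  ring

theorem barrierGradient_eq (hr : r ≠ 0) (x : E) : barrierGradient S A b r x₀ x₁ p x
    = p - S ^ 2 • (x - x₁) + (S ^ 2 * A * r ^ 2)
      • -(2 * (b / r ^ 2) * gaussianBump (b / r ^ 2) x₀ x) • (x - x₀) := by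
  rw [barrierGradient, sub_eq_add_neg _ ((_ : ℝ) • _), ← neg_smul, smul_smul]
  congr 2
  field_simp

theorem touchesBelow_barrier (hA : 0 ≤ A) (hb : 0 ≤ b) (hr : r ≠ 0) (S c : ℝ) (x₀ x₁ p z : E) :
    TouchesBelow Set.univ (barrier S A b r c x₀ x₁ p) ((1 + 2 * A * b) * S ^ 2) z
      (barrierGradient S A b r x₀ x₁ p z) := by
  have hopening : (1 + 2 * A * b) * S ^ 2 = S ^ 2 + S ^ 2 * A * r ^ 2 * (2 * (b / r ^ 2)) := by
    field_simp
  rw [barrierGradient_eq hr, hopening]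
  exact (touchesBelow_quadPoly _ (S ^ 2) x₁ p z).add
    ((touchesBelow_gaussianBump (by positivity) x₀ z).const_mul (by positivity))

theorem hasSubjet_barrier (hA : 0 ≤ A) (hb : 0 ≤ b) (hr : r ≠ 0) (S c : ℝ) (x₀ x₁ p z : E) :
    HasSubjet (barrier S A b r c x₀ x₁ p) z (barrierGradient S A b r x₀ x₁ p z)
      ((S ^ 2 * (A * b * gaussianBump (b / r ^ 2) x₀ z) * (b / r ^ 2))
          • InnerProductSpace.rankOne ℝ (z - x₀) (z - x₀)
        - ((1 + 4 * (A * b * gaussianBump (b / r ^ 2) x₀ z)) * S ^ 2) • 1) := by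
  have hrankOne : S ^ 2 * (A * b * gaussianBump (b / r ^ 2) x₀ z) * (b / r ^ 2)
      = S ^ 2 * A * r ^ 2 * ((b / r ^ 2) ^ 2 * gaussianBump (b / r ^ 2) x₀ z) := by
    field_simp
  have hone : (1 + 4 * (A * b * gaussianBump (b / r ^ 2) x₀ z)) * S ^ 2
      = S ^ 2 + S ^ 2 * A * r ^ 2 * (4 * (b / r ^ 2) * gaussianBump (b / r ^ 2) x₀ z) := by
    field_simp
  rw [barrierGradient_eq hr, hrankOne, hone, add_smul, sub_add_eq_sub_sub_swap,
    mul_smul _ _ (InnerProductSpace.rankOne ℝ _ _), mul_smul _ _ (1 : E →L[ℝ] E), ← smul_sub,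
    sub_eq_neg_add _ (S ^ 2 • 1)]
  exact ((touchesBelow_quadPoly _ (S ^ 2) x₁ p z).hasSubjet Filter.univ_mem).add
    ((hasSubjet_gaussianBump (κ := b / r ^ 2) (by positivity) x₀ z).const_mul (by positivity))

theorem mem_touchSet_of_mem_contactPairs_sub_barrier (hA : 0 ≤ A) (hb : 0 ≤ b) (hr : r ≠ 0)
    (hq : q ∈ contactPairs B (u - barrier S A b r c x₀ x₁ p) (S ^ 2) V) :
    q.1 ∈ touchSet B u ((2 + 2 * A * b) * S ^ 2) := by
  have h := (touchesBelow_of_mem_contactPairs hq).add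
    fun x _ => touchesBelow_barrier hA hb hr S c x₀ x₁ p q.1 x trivial
  rw [sub_add_cancel] at h
  exact ⟨hq.1, _, h.mono (by linarith)⟩

/-- The conditions on the height `A` and the decay `b` of the Gaussian and on the opening `S ^ 2` of
the paraboloid under which `barrier` proves the density estimate in dimension `d`. -/
structure BarrierConstants (d : ℕ) (lam Lam A b S : ℝ) : Prop where
  height_pos : 0 < A
  decay_pos : 0 < b
  le_decay : 4 * Lam * d + 1 ≤ lam * (b / 4)
  le_height : 2 * Lam * d + 2 ≤ A * b * Real.exp (-b * (3 / 2) ^ 2)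
  lt_gap : 9 / 8 < A * (Real.exp (-b) - Real.exp (-b * (3 / 2) ^ 2))
  lt_opening : 2 * (11 + 6 * A * b) < S

variable {d : ℕ}

theorem BarrierConstants.one_add_two_mul_slope_le (hc : BarrierConstants d lam Lam A b S)
    (hr : S * r ≤ 2) (hp : ‖p‖ ≤ 2 * S) (hx₁ : ‖x₁ - x₀‖ = r) (hz : ‖z - x₀‖ ≤ 3 / 2 * r)
    (hy : ‖y - x₀‖ ≤ r / 2) :
    1 + 2 * ‖S ^ 2 • (y - z) + barrierGradient S A b r x₀ x₁ p z‖ ≤ 2 * S ^ 2 := by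
  obtain ⟨hA, hb, -, -, -, hS⟩ := hc
  have hAb : 0 < A * b := mul_pos hA hb
  have hS0 : 0 < S := by linarith
  have hSr : S ^ 2 * r ≤ 2 * S := by nlinarith
  have : 0 ≤ r := hx₁ ▸ norm_nonneg _
  have hyz : ‖S ^ 2 • (y - z)‖ ≤ 4 * S := by
    have := norm_sub_le (y - x₀) (z - x₀)
    rw [sub_sub_sub_cancel_right] at this
    rw [norm_smul, Real.norm_of_nonneg (by positivity)]
    nlinarith
  have hzx₁ : ‖S ^ 2 • (z - x₁)‖ ≤ 5 * S := by
    have := norm_sub_le (z - x₀) (x₁ - x₀)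
    rw [sub_sub_sub_cancel_right] at this
    rw [norm_smul, Real.norm_of_nonneg (by positivity)]
    nlinarith
  set g := gaussianBump (b / r ^ 2) x₀ z with hg
  have hg0 : 0 ≤ g := (gaussianBump_pos _ _ _).le
  have hg1 : g ≤ 1 := gaussianBump_le_one (by positivity) _ _
  have hzx₀ : ‖(2 * S ^ 2 * A * b * g) • (z - x₀)‖ ≤ 6 * A * b * S := by
    rw [norm_smul, Real.norm_of_nonneg (by positivity)]
    calc 2 * S ^ 2 * A * b * g * ‖z - x₀‖ ≤ 2 * S ^ 2 * A * b * 1 * (3 / 2 * r) := by gcongr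
      _ = 3 * A * b * (S ^ 2 * r) := by ring
      _ ≤ 3 * A * b * (2 * S) := by gcongr
      _ = 6 * A * b * S := by ring
  have hslope : ‖S ^ 2 • (y - z) + barrierGradient S A b r x₀ x₁ p z‖ ≤ (11 + 6 * A * b) * S := by
    rw [barrierGradient, ← hg]
    linarith [norm_add_le (S ^ 2 • (y - z))
        (p - S ^ 2 • (z - x₁) - (2 * S ^ 2 * A * b * g) • (z - x₀)),
      norm_sub_le (p - S ^ 2 • (z - x₁)) ((2 * S ^ 2 * A * b * g) • (z - x₀)),
      norm_sub_le p (S ^ 2 • (z - x₁))]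
  nlinarith

theorem BarrierConstants.norm_sub_lt_of_mem_contactPairs (hc : BarrierConstants d lam Lam A b S)
    (hr : 0 < r) (htouch : TouchesBelow B u (S ^ 2) x₁ p) (hx₁B : x₁ ∈ B) (hx₁ : ‖x₁ - x₀‖ = r)
    (hq : q ∈ contactPairs B (u - barrier S A b r (u x₁) x₀ x₁ p) (S ^ 2) (closedBall x₀ (r / 2))) :
    ‖q.1 - x₀‖ < 3 / 2 * r := by
  obtain ⟨hA, hb, -, -, hgap, hS⟩ := hc
  obtain ⟨hz, hy, hmin⟩ := hq
  have hAb : 0 < A * b := mul_pos hA hb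
  have hSr : 0 < S ^ 2 * r ^ 2 := by nlinarith [mul_pos (show 0 < S by linarith) hr]
  have hx₁y : ‖x₁ - q.2‖ ≤ 3 / 2 * r := by
    have := norm_sub_le (x₁ - x₀) (q.2 - x₀)
    rw [sub_sub_sub_cancel_right] at this
    linarith [mem_closedBall_iff_norm.1 hy]
  have hsq : S ^ 2 / 2 * ‖x₁ - q.2‖ ^ 2 ≤ S ^ 2 / 2 * (3 / 2 * r) ^ 2 := by gcongr
  have hneg : (u - barrier S A b r (u x₁) x₀ x₁ p) q.1 < 0 := by
    have hx₁val := hmin x₁ hx₁B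
    rw [Pi.sub_apply _ _ x₁, barrier_apply, hx₁, div_self hr.ne', sub_self, inner_zero_right,
      norm_zero, one_pow, mul_one] at hx₁val
    have : 0 ≤ S ^ 2 / 2 * ‖q.1 - q.2‖ ^ 2 := by positivity
    linarith [mul_lt_mul_of_pos_left hgap hSr]
  rw [Pi.sub_apply, barrier_apply] at hneg
  have hbump : 0 < S ^ 2 * r ^ 2 * A
      * (Real.exp (-b * (‖q.1 - x₀‖ / r) ^ 2) - Real.exp (-b * (3 / 2) ^ 2)) := by
    linarith [htouch q.1 hz]
  have hexp := Real.exp_lt_exp.1 (sub_pos.1 (pos_of_mul_pos_right hbump (by positivity)))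
  rw [neg_mul, neg_mul, neg_lt_neg_iff, mul_lt_mul_iff_right₀ hb] at hexp
  rw [← div_lt_iff₀ hr]
  exact lt_of_pow_lt_pow_left₀ 2 (by norm_num) hexp

theorem BarrierConstants.contactTraceBound
    (hc : BarrierConstants (Module.finrank ℝ E) lam Lam A b S) (hlam : 0 < lam)
    (hu : SubjetBound lam Lam 1 (interior B) u) (hr : 0 < r) (hrS : S * r ≤ 2) (hp : ‖p‖ ≤ 2 * S)
    (hx₁ : ‖x₁ - x₀‖ = r) (hball : closedBall x₀ (3 / 2 * r) ⊆ interior B)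
    (hnear : ∀ q ∈ contactPairs B (u - barrier S A b r c x₀ x₁ p) (S ^ 2) (closedBall x₀ (r / 2)),
      q.1 ∈ closedBall x₀ (3 / 2 * r)) :
    ContactTraceBound B (u - barrier S A b r c x₀ x₁ p) (S ^ 2) (closedBall x₀ (r / 2))
      ((2 + Lam * Module.finrank ℝ E * (4 + 2 * A * b)) / lam) := by
  intro q hq P hP hsub
  have hslope := hc.one_add_two_mul_slope_le (p := p) hrS hp hx₁
    (mem_closedBall_iff_norm.1 (hnear q hq)) (mem_closedBall_iff_norm.1 hq.2.1)
  obtain ⟨hA, hb, -, -, -, -⟩ := hc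
  have hsub' := hsub.add
    ((touchesBelow_barrier hA.le hb.le hr.ne' S c x₀ x₁ p q.1).hasSubjet Filter.univ_mem)
  rw [sub_add_cancel, ← sub_eq_add_neg, sub_sub, ← add_smul] at hsub'
  have hbound := hu q.1 (hball (hnear q hq)) _ P hP _ (by positivity) hsub'
  rw [div_mul_eq_mul_div, le_div_iff₀ hlam]
  linarith

variable [FiniteDimensional ℝ E]

/-- In the annulus `r / 2 < |z - x₀| < 3 / 2 * r` the barrier is so convex in the radial direction
that a contact point there would violate the equation. -/
theorem BarrierConstants.mem_closedBall_of_mem_contactPairs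
    (hc : BarrierConstants (Module.finrank ℝ E) lam Lam A b S) (hlam : 0 < lam)
    (hu : SubjetBound lam Lam 1 (interior B) u) (hr : 0 < r) (hrS : S * r ≤ 2)
    (htouch : TouchesBelow B u (S ^ 2) x₁ p) (hp : ‖p‖ ≤ 2 * S) (hx₁B : x₁ ∈ B)
    (hx₁ : ‖x₁ - x₀‖ = r) (hball : closedBall x₀ (3 / 2 * r) ⊆ interior B)
    (hq : q ∈ contactPairs B (u - barrier S A b r (u x₁) x₀ x₁ p) (S ^ 2) (closedBall x₀ (r / 2))) :
    q.1 ∈ closedBall x₀ (r / 2) := by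
  have hlarge := hc.norm_sub_lt_of_mem_contactPairs hr htouch hx₁B hx₁ hq
  have hslope := hc.one_add_two_mul_slope_le (p := p) hrS hp hx₁ hlarge.le
    (mem_closedBall_iff_norm.1 hq.2.1)
  obtain ⟨hA, hb, hdecay, hheight, -, hS⟩ := hc
  by_contra hfar
  rw [mem_closedBall_iff_norm, not_le] at hfar
  have hqB : q.1 ∈ interior B := hball (mem_closedBall_iff_norm.2 hlarge.le)
  have hAb : 0 < A * b := mul_pos hA hb
  have hS2 : 0 < S ^ 2 := pow_pos (by linarith) 2
  set G := A * b * gaussianBump (b / r ^ 2) x₀ q.1 with hG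
  have hG0 : 0 < G := mul_pos hAb (gaussianBump_pos _ _ _)
  have hGle : 2 * Lam * Module.finrank ℝ E + 2 ≤ G := by
    have hquot : ‖q.1 - x₀‖ / r ≤ 3 / 2 := (div_le_iff₀ hr).2 hlarge.le
    refine hheight.trans ?_
    rw [hG, gaussianBump_div_sq, neg_mul, neg_mul]
    gcongr
  have hsub := ((touchesBelow_of_mem_contactPairs hq).hasSubjet
    (mem_interior_iff_mem_nhds.1 hqB)).add 
    (hasSubjet_barrier hA.le hb.le hr.ne' S (u x₁) x₀ x₁ p q.1)
  rw [sub_add_cancel, ← hG, neg_add_eq_sub, sub_sub, ← add_smul] at hsub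
  have hbound := hu q.1 hqB _ _
    ((InnerProductSpace.isPositive_rankOne_self _).smul_of_nonneg (by positivity)) _
    (by positivity) hsub
  rw [ContinuousLinearMap.toLinearMap_smul, map_smul, InnerProductSpace.trace_rankOne,
    real_inner_self_eq_norm_sq, smul_eq_mul] at hbound
  have hradial : b / 4 < b / r ^ 2 * ‖q.1 - x₀‖ ^ 2 := by
    calc b / 4 = b / r ^ 2 * (r / 2) ^ 2 := by field_simp; norm_num
      _ < _ := by gcongr
  have hconvex : S ^ 2 * G * (4 * Lam * Module.finrank ℝ E + 1)
      < lam * (S ^ 2 * G * (b / r ^ 2) * ‖q.1 - x₀‖ ^ 2) := by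
    calc _ < S ^ 2 * G * (lam * (b / r ^ 2 * ‖q.1 - x₀‖ ^ 2)) := by
          gcongr
          exact hdecay.trans_lt (by gcongr)
      _ = _ := by ring
  linarith [mul_le_mul_of_nonneg_left hGle hS2.le]

variable [MeasurableSpace E] [BorelSpace E] (μ : Measure E) [μ.IsAddHaarMeasure]

theorem BarrierConstants.measure_closedBall_le
    (hc : BarrierConstants (Module.finrank ℝ E) lam Lam A b S) (hlam : 0 < lam)
    (huc : Continuous u) (hB : IsCompact B) (hu1 : ∀ y ∈ B, |u y| ≤ 1)
    (hu : SubjetBound lam Lam 1 (interior B) u) (hr : 0 < r) (hrS : S * r ≤ 2)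
    (htouch : x₁ ∈ touchSet B u (S ^ 2)) (hx₁S : closedBall x₁ (2 / S) ⊆ B)
    (hx₁ : ‖x₁ - x₀‖ = r) (hball : closedBall x₀ (3 / 2 * r) ⊆ interior B) :
    μ (closedBall x₀ (r / 2))
      ≤ ENNReal.ofReal (((2 + Lam * Module.finrank ℝ E * (4 + 2 * A * b)) / lam)
          ^ Module.finrank ℝ E)
        * μ (touchSet B u ((2 + 2 * A * b) * S ^ 2) ∩ closedBall x₀ (r / 2)) := by
  obtain ⟨hx₁B, p, htouch⟩ := htouch
  have hA := hc.height_pos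
  have hb := hc.decay_pos
  have hS : 0 < S := by nlinarith [hc.lt_opening, mul_pos hA hb]
  have hp : ‖p‖ ≤ 2 * S := by
    have h := htouch.norm_slope_mul_le hu1 (by positivity) (by positivity) hx₁S
    rw [show S ^ 2 / 2 * (2 / S) ^ 2 = 2 by field_simp, mul_div_assoc', div_le_iff₀ hS] at h
    linarith
  have hhalf : closedBall x₀ (r / 2) ⊆ closedBall x₀ (3 / 2 * r) :=
    closedBall_subset_closedBall (by linarith)
  have hnear : ∀ q ∈ contactPairs B (u - barrier S A b r (u x₁) x₀ x₁ p) (S ^ 2)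
      (closedBall x₀ (r / 2)), q.1 ∈ closedBall x₀ (r / 2) := fun q hq =>
    hc.mem_closedBall_of_mem_contactPairs hlam hu hr hrS htouch hp hx₁B hx₁ hball hq
  refine (measure_vertices_le μ (huc.sub continuous_barrier) hB ⟨x₁, hx₁B⟩
    (isCompact_closedBall _ _) (by positivity) (fun q hq => hball (hhalf (hnear q hq)))
    (hc.contactTraceBound hlam hu hr hrS hp hx₁ hball fun q hq => hhalf (hnear q hq))).trans ?_
  gcongr
  rintro _ ⟨q, hq, rfl⟩
  exact ⟨mem_touchSet_of_mem_contactPairs_sub_barrier hA.le hb.le hr.ne' hq, hnear q hq⟩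

/-- The density estimate: next to a point of `B` at which a paraboloid of opening `S ^ 2 ≥ S₀ ^ 2`
touches, paraboloids of opening `κ * S ^ 2` touch on a set of density at least `C⁻¹`. -/
def TouchDensity (B : Set E) (u : E → ℝ) (κ S₀ C : ℝ) : Prop :=
  ∀ S, S₀ ≤ S → ∀ (r : ℝ) (x₀ x₁ : E), 0 < r → S * r ≤ 2 → x₁ ∈ touchSet B u (S ^ 2) →
    closedBall x₁ (2 / S) ⊆ B → ‖x₁ - x₀‖ = r → closedBall x₀ (3 / 2 * r) ⊆ interior B →
    μ (closedBall x₀ (r / 2))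
      ≤ ENNReal.ofReal C * μ (touchSet B u (κ * S ^ 2) ∩ closedBall x₀ (r / 2))

theorem exists_barrierConstants (hlam : 0 < lam) (hLam : 0 ≤ Lam) (d : ℕ) :
    ∃ A b, 2 ≤ A * b ∧ ∀ S, 2 * (11 + 6 * A * b) < S → BarrierConstants d lam Lam A b S := by
  set b := 4 * (4 * Lam * d + 1) / lam with hb_def
  have hb : 0 < b := by positivity
  set gap := Real.exp (-b) - Real.exp (-b * (3 / 2) ^ 2)
  have hgap : 0 < gap := sub_pos.2 (Real.exp_lt_exp.2 (by linarith))
  set tail := Real.exp (-b * (3 / 2) ^ 2)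
  have htail : 0 < tail := Real.exp_pos _
  set A := (2 * Lam * d + 2) / (b * tail) + 2 / gap
  have hA : 0 < A := by positivity
  have hheight : 2 * Lam * d + 2 ≤ A * b * tail := by
    calc 2 * Lam * d + 2 = (2 * Lam * d + 2) / (b * tail) * b * tail := by field_simp
      _ ≤ A * b * tail := by
        gcongr
        exact le_add_of_nonneg_right (by positivity)
  have hbump : 9 / 8 < A * gap := by
    calc (9 / 8 : ℝ) < 2 / gap * gap := by rw [div_mul_cancel₀ _ hgap.ne']; norm_num
      _ ≤ A * gap := by
        gcongr
        exact le_add_of_nonneg_left (by positivity)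
  have hAb : 2 ≤ A * b := by
    have htail1 : A * b * tail ≤ A * b := mul_le_of_le_one_right (by positivity)
      (Real.exp_le_one_iff.2 (by linarith))
    have : 0 ≤ 2 * Lam * d := by positivity
    linarith
  refine ⟨A, b, hAb, fun S hS => ⟨hA, hb, ?_, hheight, hbump, hS⟩⟩
  rw [hb_def]
  exact le_of_eq (by field_simp)

theorem exists_touchDensity (hlam : 0 < lam) (hLam : 0 ≤ Lam) :
    ∃ κ S₀ C : ℝ, 4 ≤ κ ∧ 13 ≤ S₀ ∧ 0 ≤ C ∧ ∀ (B : Set E) (u : E → ℝ), IsCompact B →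
      Continuous u → (∀ y ∈ B, |u y| ≤ 1) → SubjetBound lam Lam 1 (interior B) u →
        TouchDensity μ B u κ S₀ C := by
  obtain ⟨A, b, hAb, hc⟩ := exists_barrierConstants hlam hLam (Module.finrank ℝ E)
  have : 0 ≤ 4 + 2 * A * b := by linarith
  refine ⟨2 + 2 * A * b, 2 * (11 + 6 * A * b) + 1,
    ((2 + Lam * Module.finrank ℝ E * (4 + 2 * A * b)) / lam) ^ Module.finrank ℝ E,
    by linarith, by linarith, by positivity, ?_⟩
  intro B u hB huc hu1 hu S hS r x₀ x₁ hr hrS htouch hx₁S hx₁ hball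
  exact (hc S (by linarith)).measure_closedBall_le μ hlam huc hB hu1 hu hr hrS htouch hx₁S hx₁ hball

end Barrier

section TouchSets

variable {E : Type*} [NormedAddCommGroup E] [InnerProductSpace ℝ E] {u : E → ℝ} {B K : Set E}
  {a b t S : ℝ} {x₀ : E}

theorem isClosed_setOf_touchesBelow (huc : Continuous u) :
    IsClosed {q : E × E | TouchesBelow B u a q.1 q.2} := by
  simp only [TouchesBelow, Set.ofPred_forall]
  exact isClosed_iInter fun y => isClosed_iInter fun _ => isClosed_le (by fun_prop) (by fun_prop)

theorem exists_mem_touchSet_near (huc : Continuous u) (hB : IsCompact B) (hu1 : ∀ y ∈ B, |u y| ≤ 1)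
    (hx₀ : x₀ ∈ B) : ∃ x₁ ∈ touchSet B u (S ^ 2), S * ‖x₁ - x₀‖ ≤ 2 := by
  obtain ⟨z, hz⟩ := exists_mem_contactPairs (a := S ^ 2) huc hB ⟨x₀, hx₀⟩ (Set.mem_singleton x₀)
  refine ⟨z, ⟨hz.1, _, touchesBelow_of_mem_contactPairs hz⟩, le_of_sq_le_sq ?_ zero_le_two⟩
  have hmin := hz.2.2 x₀ hx₀
  rw [sub_self, norm_zero] at hmin
  nlinarith [(abs_le.1 (hu1 x₀ hx₀)).2, (abs_le.1 (hu1 z hz.1)).1]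

variable [FiniteDimensional ℝ E]

theorem isCompact_touchSet_inter (huc : Continuous u) (hu : ∀ y ∈ B, |u y| ≤ b) (ha : 0 ≤ a)
    (ht : 0 < t) (hK : IsCompact K) (hKB : ∀ x ∈ K, closedBall x t ⊆ B) :
    IsCompact (touchSet B u a ∩ K) := by
  have himage : touchSet B u a ∩ K = Prod.fst '' ((K ×ˢ closedBall 0 ((2 * b + a / 2 * t ^ 2) / t))
      ∩ {q : E × E | TouchesBelow B u a q.1 q.2}) := by
    ext x
    constructor
    · rintro ⟨⟨-, p, hp⟩, hx⟩
      refine ⟨(x, p), ⟨⟨hx, ?_⟩, hp⟩, rfl⟩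
      rw [mem_closedBall_zero_iff, le_div_iff₀ ht]
      exact hp.norm_slope_mul_le hu ha ht.le (hKB x hx)
    · rintro ⟨⟨x, p⟩, ⟨⟨hx, -⟩, hp⟩, rfl⟩
      exact ⟨⟨hKB x hx (mem_closedBall_self ht.le), p, hp⟩, hx⟩
  rw [himage]
  exact ((hK.prod (isCompact_closedBall _ _)).inter_right
    (isClosed_setOf_touchesBelow huc)).image continuous_fst

/-- The distance to the nearest touching point is a radius at which the density estimate applies. -/
theorem TouchDensity.exists_closedBall [MeasurableSpace E] {μ : Measure E} {κ S₀ C : ℝ}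
    (hdens : TouchDensity μ B u κ S₀ C) (huc : Continuous u) (hB : IsCompact B)
    (hu1 : ∀ y ∈ B, |u y| ≤ 1) (hS : 0 < S) (hS₀ : S₀ ≤ S) (hx₀B : closedBall x₀ (4 / S) ⊆ B)
    (hx₀ : x₀ ∉ touchSet B u (S ^ 2)) :
    ∃ ρ, 0 < ρ ∧ ρ ≤ 1 / S ∧ Disjoint (closedBall x₀ ρ) (touchSet B u (S ^ 2)) ∧
      μ (closedBall x₀ ρ)
        ≤ ENNReal.ofReal C * μ (touchSet B u (κ * S ^ 2) ∩ closedBall x₀ ρ) := by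
  set t := 1 / S with ht
  have ht0 : 0 < t := by positivity
  have hdiv : ∀ c, c / S = c * t := fun c => div_eq_mul_one_div c S
  rw [hdiv] at hx₀B
  have hthick : ∀ x ∈ closedBall x₀ (2 * t), closedBall x (2 * t) ⊆ B := fun x hx =>
    (closedBall_subset_closedBall' (by linarith [mem_closedBall.1 hx])).trans hx₀B
  obtain ⟨y, hy, hyx₀⟩ := exists_mem_touchSet_near (S := S) huc hB hu1
    (hx₀B (mem_closedBall_self (by positivity)))
  rw [← le_div_iff₀' hS, hdiv, ← mem_closedBall_iff_norm] at hyx₀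
  obtain ⟨x₁, hx₁, hmin⟩ := (isCompact_touchSet_inter huc hu1 (sq_nonneg S) (by positivity)
    (isCompact_closedBall x₀ (2 * t)) hthick).exists_isMinOn ⟨y, hy, hyx₀⟩
    (f := fun z => ‖z - x₀‖) (by fun_prop)
  have hr : 0 < ‖x₁ - x₀‖ := by
    rw [norm_pos_iff, sub_ne_zero]
    exact fun h => hx₀ (h ▸ hx₁.1)
  have hrt : ‖x₁ - x₀‖ ≤ 2 * t := mem_closedBall_iff_norm.1 hx₁.2
  refine ⟨‖x₁ - x₀‖ / 2, by positivity, by linarith, ?_, ?_⟩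
  · refine Set.disjoint_left.2 fun z hz htouch => ?_
    rw [mem_closedBall_iff_norm] at hz
    have : ‖x₁ - x₀‖ ≤ ‖z - x₀‖ := hmin ⟨htouch, mem_closedBall_iff_norm.2 (by linarith)⟩
    linarith
  · refine hdens S hS₀ _ x₀ x₁ hr (by rwa [← le_div_iff₀' hS, hdiv]) hx₁.1 ?_ rfl ?_
    · rw [hdiv]
      exact hthick x₁ hx₁.2
    · exact (closedBall_subset_ball (by linarith)).trans
        (interior_maximal (ball_subset_closedBall.trans hx₀B) isOpen_ball)

end TouchSets

section Covering

variable {E : Type*} [NormedAddCommGroup E] [NormedSpace ℝ E] [FiniteDimensional ℝ E]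
  [MeasurableSpace E] [BorelSpace E] (μ : Measure E) [μ.IsAddHaarMeasure] {C D R ρ : ℝ}

theorem measure_le_mul_measure_inter_of_closedBall {F G T : Set E} (hT : MeasurableSet T)
    (hF : ∀ x ∈ F, ∃ r, 0 < r ∧ r ≤ R ∧ closedBall x r ⊆ G ∧
      μ (closedBall x r) ≤ ENNReal.ofReal C * μ (T ∩ closedBall x r)) :
    μ F ≤ ENNReal.ofReal (5 ^ Module.finrank ℝ E * C) * μ (G ∩ T) := by
  choose! r hr0 hrR hrG hrμ using hF
  obtain ⟨I, hI, hdisj, hcov⟩ := Vitali.exists_disjoint_subfamily_covering_enlargement_closedBall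
    F (fun x => x) r R hrR 5 (by norm_num)
  have hIc : I.Countable := hdisj.countable_of_nonempty_interior fun x hx =>
    ⟨x, ball_subset_interior_closedBall (mem_ball_self (hr0 x (hI hx)))⟩
  have henlarge : ∀ x ∈ I, μ (closedBall x (5 * r x))
      ≤ ENNReal.ofReal (5 ^ Module.finrank ℝ E * C) * μ (T ∩ closedBall x (r x)) := by
    intro x hx
    rw [Measure.addHaar_closedBall_mul _ _ (by norm_num) (hr0 x (hI hx)).le,
      ← Measure.addHaar_closedBall_center μ x, ENNReal.ofReal_mul (by positivity), mul_assoc]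
    gcongr
    exact hrμ x (hI hx)
  calc μ F ≤ μ (⋃ x ∈ I, closedBall x (5 * r x)) := by
        refine measure_mono fun x hx => ?_
        obtain ⟨y, hy, hxy⟩ := hcov x hx
        exact Set.mem_biUnion hy (hxy (mem_closedBall_self (hr0 x hx).le))
    _ ≤ ∑' x : I, μ (closedBall (x : E) (5 * r x)) := measure_biUnion_le _ hIc _
    _ ≤ ∑' x : I, ENNReal.ofReal (5 ^ Module.finrank ℝ E * C) * μ (T ∩ closedBall (x : E) (r x)) :=
        ENNReal.tsum_le_tsum fun x => henlarge x x.2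
    _ = ENNReal.ofReal (5 ^ Module.finrank ℝ E * C) * μ (⋃ x ∈ I, T ∩ closedBall x (r x)) := by
        rw [ENNReal.tsum_mul_left, measure_biUnion hIc
          (hdisj.mono fun x => Set.inter_subset_right) fun x _ => hT.inter measurableSet_closedBall]
    _ ≤ _ := by
        gcongr
        exact Set.iUnion₂_subset fun x hx y hy => ⟨hrG x (hI hx) hy.2, hy.1⟩

theorem le_ofReal_div_one_add_mul (hD : 0 ≤ D) {m m' m'' : ℝ≥0∞}
    (hm : m ≤ ENNReal.ofReal D * m') (hadd : m' + m ≤ m'') :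
    m ≤ ENNReal.ofReal (D / (1 + D)) * m'' := by
  have hmul : ENNReal.ofReal (1 + D) * m ≤ ENNReal.ofReal D * m'' := by
    calc ENNReal.ofReal (1 + D) * m = m + ENNReal.ofReal D * m := by
          rw [ENNReal.ofReal_add zero_le_one hD, ENNReal.ofReal_one, add_mul, one_mul]
      _ ≤ ENNReal.ofReal D * m' + ENNReal.ofReal D * m := by gcongr
      _ ≤ ENNReal.ofReal D * m'' := by rw [← mul_add]; gcongr
  rw [ENNReal.ofReal_div_of_pos (by positivity), ENNReal.mul_div_right_comm.symm]
  exact (ENNReal.le_div_iff_mul_le (.inl (by simp; linarith)) (.inl ENNReal.ofReal_ne_top)).2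
    (by rwa [mul_comm])

theorem measure_ball_sdiff_ball_le (hρ : 0 < ρ) (hρ1 : ρ ≤ 1) :
    μ (ball 0 1 \ ball 0 ρ)
      ≤ ENNReal.ofReal (Module.finrank ℝ E * (1 - ρ)) * μ (ball 0 1) := by
  have : 0 ≤ Module.finrank ℝ E * (1 - ρ) := mul_nonneg (Nat.cast_nonneg _) (by linarith)
  have hbernoulli := one_add_mul_le_pow (a := ρ - 1) (by linarith) (Module.finrank ℝ E)
  rw [add_sub_cancel] at hbernoulli
  rw [measure_sdiff (ball_subset_ball hρ1) measurableSet_ball.nullMeasurableSet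
    measure_ball_lt_top.ne, tsub_le_iff_right, Measure.addHaar_ball_of_pos _ _ hρ, ← add_mul,
    ← ENNReal.ofReal_add this (by positivity)]
  exact le_mul_of_one_le_left zero_le (ENNReal.one_le_ofReal.2 (by linarith))

end Covering

section Decay

variable {E : Type*} [NormedAddCommGroup E] [InnerProductSpace ℝ E] [FiniteDimensional ℝ E]
  [MeasurableSpace E] [BorelSpace E] (μ : Measure E) [μ.IsAddHaarMeasure] {u : E → ℝ}
  {S S₀ C κ s ρ ρ' lam Lam : ℝ}

theorem TouchDensity.measure_ball_sdiff_touchSet_le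
    (hdens : TouchDensity μ (closedBall 0 1) u κ S₀ C) (huc : Continuous u)
    (hu1 : ∀ y ∈ closedBall 0 1, |u y| ≤ 1) (hκ : 1 ≤ κ) (hC : 0 ≤ C) (hS : 0 < S) (hS₀ : S₀ ≤ S)
    (hρ' : ρ' < 1) (hρρ' : ρ + 1 / S ≤ ρ') (hρ : ρ + 4 / S ≤ 1) :
    μ (ball 0 ρ \ touchSet (closedBall 0 1) u (κ * S ^ 2))
      ≤ ENNReal.ofReal (5 ^ Module.finrank ℝ E * C / (1 + 5 ^ Module.finrank ℝ E * C))
        * μ (ball 0 ρ' \ touchSet (closedBall 0 1) u (S ^ 2)) := by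
  set T := touchSet (closedBall 0 1) u (κ * S ^ 2) ∩ closedBall 0 ρ'
  have hTm : MeasurableSet T :=
    (isCompact_touchSet_inter huc hu1 (by positivity) (sub_pos.2 hρ') (isCompact_closedBall 0 ρ')
      fun x hx => closedBall_subset_closedBall' (by linarith [mem_closedBall.1 hx])).measurableSet
  have hmono : touchSet (closedBall 0 1) u (S ^ 2) ⊆ touchSet (closedBall 0 1) u (κ * S ^ 2) :=
    touchSet_mono (le_mul_of_one_le_left (sq_nonneg S) hκ)
  have hρle : ρ ≤ ρ' := by linarith [show 0 < 1 / S by positivity]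
  refine le_ofReal_div_one_add_mul (by positivity) (measure_le_mul_measure_inter_of_closedBall μ
    (G := ball 0 ρ' \ touchSet (closedBall 0 1) u (S ^ 2)) (R := 1 / S) hTm fun x hx => ?_) ?_
  · obtain ⟨r, hr, hrS, hdisj, hrμ⟩ := hdens.exists_closedBall huc (isCompact_closedBall 0 1) hu1
      hS hS₀ (closedBall_subset_closedBall' (by linarith [mem_ball.1 hx.1])) fun h => hx.2 (hmono h)
    have hball : closedBall x r ⊆ ball 0 ρ' :=
      closedBall_subset_ball' (by linarith [mem_ball.1 hx.1])
    refine ⟨r, hr, hrS, fun y hy => ⟨hball hy, Set.disjoint_left.1 hdisj hy⟩, hrμ.trans ?_⟩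
    have hsub : touchSet (closedBall 0 1) u (κ * S ^ 2) ∩ closedBall x r ⊆ T ∩ closedBall x r :=
      fun y hy => ⟨⟨hy.1, ball_subset_closedBall (hball hy.2)⟩, hy.2⟩
    exact mul_le_mul_right (measure_mono hsub) _
  · rw [← measure_inter_add_sdiff (ball 0 ρ' \ _) hTm, Set.inter_comm]
    exact add_le_add le_rfl (measure_mono fun y hy =>
      ⟨⟨ball_subset_ball hρle hy.1, fun h => hy.2 (hmono h)⟩, fun h => hy.2 h.1⟩)

theorem TouchDensity.measure_ball_sdiff_touchSet_pow_le
    (hdens : TouchDensity μ (closedBall 0 1) u (s ^ 2) S₀ C) (huc : Continuous u)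
    (hu1 : ∀ y ∈ closedBall 0 1, |u y| ≤ 1) (hs : 2 ≤ s) (hC : 0 ≤ C) (j : ℕ) (hS : 0 < S)
    (hS₀ : S₀ ≤ S) (hρρ' : ρ + 2 / S ≤ ρ') (hρ' : ρ' + 3 / S ≤ 1) :
    μ (ball 0 ρ \ touchSet (closedBall 0 1) u ((s ^ j * S) ^ 2))
      ≤ ENNReal.ofReal (5 ^ Module.finrank ℝ E * C / (1 + 5 ^ Module.finrank ℝ E * C)) ^ j
        * μ (ball 0 ρ' \ touchSet (closedBall 0 1) u (S ^ 2)) := by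
  induction j generalizing S ρ' with
  | zero =>
    rw [pow_zero, pow_zero, one_mul, one_mul]
    have : 0 < 2 / S := by positivity
    gcongr
    linarith
  | succ j ih =>
    have hinv : ∀ c, c / S = c * (1 / S) := fun c => div_eq_mul_one_div c S
    have hinv' : ∀ c, 0 ≤ c → c / (s * S) ≤ c / 2 * (1 / S) := by
      intro c hc
      rw [← div_div, ← hinv]
      gcongr
    have : 0 < 1 / S := by positivity
    rw [hinv] at hρρ' hρ'
    have hstep := hdens.measure_ball_sdiff_touchSet_le μ (ρ := ρ' - 1 / S) (ρ' := ρ') huc hu1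
      (by nlinarith) hC hS hS₀ (by linarith) (by linarith) (by rw [hinv 4]; linarith)
    rw [← mul_pow] at hstep
    rw [pow_succ s j, pow_succ _ j, mul_assoc, mul_assoc]
    refine (ih (S := s * S) (by positivity) (by nlinarith) ?_ ?_).trans
      (mul_le_mul_right hstep _)
    · linarith [hinv' 2 zero_le_two]
    · linarith [hinv' 3 zero_le_three]

theorem TouchDensity.measure_unitBall_sdiff_touchSet_le
    (hdens : TouchDensity μ (closedBall 0 1) u (s ^ 2) S₀ C) (huc : Continuous u)
    (hu1 : ∀ y ∈ closedBall 0 1, |u y| ≤ 1) (hs : 2 ≤ s) (hC : 0 ≤ C) (hS₀ : 13 ≤ S₀) (k : ℕ) :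
    μ (ball 0 1 \ touchSet (closedBall 0 1) u (S₀ ^ 2 * ((s ^ 2) ^ 2) ^ k))
      ≤ ENNReal.ofReal ((1 + Module.finrank ℝ E) * μ.real (ball 0 1)
        * max (5 ^ Module.finrank ℝ E * C / (1 + 5 ^ Module.finrank ℝ E * C)) (1 / 2) ^ k) := by
  set d := Module.finrank ℝ E
  set q₀ := 5 ^ d * C / (1 + 5 ^ d * C)
  have hq₀0 : 0 ≤ q₀ := by positivity
  set q := max q₀ (1 / 2)
  set S := s ^ k * S₀ with hS
  have hS13 : 2 ^ k * 13 ≤ S := by rw [hS]; gcongr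
  have hS0 : 0 < S := lt_of_lt_of_le (by positivity) hS13
  have hshell : 5 / S ≤ (1 / 2) ^ k := by
    rw [one_div, inv_pow, div_le_iff₀ hS0, ← div_eq_inv_mul, le_div_iff₀ (by positivity)]
    linarith
  have hshell1 : 5 / S < 1 := by
    rw [div_lt_one hS0]
    linarith [one_le_pow₀ (one_le_two (α := ℝ)) (n := k)]
  have hinner := hdens.measure_ball_sdiff_touchSet_pow_le μ (ρ := 1 - 5 / S)
    (ρ' := 1 - 3 / S) huc hu1 hs hC k hS0
    (le_mul_of_one_le_left (by linarith) (one_le_pow₀ (by linarith)))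
    (le_of_eq (by ring)) (le_of_eq (by ring))
  have houter := measure_ball_sdiff_ball_le μ (ρ := 1 - 5 / S) (by linarith)
    (sub_le_self _ (by positivity))
  rw [sub_sub_cancel] at houter
  rw [show S₀ ^ 2 * ((s ^ 2) ^ 2) ^ k = (s ^ k * S) ^ 2 by rw [hS]; ring]
  calc μ (ball 0 1 \ touchSet (closedBall 0 1) u ((s ^ k * S) ^ 2))
      ≤ μ (ball 0 (1 - 5 / S) \ touchSet (closedBall 0 1) u ((s ^ k * S) ^ 2))
        + μ (ball 0 1 \ ball 0 (1 - 5 / S)) := by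
        refine (measure_mono fun x hx => ?_).trans (measure_union_le _ _)
        by_cases h : x ∈ ball 0 (1 - 5 / S)
        exacts [.inl ⟨h, hx.2⟩, .inr ⟨hx.1, h⟩]
    _ ≤ ENNReal.ofReal q₀ ^ k * μ (ball 0 1) + ENNReal.ofReal (d * (5 / S)) * μ (ball 0 1) := by
        refine add_le_add (hinner.trans ?_) houter
        gcongr
        exact Set.sdiff_subset.trans (ball_subset_ball (sub_le_self _ (by positivity)))
    _ ≤ ENNReal.ofReal (q ^ k) * μ (ball 0 1) + ENNReal.ofReal (d * q ^ k) * μ (ball 0 1) := by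
        rw [← ENNReal.ofReal_pow hq₀0]
        gcongr
        · exact le_max_left _ _
        · exact hshell.trans (by gcongr; exact le_max_right _ _)
    _ = ENNReal.ofReal ((1 + d) * μ.real (ball 0 1) * q ^ k) := by
        rw [← add_mul, ← ENNReal.ofReal_add (by positivity) (by positivity),
          ← ofReal_measureReal measure_ball_lt_top.ne, ← ENNReal.ofReal_mul (by positivity)]
        congr 1
        ring

theorem exists_measure_touchSet_decay (hlam : 0 < lam) (hLam : 0 ≤ Lam) :
    ∃ T κ C q : ℝ, 0 < T ∧ 1 < κ ∧ 0 ≤ C ∧ 0 < q ∧ q < 1 ∧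
      ∀ u : E → ℝ, Continuous u → (∀ y ∈ closedBall 0 1, |u y| ≤ 1) →
        SubjetBound lam Lam 1 (ball 0 1) u →
        ∀ k : ℕ, μ (ball 0 1 \ touchSet (closedBall 0 1) u (T * κ ^ k))
          ≤ ENNReal.ofReal (C * q ^ k) := by
  obtain ⟨κ, S₀, C, hκ, hS₀, hC, hdens⟩ := exists_touchDensity μ hlam hLam
  obtain ⟨s, hs, rfl⟩ : ∃ s : ℝ, 2 ≤ s ∧ κ = s ^ 2 :=
    ⟨√κ, Real.le_sqrt_of_sq_le (by linarith), (Real.sq_sqrt (by linarith)).symm⟩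
  set d := Module.finrank ℝ E
  have hq₀ : 5 ^ d * C / (1 + 5 ^ d * C) < 1 := (div_lt_one (by positivity)).2 (lt_one_add _)
  refine ⟨S₀ ^ 2, (s ^ 2) ^ 2, (1 + d) * μ.real (ball 0 1),
    max (5 ^ d * C / (1 + 5 ^ d * C)) (1 / 2), by positivity, by nlinarith, by positivity,
    lt_max_of_lt_right one_half_pos, max_lt hq₀ one_half_lt_one, fun u huc hu1 hu k => ?_⟩
  exact (hdens _ u (isCompact_closedBall 0 1) huc hu1
    (by rwa [interior_closedBall _ one_ne_zero])).measure_unitBall_sdiff_touchSet_le μ huc hu1 hs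
    hC hS₀ k

end Decay

section TwoSidedTouching

variable {E : Type*} [NormedAddCommGroup E] [InnerProductSpace ℝ E] {u : E → ℝ} {A B : Set E}
  {a K : ℝ} {x y p q : E} {L : E →L[ℝ] E}

/-- The points of `B` at which `u` is touched in `B` from below by a concave and from above by a
convex paraboloid of opening `a`. -/
def twoSidedTouchSet (B : Set E) (u : E → ℝ) (a : ℝ) : Set E :=
  touchSet B u a ∩ touchSet B (-u) a

/-- The paraboloids of opening `a` with the common slope `p` at `x` touch `u` in `B` from below
and from above. -/
def TouchesBothSides (B : Set E) (u : E → ℝ) (a : ℝ) (x p : E) : Prop :=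
  ∀ y ∈ B, |u y - u x - inner ℝ p (y - x)| ≤ a / 2 * ‖y - x‖ ^ 2

theorem TouchesBothSides.touchesBelow (h : TouchesBothSides B u a x p) :
    TouchesBelow B u a x p :=
  fun y hy => by linarith [(abs_le.1 (h y hy)).1]

theorem TouchesBothSides.neg (h : TouchesBothSides B u a x p) :
    TouchesBothSides B (-u) a x (-p) := by
  intro y hy
  rw [← abs_neg, Pi.neg_apply, Pi.neg_apply, inner_neg_left]
  exact (h y hy).trans_eq' (by congr 1; ring)

theorem eq_zero_of_eventually_inner_le {C : ℝ}
    (h : ∀ᶠ y in 𝓝 x, inner ℝ p (y - x) ≤ C * ‖y - x‖ ^ 2) : p = 0 := by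
  have hlim : Filter.Tendsto (fun t : ℝ => C * t * ‖p‖ ^ 2) (𝓝[>] 0) (𝓝 0) :=
    (Continuous.tendsto' (by fun_prop) _ _ (by simp)).mono_left nhdsWithin_le_nhds
  have hp : ‖p‖ ^ 2 ≤ 0 := by
    refine ge_of_tendsto hlim ?_
    filter_upwards [(tendsto_ray x p).eventually h, self_mem_nhdsWithin] with t ht ht0
    rw [add_sub_cancel_left, real_inner_smul_right, real_inner_self_eq_norm_sq, norm_smul,
      mul_pow, Real.norm_eq_abs, sq_abs] at ht
    exact le_of_mul_le_mul_left (ht.trans_eq (by ring)) ht0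
  simpa using hp

theorem exists_touchesBothSides_of_mem (hx : x ∈ twoSidedTouchSet B u a) (hB : B ∈ 𝓝 x) :
    ∃ p, TouchesBothSides B u a x p := by
  obtain ⟨⟨-, p, hp⟩, -, q, hq⟩ := hx
  have hpq : p + q = 0 := by
    refine eq_zero_of_eventually_inner_le (x := x) (C := a) ?_
    filter_upwards [hB] with y hy
    have hbelow := hp y hy
    have habove := hq y hy
    rw [Pi.neg_apply, Pi.neg_apply] at habove
    rw [inner_add_left]
    linarith
  obtain rfl := eq_neg_of_add_eq_zero_right hpq
  refine ⟨p, fun y hy => abs_le.2 ⟨?_, ?_⟩⟩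
  · linarith [hp y hy]
  · have habove := hq y hy
    rw [Pi.neg_apply, Pi.neg_apply, inner_neg_left] at habove
    linarith

/-- The slope is read off between the antipodal points `c + e` and `c - e`, since `x` may be
arbitrarily close to the boundary of `B`. -/
theorem TouchesBothSides.norm_slope_mul_le {c : E} {r R : ℝ} (h : TouchesBothSides B u a x p)
    (hu : ∀ y ∈ B, |u y| ≤ K) (ha : 0 ≤ a) (hr : 0 ≤ r) (hcB : closedBall c r ⊆ B)
    (hBx : B ⊆ closedBall x R) : ‖p‖ * r ≤ K + a / 2 * R ^ 2 := by
  refine norm_mul_le_of_forall_inner_le hr fun e he => ?_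
  have herr {y : E} (hy : y ∈ B) :
      |u y - u x - inner ℝ p (y - x)| ≤ a / 2 * R ^ 2 := by
    have := mem_closedBall_iff_norm.1 (hBx hy)
    exact (h y hy).trans (by gcongr)
  have hplus : c + e ∈ B := hcB (by rwa [mem_closedBall, dist_self_add_left])
  have hminus : c - e ∈ B := hcB (by rwa [mem_closedBall, dist_self_sub_left])
  have hinner : inner ℝ p (c + e - x) - inner ℝ p (c - e - x) = 2 * inner ℝ p e := by
    rw [← inner_sub_right, ← real_inner_smul_right, two_smul]
    congr 1
    abel
  linarith [(abs_le.1 (herr hplus)).1, (abs_le.1 (herr hminus)).2, (abs_le.1 (hu _ hplus)).2,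
    (abs_le.1 (hu _ hminus)).1]

theorem TouchesBothSides.norm_sub_slope_mul_le {s : ℝ} (hx : TouchesBothSides B u a x p)
    (hy : TouchesBothSides B u a y q) (ha : 0 ≤ a) (hxy : ‖x - y‖ ≤ s) (hB : closedBall y s ⊆ B) :
    ‖p - q‖ * s ≤ 3 * a * s ^ 2 := by
  have hs : 0 ≤ s := (norm_nonneg _).trans hxy
  refine norm_mul_le_of_forall_inner_le hs fun e he => ?_
  have hyB : y ∈ B := hB (mem_closedBall_self hs)
  have heB : y + e ∈ B := hB (by rwa [mem_closedBall, dist_self_add_left])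
  have hyx : ‖y - x‖ ≤ s := by rwa [norm_sub_rev]
  have hex : ‖y + e - x‖ ≤ 2 * s := by
    rw [add_sub_right_comm]
    linarith [norm_add_le (y - x) e]
  have herr₁ := (hx _ heB).trans (by gcongr : _ ≤ a / 2 * (2 * s) ^ 2)
  have herr₂ := (hx y hyB).trans (by gcongr : _ ≤ a / 2 * s ^ 2)
  have herr₃ := hy _ heB
  rw [add_sub_cancel_left] at herr₃
  replace herr₃ := herr₃.trans (by gcongr : _ ≤ a / 2 * s ^ 2)
  rw [add_sub_right_comm, inner_add_right] at herr₁
  rw [inner_sub_left]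
  linarith [(abs_le.1 herr₁).1, (abs_le.1 herr₂).2, (abs_le.1 herr₃).2]

theorem TouchesBothSides.eq_of_hasQuadExpansion (h : TouchesBothSides B u a x p) (hB : B ∈ 𝓝 x)
    (hL : HasQuadExpansion u x q L) : q = p := by
  rw [← sub_eq_zero]
  refine eq_zero_of_eventually_inner_le (x := x) (C := 1 / 2 * ‖L‖ + 1 + a / 2) ?_
  filter_upwards [hL.def one_pos, hB] with y hexp hy
  have hquad : |inner ℝ (L (y - x)) (y - x)| ≤ ‖L‖ * ‖y - x‖ ^ 2 := by
    refine (abs_real_inner_le_norm _ _).trans ?_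
    rw [sq, ← mul_assoc]
    gcongr
    exact L.le_opNorm _
  rw [quadPoly, Real.norm_eq_abs, norm_pow, norm_norm] at hexp
  rw [inner_sub_left]
  linarith [(abs_le.1 hexp).1, (abs_le.1 (h y hy)).2, (abs_le.1 hquad).1]

theorem HasQuadExpansion.neg (h : HasQuadExpansion u x p L) :
    HasQuadExpansion (-u) x (-p) (-L) := by
  refine h.neg_left.congr_left fun y => ?_
  simp only [quadPoly, Pi.neg_apply, neg_apply, inner_neg_left]
  ring

theorem TouchesBothSides.norm_le_of_hasQuadExpansion (h : TouchesBothSides B u a x p)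
    (ha : 0 ≤ a) (hB : B ∈ 𝓝 x) (hL : HasQuadExpansion u x p L) (hsymm : L.IsSymmetric) :
    ‖L‖ ≤ a := by
  have hlow {v : E → ℝ} {q : E} {N : E →L[ℝ] E} (hv : TouchesBothSides B v a x q)
      (hN : HasQuadExpansion v x q N) (k : E) : -a * ‖k‖ ^ 2 ≤ inner ℝ (N k) k := by
    have hc : ∀ᶠ y in 𝓝 x, -(a / 2) * ‖y - x‖ ^ 2 ≤ v y - v x - inner ℝ q (y - x) := by
      filter_upwards [hB] with y hy
      linarith [(abs_le.1 (hv y hy)).1]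
    linarith [hN.mul_sq_norm_le hc k]
  rw [L.norm_eq_iSup_rayleighQuotient hsymm]
  refine ciSup_le fun k => ?_
  rw [ContinuousLinearMap.rayleighQuotient, abs_div, abs_sq]
  refine div_le_of_le_mul₀ (sq_nonneg _) ha (abs_le.2 ⟨?_, ?_⟩)
  · exact (neg_mul a _).ge.trans (hlow h hL k)
  · have habove := hlow h.neg hL.neg k
    rw [neg_apply, inner_neg_left] at habove
    exact le_of_neg_le_neg ((neg_mul a _).ge.trans habove)

end TwoSidedTouching

section PointwiseDerivatives

variable {E : Type*} [NormedAddCommGroup E] [InnerProductSpace ℝ E] [FiniteDimensional ℝ E]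
  {u : E → ℝ} {A Ω : Set E} {a K t : ℝ}

/-- Near pairs are compared on the sphere through both points, far pairs through the bound for the
slopes themselves. -/
theorem exists_lipschitzWith_slope (hu : ∀ y ∈ Ω, |u y| ≤ K) (ha : 0 ≤ a) (ht : 0 < t)
    (hA : ∀ x ∈ A, closedBall x t ⊆ Ω) (htouch : ∀ x ∈ A, ∃ p, TouchesBothSides Ω u a x p) :
    ∃ c P, LipschitzWith c P ∧ HasUniformExpansionOn u P (a / 2) A Ω := by
  choose! P hP using htouch
  set b := (2 * K + a / 2 * t ^ 2) / t
  have hPb : ∀ x ∈ A, ‖P x‖ ≤ b := fun x hx =>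
    (le_div_iff₀ ht).2 ((hP x hx).touchesBelow.norm_slope_mul_le hu ha ht.le (hA x hx))
  have hLip : LipschitzOnWith (max (3 * a) (2 * b / t)).toNNReal P A := by
    refine LipschitzOnWith.of_dist_le_mul fun x hx y hy => ?_
    rw [Real.coe_toNNReal _ (by positivity)]
    rcases (dist_nonneg (x := x) (y := y)).eq_or_lt with hxy | hxy
    · rw [dist_eq_zero.1 hxy.symm, dist_self, dist_self, mul_zero]
    rcases le_total (dist x y) t with hnear | hfar
    · have hslope := (hP x hx).norm_sub_slope_mul_le (hP y hy) ha (dist_eq_norm x y).ge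
        ((closedBall_subset_closedBall hnear).trans (hA y hy))
      rw [sq, ← mul_assoc, ← dist_eq_norm] at hslope
      exact (le_of_mul_le_mul_right hslope hxy).trans (by gcongr; exact le_max_left _ _)
    · have : 0 ≤ b := (norm_nonneg _).trans (hPb x hx)
      calc dist (P x) (P y) ≤ b + b := (dist_le_norm_add_norm _ _).trans
            (add_le_add (hPb x hx) (hPb y hy))
        _ = 2 * b / t * t := by field_simp; norm_num
        _ ≤ max (3 * a) (2 * b / t) * dist x y := by gcongr; exact le_max_right _ _
  obtain ⟨Q, hQ, hPQ⟩ := hLip.extend_finite_dimension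
  exact ⟨_, Q, hQ, fun x hx => hPQ hx ▸ hP x hx⟩

theorem exists_isCompact_exhaustion_twoSidedTouchSet (hΩ : IsOpen Ω) (huc : Continuous u)
    (hu : ∀ y ∈ Ω, |u y| ≤ K) :
    ∃ S : ℕ → Set E, (∀ k, IsCompact (S k) ∧ S k ⊆ twoSidedTouchSet Ω u k ∧
      ∃ t > 0, ∀ x ∈ S k, closedBall x t ⊆ Ω) ∧ ∀ x M, x ∈ twoSidedTouchSet Ω u M →
      x ∈ ⋃ k, S k := by
  obtain ⟨F, hFc, hFΩ, hFU, hFmono⟩ := hΩ.exists_iUnion_isClosed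
  have hcompact (k : ℕ) : IsCompact (F k ∩ closedBall 0 k) :=
    (isCompact_closedBall _ _).inter_left (hFc k)
  have hthick (k : ℕ) : ∃ t > 0, ∀ x ∈ F k ∩ closedBall 0 k, closedBall x t ⊆ Ω := by
    obtain ⟨t, ht, hsub⟩ := (hcompact k).exists_cthickening_subset_open hΩ
      (Set.inter_subset_left.trans (hFΩ k))
    exact ⟨t, ht, fun x hx => (closedBall_subset_cthickening hx t).trans hsub⟩
  refine ⟨fun k => twoSidedTouchSet Ω u k ∩ (F k ∩ closedBall 0 k), fun k => ?_, fun x M hx => ?_⟩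
  · obtain ⟨t, ht, hball⟩ := hthick k
    refine ⟨?_, Set.inter_subset_left, t, ht, fun x hx => hball x hx.2⟩
    simp only [twoSidedTouchSet]
    rw [Set.inter_inter_distrib_right]
    exact (isCompact_touchSet_inter huc hu k.cast_nonneg ht (hcompact k) hball).inter
      (isCompact_touchSet_inter huc.neg (by simpa using hu) k.cast_nonneg ht (hcompact k) hball)
  · obtain ⟨i, hi⟩ := Set.mem_iUnion.1 (hFU.superset hx.1.1)
    obtain ⟨j, hj⟩ := exists_nat_ge (max M ‖x‖)
    have hjk : (j : ℝ) ≤ (max i j : ℕ) := by exact_mod_cast le_max_right i j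
    refine Set.mem_iUnion.2 ⟨max i j, ⟨?_, ?_⟩, hFmono (le_max_left i j) hi, ?_⟩
    · exact touchSet_mono ((le_max_left _ _).trans (hj.trans hjk)) hx.1
    · exact touchSet_mono ((le_max_left _ _).trans (hj.trans hjk)) hx.2
    · exact mem_closedBall_zero_iff.2 ((le_max_right _ _).trans (hj.trans hjk))

variable [MeasurableSpace E] [BorelSpace E] (μ : Measure E) [μ.IsAddHaarMeasure]

theorem ae_hasQuadExpansion_of_lipschitzWith {P : E → E} {M : ℝ} {c : ℝ≥0}
    (hP : LipschitzWith c P) (hA : MeasurableSet A) (hΩ : IsOpen Ω) (hAΩ : A ⊆ Ω) (hM : 0 ≤ M)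
    (hu : HasUniformExpansionOn u P M A Ω) :
    ∀ᵐ x ∂μ.restrict A, HasQuadExpansion u x (P x) (fderiv ℝ P x) ∧
      (fderiv ℝ P x).IsSymmetric := by
  filter_upwards [ae_restrict_of_ae hP.ae_differentiableAt, ae_isThickAt μ A,
    ae_restrict_mem hA] with x hdiff hthick hx
  have hderiv := hdiff.hasFDerivAt.hasFDerivWithinAt (s := A)
  have hxΩ := hΩ.mem_nhds (hAΩ hx)
  exact ⟨hu.hasQuadExpansion hM hxΩ hderiv hthick, hu.isSymmetric hM hxΩ hderiv hthick⟩

/-- A function touched from both sides almost everywhere is twice differentiable almost everywhere: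
on each set of an exhaustion the slopes are Lipschitz, and Rademacher's theorem applies to them. -/
theorem exists_measurable_hasQuadExpansion (hΩ : IsOpen Ω) (huc : Continuous u)
    (hu : ∀ y ∈ Ω, |u y| ≤ K) (hae : ∀ᵐ x ∂μ.restrict Ω, ∃ M, x ∈ twoSidedTouchSet Ω u M) :
    ∃ P : E → E, ∃ L : E → E →L[ℝ] E, Measurable P ∧ Measurable L ∧
      ∀ᵐ x ∂μ.restrict Ω, HasQuadExpansion u x (P x) (L x) ∧ (L x).IsSymmetric := by
  obtain ⟨S, hS, hSx⟩ := exists_isCompact_exhaustion_twoSidedTouchSet hΩ huc hu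
  have hSΩ (k : ℕ) : S k ⊆ Ω := fun x hx => ((hS k).2.1 hx).1.1
  have hslope (k : ℕ) : ∃ c P, LipschitzWith c P ∧ HasUniformExpansionOn u P (k / 2) (S k) Ω := by
    obtain ⟨-, htouch, t, ht, hball⟩ := hS k
    exact exists_lipschitzWith_slope hu k.cast_nonneg ht hball fun x hx =>
      exists_touchesBothSides_of_mem (htouch hx) (hΩ.mem_nhds (hSΩ k hx))
  choose c P hPlip hP using hslope
  have hmeas (k : ℕ) : MeasurableSet (S k) := (hS k).1.measurableSet
  obtain ⟨g, hg, hgP⟩ := exists_measurable_piecewise (disjointed S)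
    (fun k => MeasurableSet.disjointed hmeas k) (fun k x => (P k x, fderiv ℝ (P k) x))
    (fun k => (hPlip k).continuous.measurable.prodMk (measurable_fderiv ℝ (P k)))
    fun i j hij x hx => ((disjoint_disjointed S hij).notMem_of_mem_left hx.1 hx.2).elim
  refine ⟨fun x => (g x).1, fun x => (g x).2, hg.fst, hg.snd, ?_⟩
  have hgood (k : ℕ) := (ae_restrict_iff' (hmeas k)).1 (ae_hasQuadExpansion_of_lipschitzWith μ
    (hPlip k) (hmeas k) hΩ (hSΩ k) (by positivity) (hP k))
  filter_upwards [hae, ae_restrict_of_ae (ae_all_iff.2 hgood)] with x ⟨M, hM⟩ hx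
  rw [← iUnion_disjointed] at hSx
  obtain ⟨k, hk⟩ := Set.mem_iUnion.1 (hSx x M hM)
  rw [hgP k hk]
  exact hx k (disjointed_subset S k hk)

end PointwiseDerivatives

section TwoSidedDecay

theorem exists_continuous_eqOn_of_isClosed {X : Type*} [TopologicalSpace X] [NormalSpace X]
    {s : Set X} {u : X → ℝ} (hs : IsClosed s) (hu : ContinuousOn u s) :
    ∃ v, Continuous v ∧ Set.EqOn u v s := by
  obtain ⟨v, hv⟩ := ContinuousMap.exists_restrict_eq hs ⟨s.domRestrict u, hu.domRestrict⟩
  exact ⟨v, v.continuous, fun x hx => (DFunLike.congr_fun hv ⟨x, hx⟩).symm⟩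

variable {E : Type*} [NormedAddCommGroup E] [InnerProductSpace ℝ E] {u v : E → ℝ} {B V : Set E}
  {a c : ℝ}

theorem touchSet_const_mul_subset (hc : 0 ≤ c) :
    touchSet B u a ⊆ touchSet B (fun y => c * u y) (c * a) :=
  fun _ ⟨hx, p, hp⟩ => ⟨hx, c • p, hp.const_mul hc⟩

theorem touchSet_inter_subset (hVB : V ⊆ B) (huv : Set.EqOn u v B) :
    touchSet B u a ∩ V ⊆ touchSet V v a := by
  rintro x ⟨⟨hxB, p, hp⟩, hxV⟩
  refine ⟨hxV, p, fun y hy => ?_⟩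
  rw [← huv (hVB hy), ← huv hxB]
  exact hp.mono_set hVB y hy

variable [FiniteDimensional ℝ E] [MeasurableSpace E] [BorelSpace E] (μ : Measure E)
  [μ.IsAddHaarMeasure] {lam Lam : ℝ}

theorem exists_measure_touchSet_decay_of_continuousOn (hlam : 0 < lam) (hLam : 0 ≤ Lam) :
    ∃ T κ C q : ℝ, 0 < T ∧ 1 < κ ∧ 0 ≤ C ∧ 0 < q ∧ q < 1 ∧
      ∀ u : E → ℝ, ∀ K : ℝ, 0 < K → ContinuousOn u (closedBall 0 1) →
        (∀ y ∈ closedBall 0 1, |u y| ≤ K) → SubjetBound lam Lam K (ball 0 1) u →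
        ∀ k : ℕ, μ (ball 0 1 \ touchSet (ball 0 1) u (K * (T * κ ^ k)))
          ≤ ENNReal.ofReal (C * q ^ k) := by
  obtain ⟨T, κ, C, q, hT, hκ, hC, hq0, hq1, H⟩ := exists_measure_touchSet_decay μ hlam hLam
  refine ⟨T, κ, C, q, hT, hκ, hC, hq0, hq1, fun u K hK huc huK hu k => ?_⟩
  obtain ⟨v, hvc, huv⟩ := exists_continuous_eqOn_of_isClosed isClosed_closedBall huc
  have hv1 : ∀ y ∈ closedBall 0 1, |K⁻¹ * v y| ≤ 1 := fun y hy => by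
    rw [← huv hy, abs_mul, abs_of_pos (inv_pos.2 hK), inv_mul_le_iff₀ hK, mul_one]
    exact huK y hy
  have hv : SubjetBound lam Lam 1 (ball 0 1) fun y => K⁻¹ * v y := by
    have := (hu.congr isOpen_ball (huv.mono ball_subset_closedBall)).const_mul (inv_pos.2 hK)
    rwa [inv_mul_cancel₀ hK.ne'] at this
  have hKv : Set.EqOn (fun y => K * (K⁻¹ * v y)) u (closedBall 0 1) := fun y hy => by
    rw [huv hy]
    exact mul_inv_cancel_left₀ hK.ne' _
  refine (H _ (by fun_prop) hv1 hv k).trans' (measure_mono fun x hx => ⟨hx.1, fun ht => hx.2 ?_⟩)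
  exact touchSet_inter_subset ball_subset_closedBall hKv
    ⟨touchSet_const_mul_subset hK.le ht, hx.1⟩

theorem exists_measure_twoSidedTouchSet_decay (hlam : 0 < lam) (hLam : 0 ≤ Lam) :
    ∃ T κ C q : ℝ, 0 < T ∧ 1 < κ ∧ 0 < q ∧ q < 1 ∧
      ∀ u : E → ℝ, ∀ K : ℝ, 0 < K → ContinuousOn u (closedBall 0 1) →
        (∀ y ∈ closedBall 0 1, |u y| ≤ K) → SubjetBound lam Lam K (ball 0 1) u →
        SubjetBound lam Lam K (ball 0 1) (-u) →
        ∀ k : ℕ, μ (ball 0 1 \ twoSidedTouchSet (ball 0 1) u (K * (T * κ ^ k)))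
          ≤ ENNReal.ofReal (C * q ^ k) := by
  obtain ⟨T, κ, C, q, hT, hκ, hC, hq0, hq1, H⟩ :=
    exists_measure_touchSet_decay_of_continuousOn μ hlam hLam
  refine ⟨T, κ, C + C, q, hT, hκ, hq0, hq1, fun u K hK huc huK hu hu' k => ?_⟩
  rw [twoSidedTouchSet, Set.sdiff_inter, add_mul,
    ENNReal.ofReal_add (by positivity) (by positivity)]
  exact (measure_union_le _ _).trans (add_le_add (H u K hK huc huK hu k)
    (H (-u) K hK huc.neg (fun y hy => by simpa using huK y hy) hu' k))

end TwoSidedDecay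

section LayerCake

variable {α : Type*} {Θ : α → ℝ≥0∞} {C m κ q : ℝ≥0∞} {δ : ℝ}

/-- With `k` the least index such that `Θ x ≤ m * κ ^ k`, the value `Θ x ^ δ` is one of the terms:
the constant for `k = 0`, the one of index `k - 1` otherwise. -/
theorem rpow_le_add_tsum_indicator (hm : m ≠ 0) (hκ : 1 ≤ κ) (hδ : 0 ≤ δ) {S : ℕ → Set α}
    (hS : ∀ k, {x | m * κ ^ k < Θ x} ⊆ S k) (x : α) :
    Θ x ^ δ ≤ m ^ δ + ∑' k, (S k).indicator (fun _ => (m * κ ^ (k + 1)) ^ δ) x := by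
  classical
  by_cases hex : ∃ k, Θ x ≤ m * κ ^ k
  · rcases hfind : Nat.find hex with _ | k
    · have hle := Nat.find_spec hex
      rw [hfind, pow_zero, mul_one] at hle
      exact le_add_right (by gcongr)
    · have hle := Nat.find_spec hex
      rw [hfind] at hle
      have hk : x ∈ S k := hS k (not_le.1 (Nat.find_min hex (hfind ▸ k.lt_succ_self)))
      refine le_add_left ((ENNReal.le_tsum k).trans' ?_)
      rw [Set.indicator_of_mem hk]
      gcongr
  · have hterm (k : ℕ) : m ^ δ ≤ (S k).indicator (fun _ => (m * κ ^ (k + 1)) ^ δ) x := by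
      rw [Set.indicator_of_mem (hS k (not_le.1 fun h => hex ⟨k, h⟩))]
      gcongr
      exact le_mul_of_one_le_right' (one_le_pow₀ hκ)
    have hmδ : m ^ δ ≠ 0 := by simp [ENNReal.rpow_eq_zero_iff, hm, hδ.not_gt]
    refine le_add_left (le_top.trans ?_)
    rw [← ENNReal.tsum_const_eq_top_of_ne_zero hmδ (α := ℕ)]
    exact ENNReal.tsum_le_tsum hterm

theorem lintegral_rpow_le_of_measure_lt_le [MeasurableSpace α] {ν : Measure α} (hm : m ≠ 0)
    (hκ : 1 ≤ κ) (hδ : 0 ≤ δ) (h : ∀ k : ℕ, ν {x | m * κ ^ k < Θ x} ≤ C * q ^ k) :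
    ∫⁻ x, Θ x ^ δ ∂ν ≤ m ^ δ * (ν Set.univ + κ ^ δ * C * (1 - κ ^ δ * q)⁻¹) := by
  set S : ℕ → Set α := fun k => toMeasurable ν {x | m * κ ^ k < Θ x}
  have hS (k : ℕ) : MeasurableSet (S k) := measurableSet_toMeasurable _ _
  have hpow (k : ℕ) : (κ ^ (k + 1)) ^ δ = κ ^ δ * (κ ^ δ) ^ k := by
    rw [← ENNReal.rpow_natCast_mul, ← pow_succ', ← ENNReal.rpow_mul_natCast, mul_comm]
  calc ∫⁻ x, Θ x ^ δ ∂ν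
      ≤ ∫⁻ x, (m ^ δ + ∑' k, (S k).indicator (fun _ => (m * κ ^ (k + 1)) ^ δ) x) ∂ν :=
        lintegral_mono (rpow_le_add_tsum_indicator hm hκ hδ fun k => subset_toMeasurable _ _)
    _ = m ^ δ * ν Set.univ + ∑' k, (m * κ ^ (k + 1)) ^ δ * ν {x | m * κ ^ k < Θ x} := by
        rw [lintegral_add_left measurable_const, lintegral_const,
          lintegral_tsum fun k => (measurable_const.indicator (hS k)).aemeasurable]
        simp only [lintegral_indicator_const (hS _), S, measure_toMeasurable]
    _ ≤ m ^ δ * ν Set.univ + ∑' k, m ^ δ * (κ ^ δ * C) * (κ ^ δ * q) ^ k := by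
        refine add_le_add le_rfl (ENNReal.tsum_le_tsum fun k => ?_)
        calc (m * κ ^ (k + 1)) ^ δ * ν {x | m * κ ^ k < Θ x}
            ≤ (m * κ ^ (k + 1)) ^ δ * (C * q ^ k) := by gcongr; exact h k
          _ = m ^ δ * (κ ^ δ * C) * (κ ^ δ * q) ^ k := by
            rw [ENNReal.mul_rpow_of_nonneg _ _ hδ, hpow]
            ring
    _ = m ^ δ * (ν Set.univ + κ ^ δ * C * (1 - κ ^ δ * q)⁻¹) := by
        rw [ENNReal.tsum_mul_left, ENNReal.tsum_geometric]
        ring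

theorem ae_lt_top_of_measure_lt_le [MeasurableSpace α] {ν : Measure α} (hm : m ≠ ⊤) (hκ : κ ≠ ⊤)
    (hC : C ≠ ⊤) (hq : q < 1) (h : ∀ k : ℕ, ν {x | m * κ ^ k < Θ x} ≤ C * q ^ k) :
    ∀ᵐ x ∂ν, Θ x < ⊤ := by
  have hlim : Filter.Tendsto (fun k : ℕ => C * q ^ k) Filter.atTop (𝓝 (C * 0)) :=
    ENNReal.Tendsto.const_mul (ENNReal.tendsto_pow_atTop_nhds_zero_of_lt_one hq) (.inr hC)
  rw [mul_zero] at hlim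
  refine le_antisymm (ge_of_tendsto' hlim fun k => (h k).trans' (measure_mono fun x hx => ?_))
    zero_le
  exact (ENNReal.mul_lt_top hm.lt_top (ENNReal.pow_lt_top hκ.lt_top)).trans_le (not_lt.1 hx)

end LayerCake

section Coordinates

variable {n : ℕ} {u v : EuclideanSpace ℝ (Fin n) → ℝ} {Ω : Set (EuclideanSpace ℝ (Fin n))}
  {x p : EuclideanSpace ℝ (Fin n)} {A : Matrix (Fin n) (Fin n) ℝ} {K M : ℝ}

theorem hasSecondOrderExpansionAt_iff :
    HasSecondOrderExpansionAt u x p A ↔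
      A.IsSymm ∧ HasQuadExpansion u x p (Matrix.toEuclideanCLM (𝕜 := ℝ) A) := by
  refine and_congr_right fun _ => ?_
  have (y : EuclideanSpace ℝ (Fin n)) : u y - u x - ∑ i, p i * (y i - x i)
      - 1 / 2 * ∑ i, ∑ j, A i j * (y i - x i) * (y j - x j)
      = u y - quadPoly (u x) x p (Matrix.toEuclideanCLM (𝕜 := ℝ) A) y := by
    have hquad : ∑ i, ∑ j, A i j * (y i - x i) * (y j - x j)
        = inner ℝ (Matrix.toEuclideanCLM (𝕜 := ℝ) A (y - x)) (y - x) := by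
      rw [real_inner_comm, Matrix.inner_toEuclideanCLM, dotProduct]
      refine Finset.sum_congr rfl fun i _ => ?_
      rw [Matrix.mulVec, dotProduct, Finset.mul_sum]
      refine Finset.sum_congr rfl fun j _ => ?_
      simp only [PiLp.sub_apply]
      ring
    have hlin : ∑ i, p i * (y i - x i) = inner ℝ p (y - x) := by
      simp [PiLp.inner_apply, mul_comm]
    rw [hquad, hlin, quadPoly]
    ring
  simp only [this, HasQuadExpansion]

theorem toEuclideanCLM_single_apply (A : Matrix (Fin n) (Fin n) ℝ) (i j : Fin n) :
    Matrix.toEuclideanCLM (𝕜 := ℝ) A (EuclideanSpace.single j 1) i = A i j := by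
  simp

theorem norm_entry_le_norm_toEuclideanCLM (A : Matrix (Fin n) (Fin n) ℝ) (i j : Fin n) :
    ‖A i j‖ ≤ ‖Matrix.toEuclideanCLM (n := Fin n) (𝕜 := ℝ) A‖ :=
  calc ‖A i j‖ ≤ ‖Matrix.toEuclideanCLM (𝕜 := ℝ) A (EuclideanSpace.single j 1)‖ := by
        rw [← toEuclideanCLM_single_apply A i j]
        exact PiLp.norm_apply_le _ i
    _ ≤ ‖Matrix.toEuclideanCLM (n := Fin n) (𝕜 := ℝ) A‖ := by
        simpa using (Matrix.toEuclideanCLM (𝕜 := ℝ) A).le_opNorm (EuclideanSpace.single j 1)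

theorem HasQuadExpansion.congr {E : Type*} [NormedAddCommGroup E] [InnerProductSpace ℝ E]
    {u v : E → ℝ} {x p : E} {L : E →L[ℝ] E} (h : HasQuadExpansion u x p L) (huv : u =ᶠ[𝓝 x] v) :
    HasQuadExpansion v x p L := by
  refine IsLittleO.congr' h ?_ Filter.EventuallyEq.rfl
  filter_upwards [huv] with y hy
  rw [hy, huv.eq_of_nhds]

theorem exists_isGradHess (hΩ : IsOpen Ω) (huc : ContinuousOn u (closure Ω))
    (hu : ∀ y ∈ Ω, |u y| ≤ K) (hae : ∀ᵐ x ∂volume.restrict Ω, ∃ M, x ∈ twoSidedTouchSet Ω u M) :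
    ∃ Du D2u, IsGradHess Ω u Du D2u := by
  obtain ⟨v, hvc, huv⟩ := exists_continuous_eqOn_of_isClosed isClosed_closure huc
  replace huv : Set.EqOn u v Ω := huv.mono subset_closure
  have haev : ∀ᵐ x ∂volume.restrict Ω, ∃ M, x ∈ twoSidedTouchSet Ω v M :=
    hae.mono fun x ⟨M, hx, hx'⟩ => ⟨M, touchSet_inter_subset subset_rfl huv ⟨hx, hx.1⟩,
      touchSet_inter_subset subset_rfl (fun y hy => congrArg Neg.neg (huv hy)) ⟨hx', hx.1⟩⟩
  obtain ⟨P, L, hP, hL, hexp⟩ := exists_measurable_hasQuadExpansion volume hΩ hvc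
    (fun y hy => huv hy ▸ hu y hy) haev
  choose A hA using fun x =>
    EquivLike.surjective (Matrix.toEuclideanCLM (n := Fin n) (𝕜 := ℝ)) (L x)
  refine ⟨P, A, fun i => ?_, fun i j => ?_, ?_⟩
  · exact ((EuclideanSpace.proj (𝕜 := ℝ) i).measurable.comp hP).aemeasurable
  · have hcoord : (fun x => A x i j) = fun x => L x (EuclideanSpace.single j 1) i := by
      simp only [← hA, toEuclideanCLM_single_apply]
    rw [hcoord]
    exact (EuclideanSpace.proj (𝕜 := ℝ) i).measurable.comp
      (hL.apply_continuousLinearMap _) |>.aemeasurable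
  · filter_upwards [hexp, ae_restrict_mem hΩ.measurableSet] with x ⟨hx, hsymm⟩ hxΩ
    rw [← hA] at hx hsymm
    exact hasSecondOrderExpansionAt_iff.2 ⟨Matrix.isSymmetric_toEuclideanLin_iff.1 hsymm,
      hx.congr (huv.symm.eventuallyEq_of_mem (hΩ.mem_nhds hxΩ))⟩

theorem paraboloidOpening_eq_iInf (u : EuclideanSpace ℝ (Fin n) → ℝ)
    (Ω : Set (EuclideanSpace ℝ (Fin n))) (x : EuclideanSpace ℝ (Fin n)) :
    paraboloidOpening u Ω x = ⨅ (M : ℝ≥0) (_ : x ∈ twoSidedTouchSet Ω u M), (M : ℝ≥0∞) := by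
  have hiff (M : ℝ≥0) : ((∃ p, TouchesFromBelow
        (fun y => u x + inner ℝ p (y - x) - (M : ℝ) / 2 * ‖y - x‖ ^ 2) u x Ω) ∧
      ∃ q, TouchesFromBelow
        u (fun y => u x + inner ℝ q (y - x) + (M : ℝ) / 2 * ‖y - x‖ ^ 2) x Ω) ↔
      x ∈ twoSidedTouchSet Ω u M := by
    refine and_congr ⟨fun ⟨p, hp⟩ => ⟨hp.1, p, hp.2.2⟩, fun ⟨hx, p, hp⟩ => ⟨p, hx, by simp, hp⟩⟩
      ⟨fun ⟨p, hp⟩ => ⟨hp.1, -p, fun y hy => ?_⟩,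
        fun ⟨hx, p, hp⟩ => ⟨-p, hx, by simp, fun y hy => ?_⟩⟩
    · have := hp.2.2 y hy
      simp only [Pi.neg_apply, inner_neg_left]
      linarith
    · have := hp y hy
      simp only [Pi.neg_apply] at this
      simp only [inner_neg_left]
      linarith
  simp only [paraboloidOpening, hiff]

theorem paraboloidOpening_le (hM : 0 ≤ M) (hx : x ∈ twoSidedTouchSet Ω u M) :
    paraboloidOpening u Ω x ≤ ENNReal.ofReal M := by
  lift M to ℝ≥0 using hM
  rw [paraboloidOpening_eq_iInf, ENNReal.ofReal_coe_nnreal]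
  exact iInf₂_le M hx

theorem exists_mem_twoSidedTouchSet_of_paraboloidOpening_lt_top
    (h : paraboloidOpening u Ω x < ⊤) : ∃ M, x ∈ twoSidedTouchSet Ω u M := by
  rw [paraboloidOpening_eq_iInf] at h
  simp only [iInf_lt_iff] at h
  obtain ⟨M, hM, -⟩ := h
  exact ⟨M, hM⟩

theorem HasSecondOrderExpansionAt.enorm_hess_le (h : HasSecondOrderExpansionAt u x p A)
    (hΩ : Ω ∈ 𝓝 x) (i j : Fin n) : ‖A i j‖ₑ ≤ paraboloidOpening u Ω x := by
  rw [hasSecondOrderExpansionAt_iff] at h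
  rw [paraboloidOpening_eq_iInf]
  refine le_iInf₂ fun M hM => ?_
  obtain ⟨q, hq⟩ := exists_touchesBothSides_of_mem hM hΩ
  obtain rfl := hq.eq_of_hasQuadExpansion hΩ h.2
  rw [enorm_le_coe]
  exact (norm_entry_le_norm_toEuclideanCLM A i j).trans
    (hq.norm_le_of_hasQuadExpansion M.2 hΩ h.2 (Matrix.isSymmetric_toEuclideanLin_iff.2 h.1))

theorem HasSecondOrderExpansionAt.enorm_grad_le
    (h : HasSecondOrderExpansionAt u x p A) (hx : x ∈ ball 0 1) (hu : ∀ y ∈ ball 0 1, |u y| ≤ K) :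
    ‖p‖ₑ ≤ 4 * (ENNReal.ofReal K + paraboloidOpening u (ball 0 1) x) := by
  rw [hasSecondOrderExpansionAt_iff] at h
  have hB := isOpen_ball.mem_nhds hx
  have hK : 0 ≤ K := (abs_nonneg _).trans (hu x hx)
  rw [mul_comm, ← ENNReal.div_le_iff_le_mul (by simp) (by simp), ← tsub_le_iff_left,
    paraboloidOpening_eq_iInf]
  refine le_iInf₂ fun M hM => ?_
  rw [tsub_le_iff_left, ENNReal.div_le_iff_le_mul (by simp) (by simp)]
  obtain ⟨q, hq⟩ := exists_touchesBothSides_of_mem hM hB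
  obtain rfl := hq.eq_of_hasQuadExpansion hB h.2
  have hslope := hq.norm_slope_mul_le (c := 0) (r := 1 / 2) (R := 2) hu M.2 (by norm_num)
    (closedBall_subset_ball (by norm_num)) fun y hy => by
      rw [mem_closedBall]
      linarith [dist_triangle_right y x 0, mem_ball.1 hx, mem_ball.1 hy]
  calc ‖p‖ₑ = ENNReal.ofReal ‖p‖ := (ofReal_norm p).symm
    _ ≤ ENNReal.ofReal (4 * (K + M)) := ENNReal.ofReal_le_ofReal (by linarith)
    _ = (ENNReal.ofReal K + M) * 4 := by
      rw [ENNReal.ofReal_mul (by norm_num), ENNReal.ofReal_add hK M.coe_nonneg,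
        ENNReal.ofReal_coe_nnreal, ENNReal.ofReal_ofNat, mul_comm]

end Coordinates

section LpBounds

variable {α : Type*} [MeasurableSpace α] {ν : Measure α} {g : α → ℝ} {s t : Set α} {δ K : ℝ}
  {a b c : ℝ≥0∞}

theorem memLp_ofReal_of_lintegral_lt_top (hg : AEStronglyMeasurable g ν) (hδ : 0 < δ)
    (h : ∫⁻ x, ‖g x‖ₑ ^ δ ∂ν < ⊤) : MemLp g (ENNReal.ofReal δ) ν := by
  refine ⟨hg, ?_⟩
  rwa [eLpNorm_lt_top_iff_lintegral_rpow_enorm_lt_top (by simpa using hδ) ENNReal.ofReal_ne_top,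
    ENNReal.toReal_ofReal hδ.le]

theorem setLIntegral_enorm_rpow_le (hδ : 0 ≤ δ) (hg : ∀ x ∈ s, |g x| ≤ K) :
    ∫⁻ x in s, ‖g x‖ₑ ^ δ ∂ν ≤ ENNReal.ofReal K ^ δ * ν s := by
  rw [← setLIntegral_const]
  refine setLIntegral_mono measurable_const fun x hx => ?_
  rw [Real.enorm_eq_ofReal_abs]
  gcongr
  exact hg x hx

theorem abs_le_of_eLpNorm_top_le [TopologicalSpace α] [OpensMeasurableSpace α]
    [ν.IsOpenPosMeasure] (hs : IsOpen s) (hg : ContinuousOn g s) (hK : 0 ≤ K)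
    (h : eLpNorm g ∞ (ν.restrict s) ≤ ENNReal.ofReal K) : ∀ x ∈ s, |g x| ≤ K := by
  have hopen : IsOpen (s ∩ (fun x => |g x|) ⁻¹' Set.Ioi K) :=
    hg.abs.isOpen_inter_preimage hs isOpen_Ioi
  have hae : ∀ᵐ x ∂ν.restrict s, |g x| ≤ K := by
    rw [eLpNorm_exponent_top] at h
    filter_upwards [enorm_ae_le_eLpNormEssSup g (ν.restrict s)] with x hx
    rw [← ENNReal.ofReal_le_ofReal_iff hK, ← Real.enorm_eq_ofReal_abs]
    exact hx.trans h
  have hnull : ν (s ∩ (fun x => |g x|) ⁻¹' Set.Ioi K) = 0 := by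
    refine measure_mono_null ?_ (ae_iff.1 ((ae_restrict_iff' hs.measurableSet).1 hae))
    exact fun x ⟨hx, hlt⟩ himp => not_le.2 hlt (himp hx)
  rw [hopen.measure_eq_zero_iff ν] at hnull
  exact fun x hx => not_lt.1 fun hlt => Set.eq_empty_iff_forall_notMem.1 hnull x ⟨hx, hlt⟩

theorem eLpNorm_top_restrict_ne_top_of_isCompact [TopologicalSpace α] (hs : IsCompact s)
    (hg : ContinuousOn g s) (hts : t ⊆ s) (ht : MeasurableSet t) :
    eLpNorm g ∞ (ν.restrict t) ≠ ⊤ := by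
  obtain ⟨K, hK⟩ := hs.exists_bound_of_continuousOn hg
  rw [eLpNorm_exponent_top]
  refine (eLpNormEssSup_lt_top_of_ae_bound (C := K) ?_).ne
  filter_upwards [ae_restrict_mem ht] with x hx using hK x (hts hx)

theorem le_mul_of_forall_toReal_lt (ha : a ≠ ⊤) (hb : b ≠ ⊤)
    (h : ∀ K : ℝ, b.toReal < K → c ≤ a * ENNReal.ofReal K) : c ≤ a * b := by
  have hlim : Filter.Tendsto (fun K => a * ENNReal.ofReal K) (𝓝[>] b.toReal) (𝓝 (a * b)) := by
    conv_rhs => rw [← ENNReal.ofReal_toReal hb]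
    exact ENNReal.Tendsto.const_mul
      (ENNReal.continuous_ofReal.continuousWithinAt.tendsto) (.inr ha)
  exact ge_of_tendsto hlim (Filter.eventually_of_mem self_mem_nhdsWithin h)

end LpBounds

section SobolevEstimate

variable {n : ℕ} {u f : EuclideanSpace ℝ (Fin n) → ℝ} {Ω : Set (EuclideanSpace ℝ (Fin n))}
  {Du : EuclideanSpace ℝ (Fin n) → EuclideanSpace ℝ (Fin n)}
  {D2u : EuclideanSpace ℝ (Fin n) → Matrix (Fin n) (Fin n) ℝ} {lam Lam γ δ K : ℝ} {a b c : ℝ≥0∞}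

theorem IsGradHess.memSobolevTwo (h : IsGradHess Ω u Du D2u) (hδ : 0 < δ)
    (hu : AEStronglyMeasurable u (volume.restrict Ω)) (h₀ : ∫⁻ x in Ω, ‖u x‖ₑ ^ δ < ⊤)
    (h₁ : ∀ i, ∫⁻ x in Ω, ‖Du x i‖ₑ ^ δ < ⊤) (h₂ : ∀ i j, ∫⁻ x in Ω, ‖D2u x i j‖ₑ ^ δ < ⊤) :
    MemSobolevTwo δ Ω u :=
  ⟨Du, D2u, h, memLp_ofReal_of_lintegral_lt_top hu hδ h₀,
    fun i => memLp_ofReal_of_lintegral_lt_top (h.1 i).aestronglyMeasurable hδ (h₁ i),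
    fun i j => memLp_ofReal_of_lintegral_lt_top (h.2 i j).aestronglyMeasurable hδ (h₂ i j)⟩

theorem IsGradHess.sobolevTwoNorm_le (h : IsGradHess Ω u Du D2u) (hδ : 0 ≤ δ)
    (h₀ : ∫⁻ x in Ω, ‖u x‖ₑ ^ δ ≤ a) (h₁ : ∀ i, ∫⁻ x in Ω, ‖Du x i‖ₑ ^ δ ≤ b)
    (h₂ : ∀ i j, ∫⁻ x in Ω, ‖D2u x i j‖ₑ ^ δ ≤ c) :
    sobolevTwoNorm δ Ω u ≤ (a + n * b + n * (n * c)) ^ (1 / δ) := by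
  refine (iInf_le_of_le Du (iInf₂_le D2u h)).trans ?_
  have hn (d : ℝ≥0∞) : ∑ _i : Fin n, d = n * d := by simp
  rw [← hn b, ← hn c, ← hn]
  gcongr with i _ i _ j _
  exacts [h₁ i, h₂ i j]

theorem IsGradHess.lintegral_hess_le (h : IsGradHess Ω u Du D2u) (hΩ : IsOpen Ω) (hδ : 0 ≤ δ)
    (i j : Fin n) :
    ∫⁻ x in Ω, ‖D2u x i j‖ₑ ^ δ ≤ ∫⁻ x in Ω, paraboloidOpening u Ω x ^ δ := by
  refine lintegral_mono_ae ?_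
  filter_upwards [h.expansion, ae_restrict_mem hΩ.measurableSet] with x hx hxΩ
  gcongr
  exact hx.enorm_hess_le (hΩ.mem_nhds hxΩ) i j

theorem IsGradHess.lintegral_grad_le (h : IsGradHess (ball 0 1) u Du D2u) (hδ0 : 0 ≤ δ)
    (hδ1 : δ ≤ 1) (hu : ∀ x ∈ ball 0 1, |u x| ≤ K) (i : Fin n) :
    ∫⁻ x in ball 0 1, ‖Du x i‖ₑ ^ δ
      ≤ 4 * (ENNReal.ofReal K ^ δ * volume (ball (0 : EuclideanSpace ℝ (Fin n)) 1)
        + ∫⁻ x in ball 0 1, paraboloidOpening u (ball 0 1) x ^ δ) := by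
  rw [← setLIntegral_const, ← lintegral_add_left measurable_const,
    ← lintegral_const_mul' _ _ ENNReal.ofNat_ne_top]
  refine lintegral_mono_ae ?_
  filter_upwards [h.expansion, ae_restrict_mem measurableSet_ball] with x hx hxB
  have hi : ‖Du x i‖ₑ ≤ ‖Du x‖ₑ := enorm_le_iff_norm_le.2 (PiLp.norm_apply_le _ i)
  calc ‖Du x i‖ₑ ^ δ
      ≤ (4 * (ENNReal.ofReal K + paraboloidOpening u (ball 0 1) x)) ^ δ := by
        gcongr
        exact hi.trans (hx.enorm_grad_le hxB hu)
    _ = 4 ^ δ * (ENNReal.ofReal K + paraboloidOpening u (ball 0 1) x) ^ δ :=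
        ENNReal.mul_rpow_of_nonneg _ _ hδ0
    _ ≤ 4 ^ (1 : ℝ) * (ENNReal.ofReal K ^ δ + paraboloidOpening u (ball 0 1) x ^ δ) :=
        mul_le_mul' (ENNReal.rpow_le_rpow_of_exponent_le (by norm_num) hδ1)
          (ENNReal.rpow_add_le_add_rpow _ _ hδ0 hδ1)
    _ = 4 * (ENNReal.ofReal K ^ δ + paraboloidOpening u (ball 0 1) x ^ δ) := by
        rw [ENNReal.rpow_one]

theorem exists_integrability_exponent {κ q : ℝ} (hκ : 1 < κ) (hq0 : 0 < q) (hq1 : q < 1) :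
    ∃ σ : ℝ, 0 < σ ∧ σ ≤ 1 ∧ ∀ δ < σ, κ ^ δ * q < 1 := by
  have hlogκ : 0 < Real.log κ := Real.log_pos hκ
  have hlogq : 0 < -Real.log q := neg_pos.2 (Real.log_neg hq0 hq1)
  have hκ0 : 0 < κ := one_pos.trans hκ
  refine ⟨min 1 (-Real.log q / Real.log κ), lt_min one_pos (div_pos hlogq hlogκ),
    min_le_left _ _, fun δ hδ => ?_⟩
  have hδ' : δ * Real.log κ < -Real.log q :=
    (lt_div_iff₀ hlogκ).1 (hδ.trans_le (min_le_right _ _))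
  rw [← Real.log_neg_iff (by positivity), Real.log_mul (by positivity) hq0.ne', Real.log_rpow hκ0]
  linarith

theorem exists_lintegral_paraboloidOpening_rpow_le (n : ℕ) (hlam : 0 < lam) (hLam : 0 ≤ Lam) :
    ∃ σ : ℝ, 0 < σ ∧ σ ≤ 1 ∧ ∀ δ, 0 < δ → δ < σ → ∃ a : ℝ≥0∞, a ≠ ⊤ ∧
      ∀ (u : EuclideanSpace ℝ (Fin n) → ℝ) (K : ℝ), 0 < K → ContinuousOn u (closedBall 0 1) →
        (∀ y ∈ closedBall 0 1, |u y| ≤ K) → SubjetBound lam Lam K (ball 0 1) u →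
        SubjetBound lam Lam K (ball 0 1) (-u) →
        (∀ᵐ x ∂volume.restrict (ball 0 1), paraboloidOpening u (ball 0 1) x < ⊤) ∧
          ∫⁻ x in ball 0 1, paraboloidOpening u (ball 0 1) x ^ δ ≤ ENNReal.ofReal K ^ δ * a := by
  obtain ⟨T, κ, C, q, hT, hκ, hq0, hq1, H⟩ := exists_measure_twoSidedTouchSet_decay
    (volume : Measure (EuclideanSpace ℝ (Fin n))) hlam hLam
  obtain ⟨σ, hσ0, hσ1, hσ⟩ := exists_integrability_exponent hκ hq0 hq1
  have hκ0 : 0 < κ := one_pos.trans hκ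
  refine ⟨σ, hσ0, hσ1, fun δ hδ0 hδσ => ⟨ENNReal.ofReal T ^ δ *
    (volume (ball (0 : EuclideanSpace ℝ (Fin n)) 1) + ENNReal.ofReal κ ^ δ * ENNReal.ofReal C
      * (1 - ENNReal.ofReal κ ^ δ * ENNReal.ofReal q)⁻¹), ?_, fun u K hK huc hu hsub hsup => ?_⟩⟩
  · have hlt : ENNReal.ofReal κ ^ δ * ENNReal.ofReal q < 1 := by
      rw [ENNReal.ofReal_rpow_of_pos hκ0, ← ENNReal.ofReal_mul (by positivity),
        ENNReal.ofReal_lt_one]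
      exact hσ δ hδσ
    have hinv : (1 - ENNReal.ofReal κ ^ δ * ENNReal.ofReal q)⁻¹ ≠ ⊤ :=
      ENNReal.inv_ne_top.2 (tsub_pos_of_lt hlt).ne'
    have hV : volume (ball (0 : EuclideanSpace ℝ (Fin n)) 1) ≠ ⊤ := measure_ball_lt_top.ne
    finiteness
  · have hdecay (k : ℕ) : volume.restrict (ball 0 1)
        {x | ENNReal.ofReal (K * T) * ENNReal.ofReal κ ^ k < paraboloidOpening u (ball 0 1) x}
        ≤ ENNReal.ofReal C * ENNReal.ofReal q ^ k := by
      rw [Measure.restrict_apply' measurableSet_ball, ← ENNReal.ofReal_pow hκ0.le,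
        ← ENNReal.ofReal_mul (by positivity), mul_assoc, ← ENNReal.ofReal_pow hq0.le,
        ← ENNReal.ofReal_mul' (by positivity)]
      refine (measure_mono ?_).trans (H u K hK huc hu hsub hsup k)
      exact fun x ⟨hlt, hx⟩ =>
        ⟨hx, fun hmem => hlt.not_ge (paraboloidOpening_le (by positivity) hmem)⟩
    refine ⟨ae_lt_top_of_measure_lt_le ENNReal.ofReal_ne_top ENNReal.ofReal_ne_top
      ENNReal.ofReal_ne_top (ENNReal.ofReal_lt_one.2 hq1) hdecay, ?_⟩
    refine (lintegral_rpow_le_of_measure_lt_le (ENNReal.ofReal_pos.2 (by positivity)).ne'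
      (ENNReal.one_le_ofReal.2 hκ.le) hδ0.le hdecay).trans_eq ?_
    rw [Measure.restrict_apply_univ, ENNReal.ofReal_mul hK.le,
      ENNReal.mul_rpow_of_nonneg _ _ hδ0.le, mul_assoc]

theorem exists_sobolevTwo_estimate (n : ℕ) (hlam : 0 < lam) (hLam : 0 ≤ Lam) :
    ∃ σ : ℝ, 0 < σ ∧ σ ≤ 1 ∧ ∀ δ, 0 < δ → δ < σ → ∃ C : ℝ, 0 < C ∧
      ∀ (u : EuclideanSpace ℝ (Fin n) → ℝ) (K : ℝ), 0 < K → ContinuousOn u (closedBall 0 1) →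
        (∀ y ∈ closedBall 0 1, |u y| ≤ K) → SubjetBound lam Lam K (ball 0 1) u →
        SubjetBound lam Lam K (ball 0 1) (-u) →
        MemSobolevTwo δ (ball 0 1) u ∧
          sobolevTwoNorm δ (ball 0 1) u ≤ ENNReal.ofReal C * ENNReal.ofReal K ∧
          (∫⁻ x in ball 0 1, paraboloidOpening u (ball 0 1) x ^ δ) ^ (1 / δ)
            ≤ ENNReal.ofReal C * ENNReal.ofReal K := by
  obtain ⟨σ, hσ0, hσ1, H⟩ := exists_lintegral_paraboloidOpening_rpow_le n hlam hLam
  refine ⟨σ, hσ0, hσ1, fun δ hδ0 hδσ => ?_⟩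
  obtain ⟨a, ha, H⟩ := H δ hδ0 hδσ
  set V := volume (ball (0 : EuclideanSpace ℝ (Fin n)) 1)
  have hV : V ≠ ⊤ := measure_ball_lt_top.ne
  set c := V + n * (4 * (V + a)) + n * (n * a) + a
  lift c ^ (1 / δ) to ℝ≥0 using by finiteness with C hC
  refine ⟨C + 1, by positivity, fun u K hK huc hu hsub hsup => ?_⟩
  set k := ENNReal.ofReal K ^ δ
  have hk : k ≠ ⊤ := by finiteness
  have hroot : (k * c) ^ (1 / δ) ≤ ENNReal.ofReal (C + 1) * ENNReal.ofReal K := by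
    rw [ENNReal.mul_rpow_of_nonneg _ _ (by positivity), ← ENNReal.rpow_mul,
      mul_one_div_cancel hδ0.ne', ENNReal.rpow_one, ← hC, mul_comm, ← ENNReal.ofReal_coe_nnreal]
    gcongr
    linarith
  have huB (y) (hy : y ∈ ball 0 1) : |u y| ≤ K := hu y (ball_subset_closedBall hy)
  obtain ⟨hfin, hΘ⟩ := H u K hK huc hu hsub hsup
  obtain ⟨Du, D2u, hD⟩ := exists_isGradHess isOpen_ball
    (closure_ball (0 : EuclideanSpace ℝ (Fin n)) one_ne_zero ▸ huc) huB
    (hfin.mono fun x hx => exists_mem_twoSidedTouchSet_of_paraboloidOpening_lt_top hx)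
  have h₀ : ∫⁻ x in ball 0 1, ‖u x‖ₑ ^ δ ≤ k * V := setLIntegral_enorm_rpow_le hδ0.le huB
  have h₁ (i) : ∫⁻ x in ball 0 1, ‖Du x i‖ₑ ^ δ ≤ 4 * (k * V + k * a) :=
    (hD.lintegral_grad_le hδ0.le (hδσ.le.trans hσ1) huB i).trans (by gcongr)
  have h₂ (i j) : ∫⁻ x in ball 0 1, ‖D2u x i j‖ₑ ^ δ ≤ k * a :=
    (hD.lintegral_hess_le isOpen_ball hδ0.le i j).trans hΘ
  refine ⟨hD.memSobolevTwo hδ0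
    ((huc.mono ball_subset_closedBall).aestronglyMeasurable measurableSet_ball)
    (h₀.trans_lt (by finiteness)) (fun i => (h₁ i).trans_lt (by finiteness))
    fun i j => (h₂ i j).trans_lt (by finiteness),
    (hD.sobolevTwoNorm_le hδ0.le h₀ h₁ h₂).trans (hroot.trans' ?_), hroot.trans' ?_⟩
  · gcongr
    calc k * V + n * (4 * (k * V + k * a)) + n * (n * (k * a))
        = k * (V + n * (4 * (V + a)) + n * (n * a)) := by ring
      _ ≤ k * c := by gcongr; exact le_self_add
  · gcongr
    exact hΘ.trans (by gcongr; exact le_add_self)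

theorem bounds_of_eLpNorm_add_rpow_le (hlam : 0 ≤ lam) (hLam : lam ≤ Lam) (hγ0 : 0 ≤ γ)
    (hγ1 : γ < 1) (hK : 0 < K) (huc : ContinuousOn u (closedBall 0 1))
    (hfc : ContinuousOn f (ball 0 1)) (hsup : IsViscositySupersol lam Lam γ (ball 0 1) f u)
    (hsub : IsViscositySubsol lam Lam γ (ball 0 1) f u)
    (hN : eLpNorm u ∞ (volume.restrict (ball 0 1))
      + eLpNorm f ∞ (volume.restrict (ball 0 1)) ^ (1 / (1 - γ)) ≤ ENNReal.ofReal K) :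
    (∀ y ∈ closedBall 0 1, |u y| ≤ K) ∧ SubjetBound lam Lam K (ball 0 1) u ∧
      SubjetBound lam Lam K (ball 0 1) (-u) := by
  have huB : ContinuousOn u (ball 0 1) := huc.mono ball_subset_closedBall
  have huK := abs_le_of_eLpNorm_top_le isOpen_ball huB hK.le (le_self_add.trans hN)
  have hfK : ∀ x ∈ ball 0 1, |f x| ≤ K ^ (1 - γ) := by
    refine abs_le_of_eLpNorm_top_le (ν := volume) isOpen_ball hfc (by positivity) ?_
    rw [← ENNReal.ofReal_rpow_of_pos hK, ← ENNReal.rpow_inv_le_iff (sub_pos.2 hγ1), ← one_div]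
    exact le_add_self.trans hN
  refine ⟨?_, hsup.subjetBound isOpen_ball huB hlam hLam hγ0 hγ1.le hK.le fun x hx =>
    (le_abs_self _).trans (hfK x hx), hsub.subjetBound_neg isOpen_ball huB hlam hLam hγ0 hγ1.le
      hK.le fun x hx => (neg_le_abs _).trans (hfK x hx)⟩
  rw [← closure_ball _ one_ne_zero] at huc ⊢
  exact fun x hx => le_on_closure huK huc.abs continuousOn_const hx

end SobolevEstimate

theorem theorem1p1 (n : ℕ) (hn : 1 ≤ n) (lam Lam : ℝ) (hlam : 0 < lam) (hLam : lam ≤ Lam) :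
    ∃ σ : ℝ, 0 < σ ∧ σ ≤ 1 ∧ ∀ δ : ℝ, 0 < δ → δ < σ →
      ∃ C : ℝ, 0 < C ∧ ∀ γ : ℝ, 0 ≤ γ → γ < 1 →
        ∀ u f : EuclideanSpace ℝ (Fin n) → ℝ,
          ContinuousOn u (closedBall 0 1) →
          ContinuousOn f (ball 0 1) →
          MemLp f ∞ (volume.restrict (ball 0 1)) →
          IsViscositySupersol lam Lam γ (ball 0 1) f u →
          IsViscositySubsol lam Lam γ (ball 0 1) f u →
          MemSobolevTwo δ (ball 0 1) u ∧
          sobolevTwoNorm δ (ball 0 1) u ≤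
            ENNReal.ofReal C * (eLpNorm u ∞ (volume.restrict (ball 0 1))
              + eLpNorm f ∞ (volume.restrict (ball 0 1)) ^ (1 / (1 - γ))) ∧
          (∫⁻ x in ball 0 1, paraboloidOpening u (ball 0 1) x ^ δ) ^ (1 / δ) ≤
            ENNReal.ofReal C * (eLpNorm u ∞ (volume.restrict (ball 0 1))
              + eLpNorm f ∞ (volume.restrict (ball 0 1)) ^ (1 / (1 - γ))) := by
  obtain ⟨σ, hσ0, hσ1, H⟩ := exists_sobolevTwo_estimate n hlam (hlam.le.trans hLam)
  refine ⟨σ, hσ0, hσ1, fun δ hδ0 hδσ => ?_⟩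
  obtain ⟨C, hC, H⟩ := H δ hδ0 hδσ
  refine ⟨C, hC, fun γ hγ0 hγ1 u f huc hfc hf hsup hsub => ?_⟩
  have hN : eLpNorm u ∞ (volume.restrict (ball 0 1))
      + eLpNorm f ∞ (volume.restrict (ball 0 1)) ^ (1 / (1 - γ)) ≠ ⊤ :=
    ENNReal.add_ne_top.2 ⟨eLpNorm_top_restrict_ne_top_of_isCompact
      (isCompact_closedBall 0 1) huc ball_subset_closedBall measurableSet_ball,
      ENNReal.rpow_ne_top_of_nonneg (one_div_nonneg.2 (sub_nonneg.2 hγ1.le)) hf.2.ne⟩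
  -- `H` needs `0 < K`, so `K` decreases to the norm, which may vanish.
  have key (K : ℝ) (hK : ENNReal.toReal _ < K) :=
    have hK0 : 0 < K := ENNReal.toReal_nonneg.trans_lt hK
    have ⟨huK, hbelow, habove⟩ := bounds_of_eLpNorm_add_rpow_le hlam.le hLam hγ0 hγ1 hK0 huc hfc
      hsup hsub ((ENNReal.le_ofReal_iff_toReal_le hN hK0.le).2 hK.le)
    H u K hK0 huc huK hbelow habove
  exact ⟨(key _ (lt_add_one _)).1,
    le_mul_of_forall_toReal_lt ENNReal.ofReal_ne_top hN fun K hK => (key K hK).2.1,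
    le_mul_of_forall_toReal_lt ENNReal.ofReal_ne_top hN fun K hK => (key K hK).2.2⟩
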